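/- For $\operatorname{Im}\tau>0$ let $\theta_1,\dots,\theta_4$ be the Jacobi theta functions with nome $e^{\mathrm i\pi\tau}$, $\theta_1(u|\tau)=2\sum_{k\ge0}(-1)^ke^{\mathrm i\pi\tau(k+1/2)^2}\sin((2k+1)u)$, $\theta_2(u|\tau)=2\sum_{k\ge0}e^{\mathrm i\pi\tau(k+1/2)^2}\cos((2k+1)u)$, $\theta_3(u|\tau)=1+2\sum_{k\ge1}e^{\mathrm i\pi\tau k^2}\cos(2ku)$, $\theta_4(u|\tau)=1+2\sum_{k\ge1}(-1)^ke^{\mathrm i\pi\tau k^2}\cos(2ku)$. Put $$\zeta(\eta)=\frac{\theta_1(2\eta|2\tau)^2}{\theta_4(2\eta|2\tau)^2},\quad \Gamma(\eta)=\frac{\theta_2(2\eta|2\tau)\theta_3(2\eta|2\tau)\theta_4(0|2\tau)^2}{\theta_2(0|2\tau)\theta_3(0|2\tau)\theta_4(2\eta|2\tau)^2},\quad \chi=\frac{\theta_1'(0|\tau)^2\theta_2(\pi/3|\tau)^2}{\theta_1(\pi/3|\tau)^2\theta_2(0|\tau)^2}.$$ Let $n\ge 0$, $L=2n+1$, $V=\mathbb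 C^2$, and let $\mathbf H=-\frac12\sum_{j=1}^L(J_x\sigma^x_j\sigma^x_{j+1}+J_y\sigma^y_j\sigma^y_{j+1}+J_z\sigma^z_j\sigma^z_{j+1})$ be the periodic XYZ Hamiltonian on $V^{\otimes L}$. Let $\mathbf T(u)=\operatorname{Tr}_0(R_{01}\cdots R_{0L})$ be the transfer matrix of the eight-vertex model, where $$R=\begin{pmatrix}a&0&0&d\\0&b&c&0\\0&c&b&0\\d&0&0&a\end{pmatrix},\qquad \begin{aligned}a&=\rho\,\theta_4(2\eta|2\tau)\theta_4(u-\eta|2\tau)\theta_1(u+\eta|2\tau),\\ b&=\rho\,\theta_4(2\eta|2\tau)\theta_1(u-\eta|2\tau)\theta_4(u+\eta|2\tau),\\ c&=\rho\,\theta_1(2\eta|2\tau)\theta_4(u-\eta|2\tau)\theta_4(u+\eta|2\tau),\\ d&=\rho\,\theta_1(2\eta|2\tau)\theta_1(u-\eta|2\tau)\theta_1(u+\eta|2\tau),\end{aligned}$$ and $\rho=2/(\theta_2(0|\tau)\theta_4(0|2\tau))$. Let $\tau$ be such that $\zeta=\zeta(\pi/3)$ is real, and consider the supersymmetric chain, $J_x=1+\zeta$,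 $J_y=1-\zeta$, $J_z=(\zeta^2-1)/2$. Let $f_n$ be the quantity such that, for every eigenvector $\Psi$ for the lowest eigenvalue of $\mathbf H$ and every $j$, the correlations $C^a=\langle\Psi|\sigma^a_j\sigma^a_{j+1}|\Psi\rangle/\langle\Psi|\Psi\rangle$ are $$C^x=1-\frac{(1-\zeta)^2f_n}{\zeta^2+3},\qquad C^y=1-\frac{(1+\zeta)^2f_n}{\zeta^2+3},\qquad C^z=1-\frac{4f_n}{\zeta^2+3}.$$ Let $W^+\subset V^{\otimes L}$ be the span of the basis states with an even number of down spins. Let $\Psi(\eta)\in W^+$ be analytic at $\eta=\pi/3$, such that $\Psi(\pi/3)$ is an eigenvector for the lowest eigenvalue of the supersymmetric Hamiltonian and, for $\eta$ near $\pi/3$, $\Psi(\eta)$ is an eigenvector of $\mathbf H$ with $J_x=1+\zeta(\eta)$, $J_y=1-\zeta(\eta)$, $J_z=\Gamma(\eta)$, and $\mathbf T(u)\Psi(\eta)=\lambda(u,\eta)\Psi(\eta)$ for all $u$. **Proposition 3.3.** Such $\Psi$ and $\lambda$ exist. For any such choice, $\lambda$ is analytic at $u=\eta=\pi/3$ and does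 not vanish there, $\chi\neq0$, and the quantity $f_n$ exists, is unique, and is given by $$f_n=\frac{\zeta^2+3}{12L\chi}\,\frac{\lambda_{u\eta}\lambda-\lambda_u\lambda_\eta}{\lambda^2}\Bigg|_{u=\eta=\pi/3}.$$ -/

import Mathlib

open Filter Topology

noncomputable section

namespace XYZ

/-! Jacobi theta functions of `u` with modular parameter `τ`, nome `exp (iπτ)`, by Fourier series. -/

def theta1 (u τ : ℂ) : ℂ :=
  2 * ∑' k : ℕ, (-1) ^ k * Complex.exp (Real.pi * Complex.I * τ * ((k : ℂ) + 1 / 2) ^ 2) *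
    Complex.sin ((2 * k + 1) * u)

def theta2 (u τ : ℂ) : ℂ :=
  2 * ∑' k : ℕ, Complex.exp (Real.pi * Complex.I * τ * ((k : ℂ) + 1 / 2) ^ 2) *
    Complex.cos ((2 * k + 1) * u)

def theta3 (u τ : ℂ) : ℂ :=
  1 + 2 * ∑' k : ℕ, Complex.exp (Real.pi * Complex.I * τ * ((k : ℂ) + 1) ^ 2) *
    Complex.cos (2 * (k + 1) * u)

def theta4 (u τ : ℂ) : ℂ :=
  1 + 2 * ∑' k : ℕ, (-1) ^ (k + 1) * Complex.exp (Real.pi * Complex.I * τ * ((k : ℂ) + 1) ^ 2) *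
    Complex.cos (2 * (k + 1) * u)

/-- The supersymmetric value `π / 3` of the crossing parameter, as a complex number. -/
def eta0 : ℂ := Real.pi / 3

/-- The constant `χ = θ₁'(0|τ)² θ₂(π/3|τ)² / (θ₁(π/3|τ)² θ₂(0|τ)²)`. -/
def chi (τ : ℂ) : ℂ :=
  (deriv (fun u => theta1 u τ) 0 ^ 2 * theta2 eta0 τ ^ 2) /
    (theta1 eta0 τ ^ 2 * theta2 0 τ ^ 2)

/-- The anisotropy `ζ(η, τ)`. -/
def zeta (η τ : ℂ) : ℂ := theta1 (2 * η) (2 * τ) ^ 2 / theta4 (2 * η) (2 * τ) ^ 2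

/-- The anisotropy `Γ(η, τ)`. -/
def Gam (η τ : ℂ) : ℂ :=
  (theta2 (2 * η) (2 * τ) * theta3 (2 * η) (2 * τ) * theta4 0 (2 * τ) ^ 2) /
    (theta2 0 (2 * τ) * theta3 0 (2 * τ) * theta4 (2 * η) (2 * τ) ^ 2)

/-! The spin chain of length `L = 2n+1`. The standard basis of `V^{⊗L}` is indexed by spin
configurations, where `0` is spin up and `1` is spin down. Addition of sites in `Fin (2n+1)` is
cyclic, which gives periodic boundary conditions. -/

/-- Spin configurations. -/
abbrev Conf (n : ℕ) : Type := Fin (2 * n + 1) → Fin 2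

/-- Operators on `V^{⊗L}`. -/
abbrev Op (n : ℕ) : Type := Matrix (Conf n) (Conf n) ℂ

def sigmaX : Matrix (Fin 2) (Fin 2) ℂ := !![0, 1; 1, 0]
def sigmaY : Matrix (Fin 2) (Fin 2) ℂ := !![0, -Complex.I; Complex.I, 0]
def sigmaZ : Matrix (Fin 2) (Fin 2) ℂ := !![1, 0; 0, -1]

/-- The operator acting as `A` on the `j`-th tensor factor and as the identity on the others. -/
def site {n : ℕ} (A : Matrix (Fin 2) (Fin 2) ℂ) (j : Fin (2 * n + 1)) : Op n :=
  Matrix.of fun s t => if ∀ k, k ≠ j → s k = t k then A (s j) (t j) else 0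

/-- The nearest-neighbour operator `A_j A_{j+1}`. -/
def bond {n : ℕ} (A : Matrix (Fin 2) (Fin 2) ℂ) (j : Fin (2 * n + 1)) : Op n :=
  site A j * site A (j + 1)

/-- The periodic XYZ Hamiltonian on `2n+1` sites. -/
def hamiltonian (n : ℕ) (Jx Jy Jz : ℂ) : Op n :=
  -(1 / 2 : ℂ) • ∑ j : Fin (2 * n + 1),
    (Jx • bond sigmaX j + Jy • bond sigmaY j + Jz • bond sigmaZ j)

/-- The supersymmetric Hamiltonian, `J = (1 + ζ, 1 - ζ, (ζ² - 1) / 2)`. -/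
def susyHamiltonian (n : ℕ) (ζ : ℝ) : Op n :=
  hamiltonian n (1 + ζ) (1 - ζ) (((ζ : ℂ) ^ 2 - 1) / 2)

/-- `Ψ` is an eigenvector of `H` for its lowest (real) eigenvalue. -/
def IsGroundState {n : ℕ} (H : Op n) (Ψ : Conf n → ℂ) : Prop :=
  ∃ E : ℝ, IsLeast {E' : ℝ | Module.End.HasEigenvalue (Matrix.toLin' H) (E' : ℂ)} E ∧
    Module.End.HasEigenvector (Matrix.toLin' H) (E : ℂ) Ψ

/-- `⟨Ψ|A|Ψ⟩ / ⟨Ψ|Ψ⟩`. -/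
def expectation {n : ℕ} (Ψ : Conf n → ℂ) (A : Op n) : ℂ :=
  (star Ψ ⬝ᵥ A.mulVec Ψ) / (star Ψ ⬝ᵥ Ψ)

/-- `f` is the quantity `f_n` through which the nearest-neighbour correlations of the
supersymmetric chain are expressed, for every ground state and every site `j`:
`C^x = 1 - (1-ζ)² f / (ζ²+3)`, `C^y = 1 - (1+ζ)² f / (ζ²+3)`, `C^z = 1 - 4 f / (ζ²+3)`. -/
def IsCorrelationQuantity (n : ℕ) (ζ : ℝ) (f : ℂ) : Prop :=
  ∀ Ψ : Conf n → ℂ, IsGroundState (susyHamiltonian n ζ) Ψ → ∀ j : Fin (2 * n + 1),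
    expectation Ψ (bond sigmaX j) = 1 - (1 - (ζ : ℂ)) ^ 2 * f / ((ζ : ℂ) ^ 2 + 3) ∧
    expectation Ψ (bond sigmaY j) = 1 - (1 + (ζ : ℂ)) ^ 2 * f / ((ζ : ℂ) ^ 2 + 3) ∧
    expectation Ψ (bond sigmaZ j) = 1 - 4 * f / ((ζ : ℂ) ^ 2 + 3)

/-! The eight-vertex model. -/

/-- Normalization of the Boltzmann weights. -/
def rho (τ : ℂ) : ℂ := 2 / (theta2 0 τ * theta4 0 (2 * τ))

def weightA (u η τ : ℂ) : ℂ :=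
  rho τ * theta4 (2 * η) (2 * τ) * theta4 (u - η) (2 * τ) * theta1 (u + η) (2 * τ)
def weightB (u η τ : ℂ) : ℂ :=
  rho τ * theta4 (2 * η) (2 * τ) * theta1 (u - η) (2 * τ) * theta4 (u + η) (2 * τ)
def weightC (u η τ : ℂ) : ℂ :=
  rho τ * theta1 (2 * η) (2 * τ) * theta4 (u - η) (2 * τ) * theta4 (u + η) (2 * τ)
def weightD (u η τ : ℂ) : ℂ :=
  rho τ * theta1 (2 * η) (2 * τ) * theta1 (u - η) (2 * τ) * theta1 (u + η) (2 * τ)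

/-- The R-matrix on `V ⊗ V`; the basis is ordered as `↑↑, ↑↓, ↓↑, ↓↓`. -/
def rMatrix (a b c d : ℂ) : Matrix (Fin 2 × Fin 2) (Fin 2 × Fin 2) ℂ :=
  (!![a, 0, 0, d; 0, b, c, 0; 0, c, b, 0; d, 0, 0, a] : Matrix (Fin (2 * 2)) (Fin (2 * 2)) ℂ).submatrix
    finProdFinEquiv finProdFinEquiv

/-- `R_{0j}` on `V_0 ⊗ V^{⊗L}`: the R-matrix acts on the auxiliary factor and the factor `j`. -/
def rSite {n : ℕ} (R : Matrix (Fin 2 × Fin 2) (Fin 2 × Fin 2) ℂ) (j : Fin (2 * n + 1)) :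
    Matrix (Fin 2 × Conf n) (Fin 2 × Conf n) ℂ :=
  Matrix.of fun p q =>
    if ∀ k, k ≠ j → p.2 k = q.2 k then R (p.1, p.2 j) (q.1, q.2 j) else 0

/-- The transfer matrix `T(u) = Tr_0 (R_{01} R_{02} ⋯ R_{0L})`, for given `η` and `τ`. -/
def transfer (n : ℕ) (u η τ : ℂ) : Op n :=
  let R := rMatrix (weightA u η τ) (weightB u η τ) (weightC u η τ) (weightD u η τ)
  Matrix.of fun s t => ∑ α : Fin 2,
    (List.ofFn fun j : Fin (2 * n + 1) => rSite R j).prod (α, s) (α, t)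

/-- Membership in `W⁺`, the span of the states with an even number of down spins. -/
def IsEven {n : ℕ} (Ψ : Conf n → ℂ) : Prop :=
  ∀ s : Conf n, Odd (Finset.univ.filter fun k => s k = 1).card → Ψ s = 0

/-- `Ψ(η)` is the analytic continuation in `η`, near `π/3`, of the ground state in `W⁺` of the
supersymmetric chain: an eigenvector in `W⁺` of the XYZ Hamiltonian with
`J = (1 + ζ(η), 1 - ζ(η), Γ(η))`. `Λ u η` is the corresponding eigenvalue of the transfer
matrix. -/
structure IsGroundStateFamily (n : ℕ) (τ : ℂ) (ζ : ℝ)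
    (Ψ : ℂ → Conf n → ℂ) (Λ : ℂ → ℂ → ℂ) : Prop where
  analytic : AnalyticAt ℂ Ψ eta0
  ground : IsGroundState (susyHamiltonian n ζ) (Ψ eta0)
  even : ∀ᶠ η in 𝓝 eta0, IsEven (Ψ η)
  eigen : ∀ᶠ η in 𝓝 eta0, ∃ E : ℂ, Module.End.HasEigenvector
    (Matrix.toLin' (hamiltonian n (1 + zeta η τ) (1 - zeta η τ) (Gam η τ))) E (Ψ η)
  transfer_eigen : ∀ᶠ η in 𝓝 eta0, ∀ u : ℂ, (transfer n u η τ).mulVec (Ψ η) = Λ u η • Ψ η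

end XYZ

end

open Filter Topology

noncomputable section

namespace XYZ

/-! ### Product identities for the theta functions. -/

section Theta
open Complex

/-! Write `K` for the supersymmetric Hamiltonian minus `E₀ = -L(ζ²+3)/4`. The proof determines the
ground space of `K`, reduces all correlations to the single number `f`, and computes the mixed
logarithmic derivative of `Λ` from the first two `u`-derivatives of the transfer matrix at the shift
point `u = η`.

Ground space. On rotation-invariant real vectors `K` is, up to positive factors, `Q†Q + QQ†`, where
the supercharge `Q` splits one letter of a cyclic word into two with alternating signs
(`wsum_hloc_eq`); so `K ≥ 0` there. It has a kernel: if it were invertible, a `Q`-closed product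
vector would be in its range, but nilpotency of the supercharge would then make it orthogonal to a
dual product vector with which it pairs to 1 (`not_exists_preimage`). A Perron–Frobenius argument
gives a nowhere vanishing zero mode `q`; for `ζ < 0` a sign gauge is needed (`exists_isZeroMode`).
Dividing by `q` turns `K` into a Dirichlet form on the whole complex space (`IsZeroMode.form`), so
`E₀` is the lowest eigenvalue and the ground space has one line for each parity of the number of
down spins.

Correlations. Spin reversal exchanges the two parities, so every ground state has the same
correlations. Zero energy is one linear relation between `C^x`, `C^y`, `C^z`. As `K ≥ 0` for every
nonzero coupling, the energy of a fixed ground state is stationary when the coupling varies, which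
is a second relation (`IsEvenMode.corr_stationary`). One unknown remains, which is `f`.

Family. The transfer matrix commutes with the Hamiltonian by Sutherland's local relation
(`transfer_commute`). The even ground state is simple in its sector, so the implicit function
theorem continues it analytically, and the commuting transfer matrix must preserve its line
(`exists_isGroundStateFamily`).

Formula. At `u = η` the R-matrix is `a` times the permutation. With `B = ∂_u b / a` and the energy
`E(η)`, the first derivative gives `∂_u log Λ = L (log θ₁)' - B (L(1 + Γ/2) + E)` at `u = η`
(`transfer_eigenvalue_jet`, `logSlope_eq`). At `η = π/3` the bracket vanishes and the second
derivative gives `∂_u² log Λ = L (log θ₁)''` (`transfer_eigenvalue_second`, `jetConst_eta0`).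
Differentiating the first formula along the diagonal and subtracting the second leaves `∂_u ∂_η log
Λ = -B (L Γ'/2 + E')`. Hellmann–Feynman expresses `E'` through `f`, and the theta identity `B (ζ ζ'
- Γ') = 6χ` (`six_mul_chi`) turns the result into `12 L χ f / (ζ² + 3)`. -/

lemma theta3_eq (u : ℂ) {τ : ℂ} (hτ : 0 < τ.im) :
    theta3 u τ = jacobiTheta₂ (u / Real.pi) τ := by
  have hpi : (Real.pi : ℂ) ≠ 0 := by exact_mod_cast Real.pi_ne_zero
  have h := (hasSum_jacobiTheta₂_term (u / Real.pi) hτ).nat_add_neg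
  have h2 : HasSum (fun k : ℕ => jacobiTheta₂_term ((k + 1 : ℕ) : ℤ) (u / Real.pi) τ +
      jacobiTheta₂_term (-((k + 1 : ℕ) : ℤ)) (u / Real.pi) τ)
      (jacobiTheta₂ (u / Real.pi) τ - jacobiTheta₂_term 0 (u / Real.pi) τ) := by
    have h' := (hasSum_nat_add_iff' 1).mpr h
    rw [show jacobiTheta₂ (u / Real.pi) τ - jacobiTheta₂_term 0 (u / Real.pi) τ = jacobiTheta₂ (u / Real.pi) τ + jacobiTheta₂_term 0 (u / Real.pi) τ -
      ∑ i ∈ Finset.range 1, (jacobiTheta₂_term (i : ℕ) (u / Real.pi) τ +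
        jacobiTheta₂_term (-((i : ℕ) : ℤ)) (u / Real.pi) τ) from ?_]
    · exact h'
    simp only [Finset.sum_range_one, Nat.cast_zero, neg_zero]
    ring
  have h0 : jacobiTheta₂_term 0 (u / Real.pi) τ = 1 := by simp [jacobiTheta₂_term]
  rw [h0] at h2
  have h3 : ∀ k : ℕ, Complex.exp (Real.pi * Complex.I * τ * ((k : ℂ) + 1) ^ 2) *
      Complex.cos (2 * (k + 1) * u) * 2 = jacobiTheta₂_term ((k + 1 : ℕ) : ℤ) (u / Real.pi) τ +
      jacobiTheta₂_term (-((k + 1 : ℕ) : ℤ)) (u / Real.pi) τ := by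
    intro k
    simp only [jacobiTheta₂_term, Complex.cos]
    rw [mul_assoc, div_mul_cancel₀ _ two_ne_zero, mul_add, ← Complex.exp_add, ← Complex.exp_add]
    congr 2 <;> · push_cast; field_simp; ring
  simp_rw [← h3] at h2
  have h4 := h2.tsum_eq
  rw [tsum_mul_right] at h4
  rw [theta3, mul_comm, h4]; ring

lemma theta2_eq (u : ℂ) {τ : ℂ} (hτ : 0 < τ.im) :
    theta2 u τ = exp (Real.pi * I * τ / 4 + I * u) * jacobiTheta₂ (u / Real.pi + τ / 2) τ := by
  have hpi : (Real.pi : ℂ) ≠ 0 := by exact_mod_cast Real.pi_ne_zero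
  have h := ((hasSum_jacobiTheta₂_term (u / Real.pi + τ / 2) hτ).mul_left
    (exp (Real.pi * I * τ / 4 + I * u))).nat_add_neg_add_one
  have h3 : ∀ k : ℕ, Complex.exp (Real.pi * Complex.I * τ * ((k : ℂ) + 1 / 2) ^ 2) *
      Complex.cos ((2 * k + 1) * u) * 2 = exp (Real.pi * I * τ / 4 + I * u) *
        jacobiTheta₂_term (k : ℤ) (u / Real.pi + τ / 2) τ +
      exp (Real.pi * I * τ / 4 + I * u) *
        jacobiTheta₂_term (-((k : ℤ) + 1)) (u / Real.pi + τ / 2) τ := by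
    intro k
    simp only [jacobiTheta₂_term, Complex.cos]
    rw [mul_assoc, div_mul_cancel₀ _ two_ne_zero, mul_add, ← Complex.exp_add, ← Complex.exp_add,
      ← Complex.exp_add, ← Complex.exp_add]
    congr 2 <;> · push_cast; field_simp; ring
  simp_rw [← h3] at h
  have h4 := h.tsum_eq
  rw [tsum_mul_right] at h4
  rw [theta2, mul_comm, h4]

lemma cos_sub_nat_mul_pi' (x : ℂ) (k : ℕ) : cos (x - k * Real.pi) = (-1) ^ k * cos x := by
  simpa using Complex.cos_antiperiodic.sub_nat_mul_eq k (x := x)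

lemma theta1_eq_theta2 (u τ : ℂ) : theta1 u τ = theta2 (u - Real.pi / 2) τ := by
  have : ∀ k : ℕ, Complex.cos ((2 * k + 1) * (u - Real.pi / 2)) =
      (-1) ^ k * Complex.sin ((2 * k + 1) * u) := by
    intro k
    rw [show (2 * (k : ℂ) + 1) * (u - Real.pi / 2) = ((2 * k + 1) * u - Real.pi / 2) - k * Real.pi by
      ring, cos_sub_nat_mul_pi', Complex.cos_sub_pi_div_two]
  simp only [theta1, theta2, this]
  congr 2
  ext k; ring

lemma theta4_eq_theta3 (u τ : ℂ) : theta4 u τ = theta3 (u - Real.pi / 2) τ := by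
  have : ∀ k : ℕ, Complex.cos (2 * (k + 1) * (u - Real.pi / 2)) =
      (-1) ^ (k + 1) * Complex.cos (2 * (k + 1) * u) := by
    intro k
    rw [show 2 * ((k : ℂ) + 1) * (u - Real.pi / 2) = 2 * (k + 1) * u - (k + 1 : ℕ) * Real.pi by
      push_cast; ring, cos_sub_nat_mul_pi']
  simp only [theta4, theta3, this]
  congr 3
  ext k; ring

lemma hasSum_theta_mul {z w σ : ℂ} (hσ : 0 < σ.im) : HasSum (fun p : ℤ × ℤ =>
    jacobiTheta₂_term p.1 z σ * jacobiTheta₂_term p.2 w σ)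
    (jacobiTheta₂ z σ * jacobiTheta₂ w σ) := by
  have s1 := (hasSum_jacobiTheta₂_term z hσ).summable.norm
  have s2 := (hasSum_jacobiTheta₂_term w hσ).summable.norm
  rw [jacobiTheta₂, jacobiTheta₂, tsum_mul_tsum_of_summable_norm s1 s2]
  exact (summable_mul_of_summable_norm s1 s2).hasSum

/-- The product is a double series over `(m, k) ∈ ℤ²`. Its terms are split by the parity of `m + k`,
and each class is parametrized by sum and difference coordinates, in which the quadratic form
becomes diagonal with `τ` doubled. The two-variable product identities below descend from this one
by period shifts. -/
lemma theta3_mul_theta3 (x y : ℂ) {τ : ℂ} (hτ : 0 < τ.im) :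
    theta3 (x + y) τ * theta3 (x - y) τ =
      theta3 (2 * x) (2 * τ) * theta3 (2 * y) (2 * τ) +
        theta2 (2 * x) (2 * τ) * theta2 (2 * y) (2 * τ) := by
  have hpi : (Real.pi : ℂ) ≠ 0 := by exact_mod_cast Real.pi_ne_zero
  have h2 : 0 < (2 * τ).im := by simpa using hτ
  rw [theta3_eq _ hτ, theta3_eq _ hτ, theta3_eq _ h2, theta3_eq _ h2,
    theta2_eq _ h2, theta2_eq _ h2]
  set f : ℤ × ℤ → ℂ := fun p => jacobiTheta₂_term p.1 ((x + y) / Real.pi) τ *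
    jacobiTheta₂_term p.2 ((x - y) / Real.pi) τ with hf
  let g0 : ℤ × ℤ → ℤ × ℤ := fun p => (p.1 + p.2, p.1 - p.2)
  let g1 : ℤ × ℤ → ℤ × ℤ := fun p => (p.1 + p.2 + 1, p.1 - p.2)
  have i0 : Function.Injective g0 := by
    rintro ⟨a, b⟩ ⟨c, d⟩ h
    simp only [g0, Prod.mk.injEq] at h ⊢
    omega
  have i1 : Function.Injective g1 := by
    rintro ⟨a, b⟩ ⟨c, d⟩ h
    simp only [g1, Prod.mk.injEq] at h ⊢
    omega
  have hc : IsCompl (Set.range g0) (Set.range g1) := by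
    constructor
    · rw [Set.disjoint_left]
      rintro _ ⟨⟨a, b⟩, rfl⟩ ⟨⟨c, d⟩, h⟩
      simp only [g0, g1, Prod.mk.injEq] at h
      omega
    · rw [codisjoint_iff_le_sup]
      rintro ⟨m, k⟩ -
      rcases Int.even_or_odd (m + k) with ⟨r, hr⟩ | ⟨r, hr⟩
      · left; exact ⟨(r, m - r), by simp only [g0, Prod.mk.injEq]; omega⟩
      · right; exact ⟨(r, m - r - 1), by simp only [g1, Prod.mk.injEq]; omega⟩
  have e0 : HasSum (f ∘ g0) (jacobiTheta₂ (2 * x / Real.pi) (2 * τ) *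
      jacobiTheta₂ (2 * y / Real.pi) (2 * τ)) := by
    convert hasSum_theta_mul h2 using 1
    ext ⟨a, b⟩
    simp only [hf, g0, Function.comp, jacobiTheta₂_term, ← Complex.exp_add]
    congr 1
    push_cast; field_simp; ring
  have e1 : HasSum (f ∘ g1) (exp (Real.pi * I * (2 * τ) / 4 + I * (2 * x)) *
      jacobiTheta₂ (2 * x / Real.pi + 2 * τ / 2) (2 * τ) *
      (exp (Real.pi * I * (2 * τ) / 4 + I * (2 * y)) *
        jacobiTheta₂ (2 * y / Real.pi + 2 * τ / 2) (2 * τ))) := by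
    have e : f ∘ g1 = fun p => (exp (Real.pi * I * (2 * τ) / 4 + I * (2 * x)) *
        exp (Real.pi * I * (2 * τ) / 4 + I * (2 * y))) *
        (jacobiTheta₂_term p.1 (2 * x / Real.pi + 2 * τ / 2) (2 * τ) *
        jacobiTheta₂_term p.2 (2 * y / Real.pi + 2 * τ / 2) (2 * τ)) := by
      ext ⟨a, b⟩
      simp only [hf, g1, Function.comp, jacobiTheta₂_term, ← Complex.exp_add]
      congr 1
      push_cast; field_simp; ring
    rw [mul_mul_mul_comm, e]
    exact (hasSum_theta_mul h2).mul_left _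
  exact (hasSum_theta_mul hτ).unique ((i0.hasSum_range_iff.mpr e0).add_isCompl hc (i1.hasSum_range_iff.mpr e1))

lemma theta2_neg (u τ : ℂ) : theta2 (-u) τ = theta2 u τ := by
  simp [theta2]

lemma theta4_neg (u τ : ℂ) : theta4 (-u) τ = theta4 u τ := by
  simp [theta4]

lemma theta1_neg (u τ : ℂ) : theta1 (-u) τ = -theta1 u τ := by
  simp only [theta1, mul_neg, Complex.sin_neg, tsum_neg]

lemma theta2_sub_pi (u τ : ℂ) : theta2 (u - Real.pi) τ = -theta2 u τ := by
  have : ∀ k : ℕ, Complex.cos ((2 * k + 1) * (u - Real.pi)) =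
      -Complex.cos ((2 * k + 1) * u) := by
    intro k
    rw [show (2 * (k : ℂ) + 1) * (u - Real.pi) = (2 * k + 1) * u - (2 * k + 1 : ℕ) * Real.pi by
      push_cast; ring, cos_sub_nat_mul_pi', Odd.neg_one_pow ⟨k, rfl⟩]
    ring
  simp only [theta2, this, mul_neg, tsum_neg]

lemma theta3_sub_pi (u τ : ℂ) : theta3 (u - Real.pi) τ = theta3 u τ := by
  have : ∀ k : ℕ, Complex.cos (2 * (k + 1) * (u - Real.pi)) =
      Complex.cos (2 * (k + 1) * u) := by
    intro k
    rw [show 2 * ((k : ℂ) + 1) * (u - Real.pi) = 2 * (k + 1) * u - (2 * (k + 1) : ℕ) * Real.pi by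
      push_cast; ring, cos_sub_nat_mul_pi', Even.neg_one_pow ⟨k + 1, by ring⟩]
    ring
  simp only [theta3, this]

lemma theta1_sub_pi (u τ : ℂ) : theta1 (u - Real.pi) τ = -theta1 u τ := by
  rw [theta1_eq_theta2, theta1_eq_theta2, ← theta2_sub_pi]; ring_nf

lemma theta4_sub_pi (u τ : ℂ) : theta4 (u - Real.pi) τ = theta4 u τ := by
  rw [theta4_eq_theta3, theta4_eq_theta3, ← theta3_sub_pi (u - Real.pi / 2)]; ring_nf

lemma theta3_sub_pi_div_two (u τ : ℂ) : theta3 (u - Real.pi / 2) τ = theta4 u τ :=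
  (theta4_eq_theta3 u τ).symm

lemma theta2_sub_pi_div_two (u τ : ℂ) : theta2 (u - Real.pi / 2) τ = theta1 u τ :=
  (theta1_eq_theta2 u τ).symm

lemma theta1_sub_pi_div_two (u τ : ℂ) : theta1 (u - Real.pi / 2) τ = -theta2 u τ := by
  rw [theta1_eq_theta2, ← theta2_sub_pi]; ring_nf

lemma theta4_sub_pi_div_two (u τ : ℂ) : theta4 (u - Real.pi / 2) τ = theta3 u τ := by
  rw [theta4_eq_theta3, sub_sub, add_halves, theta3_sub_pi]

lemma theta1_zero (τ : ℂ) : theta1 0 τ = 0 := by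
  simp [theta1]

/-- Half a quasi-period exchanges `θ₂` and `θ₃` up to an exponential, which transports the product
identity for `θ₃` to `θ₂`. -/
lemma theta3_add_half (u : ℂ) {τ : ℂ} (hτ : 0 < τ.im) :
    theta3 (u + Real.pi * τ / 2) τ = exp (-(Real.pi * I * τ / 4 + I * u)) * theta2 u τ := by
  have hpi : (Real.pi : ℂ) ≠ 0 := by exact_mod_cast Real.pi_ne_zero
  rw [theta3_eq _ hτ, theta2_eq _ hτ, ← mul_assoc, ← Complex.exp_add, neg_add_cancel, exp_zero,
    one_mul]
  congr 1; field_simp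

lemma theta2_add_half (u : ℂ) {τ : ℂ} (hτ : 0 < τ.im) :
    theta2 (u + Real.pi * τ / 2) τ = exp (-(Real.pi * I * τ / 4 + I * u)) * theta3 u τ := by
  have hpi : (Real.pi : ℂ) ≠ 0 := by exact_mod_cast Real.pi_ne_zero
  rw [theta3_eq _ hτ, theta2_eq _ hτ,
    show (u + Real.pi * τ / 2) / Real.pi + τ / 2 = u / Real.pi + τ by field_simp; ring,
    jacobiTheta₂_add_left', ← mul_assoc, ← Complex.exp_add]
  congr 2; field_simp; ring

/-- This is `theta3_mul_theta3` at `x + πτ/2`. The shift is `π(2τ)/2` in the doubled variable, and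
all terms acquire the same exponential factor. -/
lemma theta2_mul_theta2 (x y : ℂ) {τ : ℂ} (hτ : 0 < τ.im) :
    theta2 (x + y) τ * theta2 (x - y) τ =
      theta2 (2 * x) (2 * τ) * theta3 (2 * y) (2 * τ) +
        theta3 (2 * x) (2 * τ) * theta2 (2 * y) (2 * τ) := by
  have h2 : 0 < (2 * τ).im := by simpa using hτ
  have h := theta3_mul_theta3 (x + Real.pi * τ / 2) y hτ
  rw [show x + Real.pi * τ / 2 + y = (x + y) + Real.pi * τ / 2 by ring,
    show x + Real.pi * τ / 2 - y = (x - y) + Real.pi * τ / 2 by ring,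
    show 2 * (x + Real.pi * τ / 2) = 2 * x + Real.pi * (2 * τ) / 2 by ring,
    theta3_add_half _ hτ, theta3_add_half _ hτ, theta3_add_half _ h2, theta2_add_half _ h2] at h
  have e : exp (-(Real.pi * I * τ / 4 + I * (x + y))) * exp (-(Real.pi * I * τ / 4 + I * (x - y))) =
      exp (-(Real.pi * I * (2 * τ) / 4 + I * (2 * x))) := by
    rw [← Complex.exp_add]; congr 1; ring
  apply mul_left_cancel₀ (exp_ne_zero (-(Real.pi * I * (2 * τ) / 4 + I * (2 * x))))
  linear_combination h - e * theta2 (x + y) τ * theta2 (x - y) τ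

/-- The Landen-type addition formula for `θ₁ θ₂`. -/
lemma theta1_mul_theta2 (u η : ℂ) {τ : ℂ} (hτ : 0 < τ.im) :
    theta1 u τ * theta2 η τ =
      theta1 (u + η) (2 * τ) * theta4 (u - η) (2 * τ) +
        theta4 (u + η) (2 * τ) * theta1 (u - η) (2 * τ) := by
  have h := theta2_mul_theta2 ((u - Real.pi / 2 + η) / 2) ((u - Real.pi / 2 - η) / 2) hτ
  rw [show (u - Real.pi / 2 + η) / 2 + (u - Real.pi / 2 - η) / 2 = u - Real.pi / 2 by ring,
    show (u - Real.pi / 2 + η) / 2 - (u - Real.pi / 2 - η) / 2 = η by ring,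
    show 2 * ((u - Real.pi / 2 + η) / 2) = (u + η) - Real.pi / 2 by ring,
    show 2 * ((u - Real.pi / 2 - η) / 2) = (u - η) - Real.pi / 2 by ring] at h
  simpa only [theta2_sub_pi_div_two, theta3_sub_pi_div_two] using h

lemma theta4_mul_theta3 (u η : ℂ) {τ : ℂ} (hτ : 0 < τ.im) :
    theta4 u τ * theta3 η τ =
      theta4 (u + η) (2 * τ) * theta4 (u - η) (2 * τ) +
        theta1 (u + η) (2 * τ) * theta1 (u - η) (2 * τ) := by
  have h := theta3_mul_theta3 ((u - Real.pi / 2 + η) / 2) ((u - Real.pi / 2 - η) / 2) hτ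
  rw [show (u - Real.pi / 2 + η) / 2 + (u - Real.pi / 2 - η) / 2 = u - Real.pi / 2 by ring,
    show (u - Real.pi / 2 + η) / 2 - (u - Real.pi / 2 - η) / 2 = η by ring,
    show 2 * ((u - Real.pi / 2 + η) / 2) = (u + η) - Real.pi / 2 by ring,
    show 2 * ((u - Real.pi / 2 - η) / 2) = (u - η) - Real.pi / 2 by ring] at h
  simpa only [theta2_sub_pi_div_two, theta3_sub_pi_div_two] using h

lemma theta3_sq (x : ℂ) {τ : ℂ} (hτ : 0 < τ.im) : theta3 x τ ^ 2 =
    theta3 (2 * x) (2 * τ) * theta3 0 (2 * τ) + theta2 (2 * x) (2 * τ) * theta2 0 (2 * τ) := by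
  simpa [sq] using theta3_mul_theta3 x 0 hτ

lemma theta2_sq (x : ℂ) {τ : ℂ} (hτ : 0 < τ.im) : theta2 x τ ^ 2 =
    theta2 (2 * x) (2 * τ) * theta3 0 (2 * τ) + theta3 (2 * x) (2 * τ) * theta2 0 (2 * τ) := by
  simpa [sq] using theta2_mul_theta2 x 0 hτ

lemma theta4_sq (x : ℂ) {τ : ℂ} (hτ : 0 < τ.im) : theta4 x τ ^ 2 =
    theta3 (2 * x) (2 * τ) * theta3 0 (2 * τ) - theta2 (2 * x) (2 * τ) * theta2 0 (2 * τ) := by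
  have h := theta3_sq (x - Real.pi / 2) hτ
  rw [show 2 * (x - Real.pi / 2) = 2 * x - Real.pi by ring, theta3_sub_pi, theta2_sub_pi,
    theta3_sub_pi_div_two] at h
  rw [h]; ring

lemma theta1_sq (x : ℂ) {τ : ℂ} (hτ : 0 < τ.im) : theta1 x τ ^ 2 =
    theta3 (2 * x) (2 * τ) * theta2 0 (2 * τ) - theta2 (2 * x) (2 * τ) * theta3 0 (2 * τ) := by
  have h := theta2_sq (x - Real.pi / 2) hτ
  rw [show 2 * (x - Real.pi / 2) = 2 * x - Real.pi by ring, theta3_sub_pi, theta2_sub_pi,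
    theta2_sub_pi_div_two] at h
  rw [h]; ring

/-- `2 θ₁(z|2τ) θ₄(z|2τ) = θ₁(z|τ) θ₂(0|τ)`. -/
lemma two_mul_theta1_mul_theta4 (z : ℂ) {τ : ℂ} (hτ : 0 < τ.im) :
    2 * (theta1 z (2 * τ) * theta4 z (2 * τ)) = theta1 z τ * theta2 0 τ := by
  rw [theta1_mul_theta2 z 0 hτ, add_zero, sub_zero]; ring

/-- `2 θ₂(z|2τ) θ₃(z|2τ) = θ₂(z|τ) θ₂(0|τ)`. -/
lemma two_mul_theta2_mul_theta3 (z : ℂ) {τ : ℂ} (hτ : 0 < τ.im) :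
    2 * (theta2 z (2 * τ) * theta3 z (2 * τ)) = theta2 z τ * theta2 0 τ := by
  have h := theta2_mul_theta2 (z / 2) (z / 2) hτ
  rw [sub_self, add_halves, mul_div_cancel₀ _ two_ne_zero] at h
  rw [h]; ring

/-- `θ₄(2η|2τ) θ₄(0|2τ) = θ₃(η|τ) θ₄(η|τ)`. -/
lemma theta4_two_mul (η : ℂ) {τ : ℂ} (hτ : 0 < τ.im) :
    theta4 (2 * η) (2 * τ) * theta4 0 (2 * τ) = theta3 η τ * theta4 η τ := by
  have h := theta4_mul_theta3 η η hτ
  rw [sub_self, ← two_mul, theta1_zero] at h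
  linear_combination -h

/-- `θ₁(2η|2τ) θ₄(0|2τ) = θ₁(η|τ) θ₂(η|τ)`. -/
lemma theta1_two_mul (η : ℂ) {τ : ℂ} (hτ : 0 < τ.im) :
    theta1 (2 * η) (2 * τ) * theta4 0 (2 * τ) = theta1 η τ * theta2 η τ := by
  have h := theta1_mul_theta2 η η hτ
  rw [sub_self, ← two_mul, theta1_zero] at h
  linear_combination -h

/-! ### Differentiability -/

lemma differentiable_theta3 {τ : ℂ} (hτ : 0 < τ.im) : Differentiable ℂ (fun u => theta3 u τ) := by
  simp_rw [theta3_eq _ hτ]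
  intro u
  exact DifferentiableAt.comp (f := fun u : ℂ => u / Real.pi) (g := fun z => jacobiTheta₂ z τ) u
    (differentiableAt_jacobiTheta₂_fst _ hτ) (by fun_prop)

lemma differentiable_theta2 {τ : ℂ} (hτ : 0 < τ.im) : Differentiable ℂ (fun u => theta2 u τ) := by
  simp_rw [theta2_eq _ hτ]
  intro u
  refine DifferentiableAt.mul (by fun_prop) ?_
  exact DifferentiableAt.comp (f := fun u : ℂ => u / Real.pi + τ / 2)
    (g := fun z => jacobiTheta₂ z τ) u (differentiableAt_jacobiTheta₂_fst _ hτ) (by fun_prop)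

lemma differentiable_theta4 {τ : ℂ} (hτ : 0 < τ.im) : Differentiable ℂ (fun u => theta4 u τ) := by
  simp_rw [theta4_eq_theta3]
  exact (differentiable_theta3 hτ).comp (differentiable_id.sub_const _)

lemma differentiable_theta1 {τ : ℂ} (hτ : 0 < τ.im) : Differentiable ℂ (fun u => theta1 u τ) := by
  simp_rw [theta1_eq_theta2]
  exact (differentiable_theta2 hτ).comp (differentiable_id.sub_const _)

/-! ### Nonvanishing at real arguments -/

/-- Keeps the factor `sin x` in the bound on every term of the `θ₁` series, so that the leading term
dominates uniformly up to the zero at the origin. -/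
lemma abs_sin_nat_mul_le (k : ℕ) (x : ℝ) : |Real.sin (k * x)| ≤ k * |Real.sin x| := by
  induction k with
  | zero => simp
  | succ k ih =>
    rw [Nat.cast_succ, add_mul, one_mul, Real.sin_add]
    calc |Real.sin (k * x) * Real.cos x + Real.cos (k * x) * Real.sin x|
        ≤ |Real.sin (k * x)| * |Real.cos x| + |Real.cos (k * x)| * |Real.sin x| := by
          rw [← abs_mul, ← abs_mul]; exact abs_add_le _ _
      _ ≤ |Real.sin (k * x)| * 1 + 1 * |Real.sin x| := by
          gcongr <;> exact Real.abs_cos_le_one _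
      _ ≤ _ := by linarith

lemma norm_exp_pi_mul (τ : ℂ) (c : ℝ) :
    ‖exp (Real.pi * I * τ * c)‖ = Real.exp (-Real.pi * τ.im * c) := by
  rw [Complex.norm_exp]
  congr 1
  rw [show (Real.pi * I * τ * c : ℂ) = ((Real.pi * c : ℝ) : ℂ) * (I * τ) by push_cast; ring,
    Complex.re_ofReal_mul]
  simp; ring

lemma norm_exp_pi_mul_le {τ : ℂ} (hτ : Real.exp (-Real.pi * τ.im) ≤ 1 / 9) {c : ℝ} {k : ℕ}
    (hc : k ≤ c) : ‖exp (Real.pi * I * τ * c)‖ ≤ (1 / 9) ^ k := by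
  rw [norm_exp_pi_mul]
  have h0 : -Real.pi * τ.im ≤ 0 := by
    by_contra! h
    have := Real.one_lt_exp_iff.mpr h
    linarith
  calc Real.exp (-Real.pi * τ.im * c) ≤ Real.exp (-Real.pi * τ.im * k) := by
        apply Real.exp_le_exp.mpr; nlinarith
    _ = Real.exp (-Real.pi * τ.im) ^ k := by rw [← Real.exp_nat_mul, mul_comm]
    _ ≤ _ := by gcongr

/-- With the nome at most `1/9` in modulus, everything beyond the constant term is at most `2 ·
(1/9)/(1 - 1/9) = 1/4`. -/
lemma theta4_ne_zero_of_im_large {τ : ℂ} (hτ : Real.exp (-Real.pi * τ.im) ≤ 1 / 9) (x : ℝ) :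
    theta4 x τ ≠ 0 := by
  have hb : ∀ k : ℕ, ‖(-1) ^ (k + 1) * exp (Real.pi * I * τ * ((k : ℂ) + 1) ^ 2) *
      cos (2 * (k + 1) * x)‖ ≤ 1 / 9 * (1 / 9) ^ k := by
    intro k
    have h1 : ‖exp (Real.pi * I * τ * ((k : ℂ) + 1) ^ 2)‖ ≤ (1 / 9) ^ (k + 1) := by
      have := norm_exp_pi_mul_le hτ (c := ((k : ℝ) + 1) ^ 2) (k := k + 1) (by push_cast; nlinarith)
      simpa using this
    have h2 : ‖cos (2 * (k + 1) * x)‖ ≤ 1 := by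
      have : (2 * (k + 1) * x : ℂ) = ((2 * (k + 1) * x : ℝ) : ℂ) := by push_cast; ring
      rw [this, ← Complex.ofReal_cos, Complex.norm_real]
      exact Real.abs_cos_le_one _
    rw [norm_mul, norm_mul, norm_pow, norm_neg, norm_one, one_pow, one_mul, ← pow_succ']
    calc _ ≤ (1 / 9 : ℝ) ^ (k + 1) * 1 := by gcongr
      _ = _ := mul_one _
  have hs : HasSum (fun k : ℕ => 1 / 9 * (1 / 9 : ℝ) ^ k) (1 / 9 * (1 - 1 / 9)⁻¹) :=
    (hasSum_geometric_of_lt_one (by norm_num) (by norm_num)).mul_left _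
  have hn := tsum_of_norm_bounded hs hb
  intro h
  rw [theta4] at h
  have h' := congrArg norm (show (1 : ℂ) = -(2 * ∑' k : ℕ, (-1) ^ (k + 1) *
    exp (Real.pi * I * τ * ((k : ℂ) + 1) ^ 2) * cos (2 * (k + 1) * x)) by linear_combination h)
  rw [norm_neg, norm_mul, norm_one, Complex.norm_two] at h'
  norm_num at hn
  linarith

/-- Relative to the leading term, the `k`-th term is at most `9⁻ᵏ · (2k+1) ≤ 3⁻ᵏ`, so the tail is at
most half of it. A quantitative bound is needed, because the nonvanishing of `θ₁'(0)` is read off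
from it in the limit `x → 0`. -/
lemma le_norm_theta1_of_im_large {τ : ℂ} (hτ : Real.exp (-Real.pi * τ.im) ≤ 1 / 9) (x : ℝ) :
    ‖exp (Real.pi * I * τ * (1 / 4))‖ * |Real.sin x| ≤ ‖theta1 x τ‖ := by
  set f : ℕ → ℂ := fun k => (-1) ^ k * exp (Real.pi * I * τ * ((k : ℂ) + 1 / 2) ^ 2) *
    sin ((2 * k + 1) * x) with hf
  set c := ‖exp (Real.pi * I * τ * (1 / 4))‖ * |Real.sin x| with hc
  have hc0 : 0 ≤ c := by positivity
  have hb : ∀ k : ℕ, ‖f k‖ ≤ c * (1 / 3) ^ k := by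
    intro k
    have h1 : exp (Real.pi * I * τ * ((k : ℂ) + 1 / 2) ^ 2) = exp (Real.pi * I * τ * (1 / 4)) *
        exp (Real.pi * I * τ * ((k ^ 2 + k : ℝ) : ℂ)) := by
      rw [← Complex.exp_add]; congr 1; push_cast; ring
    have h2 : ‖sin ((2 * k + 1) * x)‖ ≤ 3 ^ k * |Real.sin x| := by
      have : ((2 * k + 1) * x : ℂ) = (((2 * k + 1 : ℕ) * x : ℝ) : ℂ) := by push_cast; ring
      rw [this, ← Complex.ofReal_sin, Complex.norm_real]
      refine (abs_sin_nat_mul_le _ _).trans ?_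
      gcongr
      have h3 := one_add_mul_le_pow (a := (2 : ℝ)) (by norm_num) k
      push_cast
      norm_num at h3
      linarith
    have h3 := norm_exp_pi_mul_le hτ (c := (k : ℝ) ^ 2 + k) (k := k) (by nlinarith)
    rw [hf]
    simp only [norm_mul, norm_pow, norm_neg, norm_one, one_pow, one_mul]
    rw [h1, norm_mul]
    calc _ ≤ ‖exp (Real.pi * I * τ * (1 / 4))‖ * (1 / 9) ^ k * (3 ^ k * |Real.sin x|) := by gcongr
      _ = c * ((1 / 9) ^ k * 3 ^ k) := by rw [hc]; ring
      _ = _ := by rw [← mul_pow]; norm_num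
  have hsum : HasSum (fun k : ℕ => c * (1 / 3 : ℝ) ^ k) (c * (1 - 1 / 3)⁻¹) :=
    (hasSum_geometric_of_lt_one (by norm_num) (by norm_num)).mul_left _
  have hfs : Summable f := hsum.summable.of_norm_bounded hb
  have htail : ‖∑' k, f (k + 1)‖ ≤ c * (1 / 2) := by
    have : HasSum (fun k : ℕ => c * (1 / 3 : ℝ) ^ (k + 1)) (c * (1 / 2)) := by
      have h := (hasSum_nat_add_iff' 1).mpr hsum
      rwa [show c * (1 - 1 / 3)⁻¹ - ∑ i ∈ Finset.range 1, c * (1 / 3) ^ i = c * (1 / 2) by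
        rw [Finset.sum_range_one]; ring] at h
    exact tsum_of_norm_bounded this fun k => hb (k + 1)
  have h0 : f 0 = exp (Real.pi * I * τ * (1 / 4)) * sin x := by
    simp only [hf]; norm_num
  have h0n : ‖f 0‖ = c := by
    rw [h0, norm_mul, ← Complex.ofReal_sin, Complex.norm_real, Real.norm_eq_abs]
  have ht : theta1 x τ = 2 * (f 0 + ∑' k, f (k + 1)) := by
    rw [← hfs.tsum_eq_zero_add]; rfl
  rw [ht, norm_mul, Complex.norm_two]
  have := norm_sub_le_norm_add (f 0) (∑' k, f (k + 1))
  rw [h0n] at this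
  linarith

lemma exists_two_pow_im_large {τ : ℂ} (hτ : 0 < τ.im) :
    ∃ N : ℕ, Real.exp (-Real.pi * (2 ^ N * τ).im) ≤ 1 / 9 := by
  have h : Filter.Tendsto (fun N : ℕ => Real.exp (-Real.pi * τ.im * 2 ^ N)) atTop (𝓝 0) := by
    refine Real.tendsto_exp_atBot.comp ?_
    refine (tendsto_pow_atTop_atTop_of_one_lt one_lt_two).const_mul_atTop_of_neg ?_
    nlinarith [Real.pi_pos]
  obtain ⟨N, hN⟩ := (h.eventually (ge_mem_nhds (show (0 : ℝ) < 1 / 9 by norm_num))).exists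
  refine ⟨N, ?_⟩
  have : (2 ^ N * τ).im = 2 ^ N * τ.im := by
    have := Complex.im_ofReal_mul (2 ^ N) τ
    simpa using this
  rwa [this, ← mul_assoc, mul_right_comm]

/-- Descent by doubling `τ`: since `θ₄(2x|2τ) θ₄(0|2τ) = θ₃(x|τ) θ₄(x|τ)`, a real zero for `τ`
produces one for `2τ`. After `N` doublings the nome is small and the series estimate applies. -/
lemma theta4_ne_zero_aux (N : ℕ) : ∀ {τ : ℂ}, 0 < τ.im →
    Real.exp (-Real.pi * (2 ^ N * τ).im) ≤ 1 / 9 → ∀ x : ℝ, theta4 x τ ≠ 0 := by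
  induction N with
  | zero => intro τ _ h x; exact theta4_ne_zero_of_im_large (by simpa using h) x
  | succ N ih =>
    intro τ hτ h x
    have h2 : 0 < (2 * τ).im := by simpa using hτ
    have ih' := ih h2 (by rwa [← mul_assoc, ← pow_succ])
    intro h0
    have := theta4_two_mul x hτ
    rw [h0, mul_zero] at this
    rcases mul_eq_zero.mp this with h1 | h1
    · exact ih' (2 * x) (by exact_mod_cast h1)
    · exact ih' 0 (by exact_mod_cast h1)

lemma theta4_ne_zero {τ : ℂ} (hτ : 0 < τ.im) (x : ℝ) : theta4 x τ ≠ 0 := by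
  obtain ⟨N, hN⟩ := exists_two_pow_im_large hτ
  exact theta4_ne_zero_aux N hτ hN x

lemma theta3_ne_zero {τ : ℂ} (hτ : 0 < τ.im) (x : ℝ) : theta3 x τ ≠ 0 := by
  have := theta4_ne_zero hτ (x - Real.pi / 2)
  push_cast at this
  rwa [theta4_sub_pi_div_two] at this

lemma theta1_ne_zero_aux (N : ℕ) : ∀ {τ : ℂ}, 0 < τ.im →
    Real.exp (-Real.pi * (2 ^ N * τ).im) ≤ 1 / 9 → ∀ x : ℝ, Real.sin x ≠ 0 → theta1 x τ ≠ 0 := by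
  induction N with
  | zero =>
    intro τ _ h x hx h0
    have := le_norm_theta1_of_im_large (τ := τ) (by simpa using h) x
    rw [h0, norm_zero] at this
    have : 0 < ‖exp (Real.pi * I * τ * (1 / 4))‖ * |Real.sin x| :=
      mul_pos (norm_pos_iff.mpr (exp_ne_zero _)) (abs_pos.mpr hx)
    linarith
  | succ N ih =>
    intro τ hτ h x hx h0
    have h2 : 0 < (2 * τ).im := by simpa using hτ
    have := two_mul_theta1_mul_theta4 x hτ
    rw [h0, zero_mul] at this
    rcases mul_eq_zero.mp ((mul_eq_zero.mp this).resolve_left two_ne_zero) with h1 | h1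
    · exact ih h2 (by rwa [← mul_assoc, ← pow_succ]) x hx h1
    · exact theta4_ne_zero h2 x h1

lemma theta1_ne_zero {τ : ℂ} (hτ : 0 < τ.im) {x : ℝ} (hx : Real.sin x ≠ 0) : theta1 x τ ≠ 0 := by
  obtain ⟨N, hN⟩ := exists_two_pow_im_large hτ
  exact theta1_ne_zero_aux N hτ hN x hx

lemma theta2_ne_zero {τ : ℂ} (hτ : 0 < τ.im) {x : ℝ} (hx : Real.cos x ≠ 0) : theta2 x τ ≠ 0 := by
  have := theta1_ne_zero hτ (x := x - Real.pi / 2) (by rwa [Real.sin_sub_pi_div_two, neg_ne_zero])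
  push_cast at this
  rwa [theta1_sub_pi_div_two, neg_ne_zero] at this

/-- The derivative at the origin of `2 θ₁(z|2τ) θ₄(z|2τ) = θ₁(z|τ) θ₂(0|τ)`; it carries the
nonvanishing of `θ₁'(0)` from `2τ` to `τ`. -/
lemma deriv_theta1_zero_mul {τ : ℂ} (hτ : 0 < τ.im) :
    2 * (deriv (fun u => theta1 u (2 * τ)) 0 * theta4 0 (2 * τ)) =
      deriv (fun u => theta1 u τ) 0 * theta2 0 τ := by
  have h2 : 0 < (2 * τ).im := by simpa using hτ
  have e : deriv (fun z => 2 * (theta1 z (2 * τ) * theta4 z (2 * τ))) 0 =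
      deriv (fun z => theta1 z τ * theta2 0 τ) 0 :=
    congrArg (fun f => deriv f 0) (funext fun z => two_mul_theta1_mul_theta4 z hτ)
  have d1 : DifferentiableAt ℂ (fun u => theta1 u (2 * τ)) 0 := differentiable_theta1 h2 0
  have d4 : DifferentiableAt ℂ (fun u => theta4 u (2 * τ)) 0 := differentiable_theta4 h2 0
  have d0 : DifferentiableAt ℂ (fun u => theta1 u τ) 0 := differentiable_theta1 hτ 0
  rw [deriv_const_mul _ (d1.fun_mul d4), deriv_fun_mul d1 d4, theta1_zero, zero_mul, add_zero,
    deriv_mul_const d0] at e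
  exact e

lemma deriv_theta1_ne_zero_of_im_large {τ : ℂ} (h0τ : 0 < τ.im)
    (hτ : Real.exp (-Real.pi * τ.im) ≤ 1 / 9) : deriv (fun u => theta1 u τ) 0 ≠ 0 := by
  set c := ‖exp (Real.pi * I * τ * (1 / 4))‖ with hc
  have hcpos : 0 < c := norm_pos_iff.mpr (exp_ne_zero _)
  have hd : HasDerivAt (fun x : ℝ => theta1 x τ) (deriv (fun u => theta1 u τ) 0) 0 := by
    have := ((differentiable_theta1 h0τ) ((0 : ℝ) : ℂ)).hasDerivAt.comp_ofReal
    simpa using this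
  intro hz
  rw [hz] at hd
  have h1 := hd.tendsto_slope_zero.norm
  have h2 := (Real.hasDerivAt_sin 0).tendsto_slope_zero.norm.const_mul c
  have : c * ‖Real.cos 0‖ ≤ ‖(0 : ℂ)‖ := by
    refine le_of_tendsto_of_tendsto h2 h1 (Eventually.of_forall fun x => ?_)
    have := le_norm_theta1_of_im_large hτ x
    simp only [zero_add, Real.sin_zero, sub_zero, norm_smul, Complex.ofReal_zero, theta1_zero,
      Real.norm_eq_abs]
    calc _ = |x⁻¹| * (c * |Real.sin x|) := by ring
      _ ≤ _ := by gcongr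
  simp at this
  linarith

lemma deriv_theta1_ne_zero {τ : ℂ} (hτ : 0 < τ.im) : deriv (fun u => theta1 u τ) 0 ≠ 0 := by
  obtain ⟨N, hN⟩ := exists_two_pow_im_large hτ
  induction N generalizing τ with
  | zero => exact deriv_theta1_ne_zero_of_im_large hτ (by simpa using hN)
  | succ N ih =>
    have h2 : 0 < (2 * τ).im := by simpa using hτ
    have h := ih h2 (by rwa [← mul_assoc, ← pow_succ])
    have h4 : theta4 0 (2 * τ) ≠ 0 := by exact_mod_cast theta4_ne_zero h2 0
    intro h0
    have e := deriv_theta1_zero_mul hτ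
    rw [h0, zero_mul] at e
    simp_all

lemma im_two_mul_pos {τ : ℂ} (hτ : 0 < τ.im) : 0 < (2 * τ).im := by simpa using hτ

lemma eta0_eq : eta0 = ((Real.pi / 3 : ℝ) : ℂ) := by simp [eta0]

lemma two_mul_eta0_eq : 2 * eta0 = ((2 * (Real.pi / 3) : ℝ) : ℂ) := by simp [eta0]

lemma sin_two_pi_div_three : Real.sin (2 * (Real.pi / 3)) ≠ 0 := by
  rw [Real.sin_two_mul, Real.sin_pi_div_three, Real.cos_pi_div_three]
  positivity

lemma theta4_two_eta0_ne_zero {τ : ℂ} (hτ : 0 < τ.im) : theta4 (2 * eta0) (2 * τ) ≠ 0 := by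
  rw [two_mul_eta0_eq]; exact theta4_ne_zero (im_two_mul_pos hτ) _

lemma theta1_two_eta0_ne_zero {τ : ℂ} (hτ : 0 < τ.im) : theta1 (2 * eta0) (2 * τ) ≠ 0 := by
  rw [two_mul_eta0_eq]; exact theta1_ne_zero (im_two_mul_pos hτ) sin_two_pi_div_three

lemma theta4_zero_ne_zero {τ : ℂ} (hτ : 0 < τ.im) : theta4 0 τ ≠ 0 := by
  exact_mod_cast theta4_ne_zero hτ 0

lemma theta3_zero_ne_zero {τ : ℂ} (hτ : 0 < τ.im) : theta3 0 τ ≠ 0 := by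
  exact_mod_cast theta3_ne_zero hτ 0

lemma theta2_zero_ne_zero {τ : ℂ} (hτ : 0 < τ.im) : theta2 0 τ ≠ 0 := by
  exact_mod_cast theta2_ne_zero hτ (x := 0) (by simp)

lemma theta1_eta0_ne_zero {τ : ℂ} (hτ : 0 < τ.im) : theta1 eta0 τ ≠ 0 := by
  rw [eta0_eq]
  exact theta1_ne_zero hτ (by rw [Real.sin_pi_div_three]; positivity)

lemma theta2_eta0_ne_zero {τ : ℂ} (hτ : 0 < τ.im) : theta2 eta0 τ ≠ 0 := by
  rw [eta0_eq]
  exact theta2_ne_zero hτ (by rw [Real.cos_pi_div_three]; positivity)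

lemma chi_ne_zero {τ : ℂ} (hτ : 0 < τ.im) : chi τ ≠ 0 := by
  have := deriv_theta1_ne_zero hτ
  have := theta2_eta0_ne_zero hτ
  have := theta1_eta0_ne_zero hτ
  have := theta2_zero_ne_zero hτ
  rw [chi]
  positivity

lemma rho_ne_zero {τ : ℂ} (hτ : 0 < τ.im) : rho τ ≠ 0 := by
  have := theta2_zero_ne_zero hτ
  have := theta4_zero_ne_zero (im_two_mul_pos hτ)
  rw [rho]
  exact div_ne_zero two_ne_zero (mul_ne_zero ‹_› ‹_›)

/-! ### Relations between the Boltzmann weights -/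

lemma weightC_mul_weightD {η τ : ℂ} (hη : theta4 (2 * η) (2 * τ) ≠ 0) (u : ℂ) :
    weightC u η τ * weightD u η τ = zeta η τ * (weightA u η τ * weightB u η τ) := by
  simp only [weightA, weightB, weightC, weightD, zeta]
  field_simp

/-- By the Landen-type identity, `a ± b` and `c ± d` separate into a function of `u` times a
function of `η`. Both the quadratic relation between the weights and the appearance of `log θ₁` in
the first derivative come from this. -/
lemma weightA_add_weightB (u η : ℂ) {τ : ℂ} (hτ : 0 < τ.im) :
    weightA u η τ + weightB u η τ =
      rho τ * theta4 (2 * η) (2 * τ) * (theta1 u τ * theta2 η τ) := by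
  rw [theta1_mul_theta2 u η hτ]
  simp only [weightA, weightB]
  ring

lemma weightA_sub_weightB (u η : ℂ) {τ : ℂ} (hτ : 0 < τ.im) :
    weightA u η τ - weightB u η τ =
      rho τ * theta4 (2 * η) (2 * τ) * (theta1 η τ * theta2 u τ) := by
  rw [theta1_mul_theta2 η u hτ, show η - u = -(u - η) by ring, theta4_neg, theta1_neg]
  simp only [weightA, weightB, add_comm η u]
  ring

lemma weightC_add_weightD (u η : ℂ) {τ : ℂ} (hτ : 0 < τ.im) :
    weightC u η τ + weightD u η τ =
      rho τ * theta1 (2 * η) (2 * τ) * (theta4 u τ * theta3 η τ) := by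
  rw [theta4_mul_theta3 u η hτ]
  simp only [weightC, weightD]
  ring

lemma weightC_sub_weightD (u η : ℂ) {τ : ℂ} (hτ : 0 < τ.im) :
    weightC u η τ - weightD u η τ =
      rho τ * theta1 (2 * η) (2 * τ) * (theta4 η τ * theta3 u τ) := by
  rw [theta4_mul_theta3 η u hτ, show η - u = -(u - η) by ring, theta4_neg, theta1_neg]
  simp only [weightC, weightD, add_comm η u]
  ring

lemma theta4_zero_pow_four {τ : ℂ} (hτ : 0 < τ.im) : theta4 0 (2 * τ) ^ 4 =
    theta3 0 (2 * τ) ^ 4 - theta2 0 (2 * τ) ^ 4 := by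
  have h := theta4_two_mul 0 hτ
  have h3 := theta3_sq 0 hτ
  have h4 := theta4_sq 0 hτ
  simp only [mul_zero] at h h3 h4
  calc theta4 0 (2 * τ) ^ 4 = (theta4 0 (2 * τ) * theta4 0 (2 * τ)) ^ 2 := by ring
    _ = theta3 0 τ ^ 2 * theta4 0 τ ^ 2 := by rw [h]; ring
    _ = _ := by rw [h3, h4]; ring

lemma theta4_two_mul_sq (η : ℂ) {τ : ℂ} (hτ : 0 < τ.im) :
    theta4 (2 * η) (2 * τ) ^ 2 * theta4 0 (2 * τ) ^ 2 =
    theta3 (2 * η) (2 * τ) ^ 2 * theta3 0 (2 * τ) ^ 2 -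
      theta2 (2 * η) (2 * τ) ^ 2 * theta2 0 (2 * τ) ^ 2 := by
  rw [← mul_pow, theta4_two_mul η hτ, mul_pow, theta3_sq η hτ, theta4_sq η hτ]
  ring

lemma theta1_two_mul_sq (η : ℂ) {τ : ℂ} (hτ : 0 < τ.im) :
    theta1 (2 * η) (2 * τ) ^ 2 * theta4 0 (2 * τ) ^ 2 =
    theta3 (2 * η) (2 * τ) ^ 2 * theta2 0 (2 * τ) ^ 2 -
      theta2 (2 * η) (2 * τ) ^ 2 * theta3 0 (2 * τ) ^ 2 := by
  rw [← mul_pow, theta1_two_mul η hτ, mul_pow, theta1_sq η hτ, theta2_sq η hτ]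
  ring

lemma Gam_eq {η τ : ℂ} (hτ : 0 < τ.im) (hη : theta4 (2 * η) (2 * τ) ≠ 0) :
    Gam η τ * (theta2 0 (2 * τ) * theta3 0 (2 * τ) *
      (theta3 (2 * η) (2 * τ) ^ 2 * theta3 0 (2 * τ) ^ 2 -
      theta2 (2 * η) (2 * τ) ^ 2 * theta2 0 (2 * τ) ^ 2)) =
    theta2 (2 * η) (2 * τ) * theta3 (2 * η) (2 * τ) *
      (theta3 0 (2 * τ) ^ 4 - theta2 0 (2 * τ) ^ 4) := by
  have h2 := theta2_zero_ne_zero (im_two_mul_pos hτ)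
  have h3 := theta3_zero_ne_zero (im_two_mul_pos hτ)
  rw [← theta4_two_mul_sq η hτ, ← theta4_zero_pow_four hτ, Gam]
  field_simp

/-- In terms of `a ± b` and `c ± d`, the squares of the factorized expressions are bilinear in `θ₂`,
`θ₃` at `2u`, `2η` and `0` with parameter `2τ`. After clearing denominators the claim is a
polynomial identity in these six values. -/
lemma weight_quadratic {η τ : ℂ} (hτ : 0 < τ.im) (hη : theta4 (2 * η) (2 * τ) ≠ 0) (u : ℂ) :
    weightA u η τ ^ 2 + weightB u η τ ^ 2 - weightC u η τ ^ 2 - weightD u η τ ^ 2 =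
      2 * Gam η τ * (weightA u η τ * weightB u η τ) := by
  have h2 := theta2_zero_ne_zero (im_two_mul_pos hτ)
  have h3 := theta3_zero_ne_zero (im_two_mul_pos hτ)
  have h4 := theta4_zero_ne_zero (im_two_mul_pos hτ)
  have hX : theta3 (2 * η) (2 * τ) ^ 2 * theta3 0 (2 * τ) ^ 2 -
      theta2 (2 * η) (2 * τ) ^ 2 * theta2 0 (2 * τ) ^ 2 ≠ 0 := by
    rw [← theta4_two_mul_sq η hτ]; positivity
  have e1 : (weightA u η τ + weightB u η τ) ^ 2 * theta4 0 (2 * τ) ^ 2 = rho τ ^ 2 *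
      (theta4 (2 * η) (2 * τ) ^ 2 * theta4 0 (2 * τ) ^ 2) * (theta1 u τ ^ 2 * theta2 η τ ^ 2) := by
    rw [weightA_add_weightB u η hτ]; ring
  have e2 : (weightA u η τ - weightB u η τ) ^ 2 * theta4 0 (2 * τ) ^ 2 = rho τ ^ 2 *
      (theta4 (2 * η) (2 * τ) ^ 2 * theta4 0 (2 * τ) ^ 2) * (theta1 η τ ^ 2 * theta2 u τ ^ 2) := by
    rw [weightA_sub_weightB u η hτ]; ring
  have e3 : (weightC u η τ + weightD u η τ) ^ 2 * theta4 0 (2 * τ) ^ 2 = rho τ ^ 2 *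
      (theta1 (2 * η) (2 * τ) ^ 2 * theta4 0 (2 * τ) ^ 2) * (theta4 u τ ^ 2 * theta3 η τ ^ 2) := by
    rw [weightC_add_weightD u η hτ]; ring
  have e4 : (weightC u η τ - weightD u η τ) ^ 2 * theta4 0 (2 * τ) ^ 2 = rho τ ^ 2 *
      (theta1 (2 * η) (2 * τ) ^ 2 * theta4 0 (2 * τ) ^ 2) * (theta4 η τ ^ 2 * theta3 u τ ^ 2) := by
    rw [weightC_sub_weightD u η hτ]; ring
  rw [theta4_two_mul_sq η hτ, theta1_sq _ hτ, theta2_sq _ hτ] at e1 e2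
  rw [theta1_two_mul_sq η hτ, theta4_sq _ hτ, theta3_sq _ hτ] at e3 e4
  have hG := Gam_eq hτ hη
  have hK : theta4 0 (2 * τ) ^ 2 * (theta2 0 (2 * τ) * theta3 0 (2 * τ) *
      (theta3 (2 * η) (2 * τ) ^ 2 * theta3 0 (2 * τ) ^ 2 -
      theta2 (2 * η) (2 * τ) ^ 2 * theta2 0 (2 * τ) ^ 2)) ≠ 0 := by positivity
  apply mul_right_cancel₀ hK
  generalize theta2 0 (2 * τ) = B at *
  generalize theta3 0 (2 * τ) = A at *
  generalize theta3 (2 * η) (2 * τ) = p at *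
  generalize theta2 (2 * η) (2 * τ) = q at *
  generalize theta3 (2 * u) (2 * τ) = P at *
  generalize theta2 (2 * u) (2 * τ) = Q at *
  generalize weightA u η τ = a at *
  generalize weightB u η τ = b at *
  generalize weightC u η τ = c at *
  generalize weightD u η τ = d at *
  generalize theta4 0 (2 * τ) = t at *
  -- The left side is half of the combination `(a+b)² + (a-b)² - (c+d)² - (c-d)²`, and on the right
  -- `4ab = (a+b)² - (a-b)²`.
  linear_combination (B * A * (p ^ 2 * A ^ 2 - q ^ 2 * B ^ 2)) / 2 * (e1 + e2 - e3 - e4)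
    - 2 * a * b * t ^ 2 * hG - q * p * (A ^ 4 - B ^ 4) / 2 * (e1 - e2)

/-- The analogue of expressing `cn² dn²` through `sn²`. The coefficient of `ζ` does not depend on
`η`, so differentiating in `η` yields `Γ'`. -/
lemma Gam_sq {η τ : ℂ} (hτ : 0 < τ.im) (hη : theta4 (2 * η) (2 * τ) ≠ 0) :
    Gam η τ ^ 2 = 1 - (theta3 0 (2 * τ) ^ 4 + theta2 0 (2 * τ) ^ 4) /
      (theta3 0 (2 * τ) ^ 2 * theta2 0 (2 * τ) ^ 2) * zeta η τ + zeta η τ ^ 2 := by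
  have h2 := theta2_zero_ne_zero (im_two_mul_pos hτ)
  have h3 := theta3_zero_ne_zero (im_two_mul_pos hτ)
  have h4 := theta4_zero_ne_zero (im_two_mul_pos hτ)
  have hX : theta3 (2 * η) (2 * τ) ^ 2 * theta3 0 (2 * τ) ^ 2 -
      theta2 (2 * η) (2 * τ) ^ 2 * theta2 0 (2 * τ) ^ 2 ≠ 0 := by
    rw [← theta4_two_mul_sq η hτ]; positivity
  have hz : zeta η τ = (theta3 (2 * η) (2 * τ) ^ 2 * theta2 0 (2 * τ) ^ 2 -
      theta2 (2 * η) (2 * τ) ^ 2 * theta3 0 (2 * τ) ^ 2) /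
      (theta3 (2 * η) (2 * τ) ^ 2 * theta3 0 (2 * τ) ^ 2 -
      theta2 (2 * η) (2 * τ) ^ 2 * theta2 0 (2 * τ) ^ 2) := by
    rw [← theta4_two_mul_sq η hτ, ← theta1_two_mul_sq η hτ, zeta]
    field_simp
  have hG : Gam η τ = theta2 (2 * η) (2 * τ) * theta3 (2 * η) (2 * τ) *
      (theta3 0 (2 * τ) ^ 4 - theta2 0 (2 * τ) ^ 4) / (theta2 0 (2 * τ) * theta3 0 (2 * τ) *
      (theta3 (2 * η) (2 * τ) ^ 2 * theta3 0 (2 * τ) ^ 2 -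
      theta2 (2 * η) (2 * τ) ^ 2 * theta2 0 (2 * τ) ^ 2)) := by
    rw [eq_div_iff (by positivity), Gam_eq hτ hη]
  rw [hz, hG]
  field_simp
  ring

lemma theta1_two_eta0_add (τ : ℂ) : theta1 (Real.pi + eta0) τ = -theta1 (Real.pi - eta0) τ ∧
    theta4 (Real.pi + eta0) τ = theta4 (Real.pi - eta0) τ := by
  have e : (Real.pi + eta0 - Real.pi : ℂ) = -(Real.pi - eta0 - Real.pi) := by ring
  constructor
  · have h1 := theta1_sub_pi (Real.pi + eta0) τ
    have h2 := theta1_sub_pi (Real.pi - eta0) τ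
    rw [e, theta1_neg] at h1
    linear_combination h1 + h2
  · have h1 := theta4_sub_pi (Real.pi + eta0) τ
    have h2 := theta4_sub_pi (Real.pi - eta0) τ
    rw [e, theta4_neg] at h1
    rw [← h1, h2]

lemma Gam_eta0 {τ : ℂ} (hτ : 0 < τ.im) : Gam eta0 τ = (zeta eta0 τ ^ 2 - 1) / 2 := by
  have h4 := theta4_two_eta0_ne_zero hτ
  have h1 := theta1_two_eta0_ne_zero hτ
  have hr := rho_ne_zero hτ
  -- The value `u = π` is special at `η = π/3`: there `u - η = 2η`, and `u + η` is its reflection in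
  -- `π`. All weights become monomials in `θ₁(2η|2τ)` and `θ₄(2η|2τ)`, with `a = -b` and `c = b`.
  have h := weight_quadratic hτ h4 Real.pi
  simp only [weightA, weightB, weightC, weightD, theta1_two_eta0_add] at h
  have e : (Real.pi : ℂ) - eta0 = 2 * eta0 := by rw [eta0]; ring
  rw [e] at h
  have hz : zeta eta0 τ * theta4 (2 * eta0) (2 * τ) ^ 2 = theta1 (2 * eta0) (2 * τ) ^ 2 := by
    rw [zeta]; field_simp
  have hK : rho τ ^ 2 * theta1 (2 * eta0) (2 * τ) ^ 2 * theta4 (2 * eta0) (2 * τ) ^ 4 ≠ 0 := by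
    positivity
  apply mul_left_cancel₀ hK
  linear_combination h / 2 - rho τ ^ 2 * theta1 (2 * eta0) (2 * τ) ^ 2 / 2 *
    (zeta eta0 τ * theta4 (2 * eta0) (2 * τ) ^ 2 + theta1 (2 * eta0) (2 * τ) ^ 2) * hz

lemma zeta_eta0_ne_zero {τ : ℂ} (hτ : 0 < τ.im) : zeta eta0 τ ≠ 0 := by
  have h4 := theta4_two_eta0_ne_zero hτ
  have h1 := theta1_two_eta0_ne_zero hτ
  rw [zeta]; positivity

lemma hasDerivAt_theta1 (z : ℂ) {τ : ℂ} (hτ : 0 < τ.im) :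
    HasDerivAt (fun u => theta1 u τ) (deriv (fun u => theta1 u τ) z) z :=
  (differentiable_theta1 hτ z).hasDerivAt

lemma hasDerivAt_theta2 (z : ℂ) {τ : ℂ} (hτ : 0 < τ.im) :
    HasDerivAt (fun u => theta2 u τ) (deriv (fun u => theta2 u τ) z) z :=
  (differentiable_theta2 hτ z).hasDerivAt

lemma hasDerivAt_theta4 (z : ℂ) {τ : ℂ} (hτ : 0 < τ.im) :
    HasDerivAt (fun u => theta4 u τ) (deriv (fun u => theta4 u τ) z) z :=
  (differentiable_theta4 hτ z).hasDerivAt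

/-- Antisymmetrizing `θ₁(y|2τ) θ₄(z|2τ)` in `y` and `z` gives `θ₁((y-z)/2|τ) θ₂((y+z)/2|τ)`; the
Wronskian is the derivative of this in `y` at `y = z`. -/
lemma wronskian_theta1_theta4 (z : ℂ) {τ : ℂ} (hτ : 0 < τ.im) :
    2 * (deriv (fun u => theta1 u (2 * τ)) z * theta4 z (2 * τ) -
      theta1 z (2 * τ) * deriv (fun u => theta4 u (2 * τ)) z) =
      deriv (fun u => theta1 u τ) 0 * theta2 z τ := by
  have h2 := im_two_mul_pos hτ
  have h1 : HasDerivAt (fun y => theta1 y (2 * τ) * theta4 z (2 * τ) -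
      theta4 y (2 * τ) * theta1 z (2 * τ)) (deriv (fun u => theta1 u (2 * τ)) z * theta4 z (2 * τ) -
      deriv (fun u => theta4 u (2 * τ)) z * theta1 z (2 * τ)) z :=
    ((hasDerivAt_theta1 z h2).mul_const _).sub ((hasDerivAt_theta4 z h2).mul_const _)
  have hl : HasDerivAt (fun y : ℂ => (y - z) / 2) (1 / 2) z :=
    ((hasDerivAt_id z).sub_const z).div_const 2
  have hr : HasDerivAt (fun y : ℂ => (y + z) / 2) (1 / 2) z :=
    ((hasDerivAt_id z).add_const z).div_const 2
  have h3 : HasDerivAt (fun y => theta1 ((y - z) / 2) τ * theta2 ((y + z) / 2) τ) _ z :=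
    (HasDerivAt.comp (h₂ := fun u => theta1 u τ) z (hasDerivAt_theta1 ((z - z) / 2) hτ) hl).mul
      (HasDerivAt.comp (h₂ := fun u => theta2 u τ) z (hasDerivAt_theta2 ((z + z) / 2) hτ) hr)
  have e : (fun y => theta1 ((y - z) / 2) τ * theta2 ((y + z) / 2) τ) = fun y =>
      theta1 y (2 * τ) * theta4 z (2 * τ) - theta4 y (2 * τ) * theta1 z (2 * τ) := by
    funext y
    rw [theta1_mul_theta2 _ _ hτ, show (y - z) / 2 + (y + z) / 2 = y by ring,
      show (y - z) / 2 - (y + z) / 2 = -z by ring, theta4_neg, theta1_neg]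
    ring
  rw [e] at h3
  have h4 := h1.unique h3
  simp only [Function.comp, sub_self, zero_div, theta1_zero, zero_mul, add_zero] at h4
  rw [show (z + z) / 2 = z by ring] at h4
  linear_combination 2 * h4

/-- The quotient `θ₁(z|2τ) / θ₄(z|2τ)`, a multiple of Jacobi's `sn`. -/
def thetaQuot (z τ : ℂ) : ℂ := theta1 z (2 * τ) / theta4 z (2 * τ)

/-- The derivative of `thetaQuot` at the origin. -/
def thetaQuotSlope (τ : ℂ) : ℂ := deriv (fun u => theta1 u (2 * τ)) 0 / theta4 0 (2 * τ)

lemma zeta_eq_sq (η τ : ℂ) : zeta η τ = thetaQuot (2 * η) τ ^ 2 := by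
  rw [zeta, thetaQuot, div_pow]

lemma thetaQuotSlope_mul_Gam {η τ : ℂ} (hτ : 0 < τ.im) :
    thetaQuotSlope τ * Gam η τ =
      deriv (fun u => theta1 u τ) 0 * theta2 (2 * η) τ / (2 * theta4 (2 * η) (2 * τ) ^ 2) := by
  have h2 := theta2_zero_ne_zero (im_two_mul_pos hτ)
  have h3 := theta3_zero_ne_zero (im_two_mul_pos hτ)
  have h4 := theta4_zero_ne_zero (im_two_mul_pos hτ)
  have h20 := theta2_zero_ne_zero hτ
  have e1 := deriv_theta1_zero_mul hτ
  have e2 := two_mul_theta2_mul_theta3 (2 * η) hτ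
  have e3 := two_mul_theta2_mul_theta3 0 hτ
  have e4 : Gam η τ = theta2 (2 * η) τ * theta4 0 (2 * τ) ^ 2 /
      (theta2 0 τ * theta4 (2 * η) (2 * τ) ^ 2) := by
    have a2 : theta2 (2 * η) (2 * τ) * theta3 (2 * η) (2 * τ) =
      theta2 (2 * η) τ * theta2 0 τ / 2 := by linear_combination e2 / 2
    have a3 : theta2 0 (2 * τ) * theta3 0 (2 * τ) = theta2 0 τ * theta2 0 τ / 2 := by
      linear_combination e3 / 2
    rw [Gam, a2, a3]
    field_simp
  have e5 : deriv (fun u => theta1 u τ) 0 =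
      2 * (deriv (fun u => theta1 u (2 * τ)) 0 * theta4 0 (2 * τ)) / theta2 0 τ := by
    rw [e1]; field_simp
  rw [e4, e5, thetaQuotSlope]
  field_simp

/-- The analogue of `sn' = cn dn`, with `Γ` in the role of `cn dn`. -/
lemma hasDerivAt_thetaQuot {η τ : ℂ} (hτ : 0 < τ.im) (hη : theta4 (2 * η) (2 * τ) ≠ 0) :
    HasDerivAt (fun z => thetaQuot z τ) (thetaQuotSlope τ * Gam η τ) (2 * η) := by
  have h2 := im_two_mul_pos hτ
  have h := (hasDerivAt_theta1 (2 * η) h2).div (hasDerivAt_theta4 (2 * η) h2) hη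
  rw [thetaQuotSlope_mul_Gam hτ, ← wronskian_theta1_theta4 _ hτ, mul_div_mul_left _ _ two_ne_zero]
  exact h

lemma hasDerivAt_zeta {η τ : ℂ} (hτ : 0 < τ.im) (hη : theta4 (2 * η) (2 * τ) ≠ 0) :
    HasDerivAt (fun η => zeta η τ) (4 * thetaQuot (2 * η) τ * (thetaQuotSlope τ * Gam η τ)) η := by
  simp_rw [zeta_eq_sq]
  have h1 : HasDerivAt (fun η : ℂ => 2 * η) 2 η := by simpa using (hasDerivAt_id η).const_mul 2
  have h := (HasDerivAt.comp (h₂ := fun z => thetaQuot z τ) η (hasDerivAt_thetaQuot hτ hη) h1).pow 2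
  refine h.congr_deriv ?_
  simp only [Function.comp]
  push_cast
  ring

lemma analyticAt_theta1_comp {E : Type*} [NormedAddCommGroup E] [NormedSpace ℂ E] {τ : ℂ}
    (hτ : 0 < τ.im) {f : E → ℂ} {x : E} (hf : AnalyticAt ℂ f x) :
    AnalyticAt ℂ (fun y => theta1 (f y) τ) x :=
  ((differentiable_theta1 hτ).analyticAt (f x)).comp hf

lemma analyticAt_theta2_comp {E : Type*} [NormedAddCommGroup E] [NormedSpace ℂ E] {τ : ℂ}
    (hτ : 0 < τ.im) {f : E → ℂ} {x : E} (hf : AnalyticAt ℂ f x) :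
    AnalyticAt ℂ (fun y => theta2 (f y) τ) x :=
  ((differentiable_theta2 hτ).analyticAt (f x)).comp hf

lemma analyticAt_theta3_comp {E : Type*} [NormedAddCommGroup E] [NormedSpace ℂ E] {τ : ℂ}
    (hτ : 0 < τ.im) {f : E → ℂ} {x : E} (hf : AnalyticAt ℂ f x) :
    AnalyticAt ℂ (fun y => theta3 (f y) τ) x :=
  ((differentiable_theta3 hτ).analyticAt (f x)).comp hf

lemma analyticAt_theta4_comp {E : Type*} [NormedAddCommGroup E] [NormedSpace ℂ E] {τ : ℂ}
    (hτ : 0 < τ.im) {f : E → ℂ} {x : E} (hf : AnalyticAt ℂ f x) :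
    AnalyticAt ℂ (fun y => theta4 (f y) τ) x :=
  ((differentiable_theta4 hτ).analyticAt (f x)).comp hf

lemma analyticAt_two_mul (η : ℂ) : AnalyticAt ℂ (fun η : ℂ => 2 * η) η :=
  analyticAt_const.mul analyticAt_id

lemma analyticAt_zeta {η τ : ℂ} (hτ : 0 < τ.im) (hη : theta4 (2 * η) (2 * τ) ≠ 0) :
    AnalyticAt ℂ (fun η => zeta η τ) η := by
  have h2 := im_two_mul_pos hτ
  exact ((analyticAt_theta1_comp h2 (analyticAt_two_mul η)).pow 2).div
    ((analyticAt_theta4_comp h2 (analyticAt_two_mul η)).pow 2) (pow_ne_zero _ hη)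

lemma analyticAt_Gam {η τ : ℂ} (hτ : 0 < τ.im) (hη : theta4 (2 * η) (2 * τ) ≠ 0) :
    AnalyticAt ℂ (fun η => Gam η τ) η := by
  have h2 := im_two_mul_pos hτ
  have a2 := theta2_zero_ne_zero h2
  have a3 := theta3_zero_ne_zero h2
  refine (((analyticAt_theta2_comp h2 (analyticAt_two_mul η)).mul
    (analyticAt_theta3_comp h2 (analyticAt_two_mul η))).mul analyticAt_const).div
    (analyticAt_const.mul ((analyticAt_theta4_comp h2 (analyticAt_two_mul η)).pow 2)) ?_
  positivity

lemma eventually_theta4_ne_zero {τ : ℂ} (hτ : 0 < τ.im) :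
    ∀ᶠ η in 𝓝 eta0, theta4 (2 * η) (2 * τ) ≠ 0 :=
  (analyticAt_theta4_comp (im_two_mul_pos hτ)
    (analyticAt_two_mul eta0)).continuousAt.eventually_ne (theta4_two_eta0_ne_zero hτ)

lemma eventually_theta1_ne_zero {τ : ℂ} (hτ : 0 < τ.im) :
    ∀ᶠ η in 𝓝 eta0, theta1 (2 * η) (2 * τ) ≠ 0 :=
  (analyticAt_theta1_comp (im_two_mul_pos hτ)
    (analyticAt_two_mul eta0)).continuousAt.eventually_ne (theta1_two_eta0_ne_zero hτ)

lemma theta2_two_eta0 (τ : ℂ) : theta2 (2 * eta0) τ = -theta2 eta0 τ := by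
  have h := theta2_sub_pi (2 * eta0) τ
  rw [show 2 * eta0 - Real.pi = -eta0 by rw [eta0]; ring, theta2_neg] at h
  rw [h, neg_neg]

lemma theta1_two_eta0 (τ : ℂ) : theta1 (2 * eta0) τ = theta1 eta0 τ := by
  have h := theta1_sub_pi (2 * eta0) τ
  rw [show 2 * eta0 - Real.pi = -eta0 by rw [eta0]; ring, theta1_neg] at h
  linear_combination h

lemma Gam_eta0_ne_zero {τ : ℂ} (hτ : 0 < τ.im) : Gam eta0 τ ≠ 0 := by
  have h := thetaQuotSlope_mul_Gam (η := eta0) hτ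
  have a1 := deriv_theta1_ne_zero hτ
  have a2 := theta2_eta0_ne_zero hτ
  have a4 := theta4_two_eta0_ne_zero hτ
  intro h0
  rw [h0, mul_zero, theta2_two_eta0] at h
  have : deriv (fun u => theta1 u τ) 0 * -theta2 eta0 τ / (2 * theta4 (2 * eta0) (2 * τ) ^ 2) ≠ 0 :=
    div_ne_zero (mul_ne_zero a1 (neg_ne_zero.mpr a2)) (mul_ne_zero two_ne_zero (pow_ne_zero _ a4))
  exact this h.symm

/-- At `η = π/3` the point `2η` is the reflection of `η`, so values of theta functions at `2π/3` can
be replaced by values at `π/3`, where `χ` is defined. -/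
lemma chi_eq {τ : ℂ} (hτ : 0 < τ.im) :
    chi τ * zeta eta0 τ = thetaQuotSlope τ ^ 2 * Gam eta0 τ ^ 2 := by
  have a4 := theta4_two_eta0_ne_zero hτ
  have a1 := theta1_eta0_ne_zero hτ
  have b2 := theta2_zero_ne_zero hτ
  have e : thetaQuot (2 * eta0) τ = theta1 eta0 τ * theta2 0 τ /
      (2 * theta4 (2 * eta0) (2 * τ) ^ 2) := by
    have h := two_mul_theta1_mul_theta4 (2 * eta0) hτ
    rw [theta1_two_eta0 τ] at h
    rw [← h, thetaQuot]; field_simp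
  rw [← mul_pow, thetaQuotSlope_mul_Gam hτ, theta2_two_eta0, zeta_eq_sq, e, chi]
  field_simp

/-- `B = ∂_u b / a` at `u = η = π/3`, multiplied by `ζ ζ' - Γ'`, equals `6 χ`. -/
lemma six_mul_chi {τ : ℂ} (hτ : 0 < τ.im) :
    thetaQuotSlope τ / thetaQuot (2 * eta0) τ *
      (zeta eta0 τ * deriv (fun η => zeta η τ) eta0 - deriv (fun η => Gam η τ) eta0) =
      6 * chi τ := by
  have a4 := theta4_two_eta0_ne_zero hτ
  have hz := hasDerivAt_zeta hτ a4
  have hG := (analyticAt_Gam hτ a4).differentiableAt.hasDerivAt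
  have hGne := Gam_eta0_ne_zero hτ
  have hzne := zeta_eta0_ne_zero hτ
  have hS := zeta_eq_sq eta0 τ
  have hSne : thetaQuot (2 * eta0) τ ≠ 0 := fun h => hzne (by rw [hS, h]; ring)
  have hsq := Gam_sq hτ a4
  have hGv := Gam_eta0 hτ
  have hchi := chi_eq hτ
  set m := (theta3 0 (2 * τ) ^ 4 + theta2 0 (2 * τ) ^ 4) /
      (theta3 0 (2 * τ) ^ 2 * theta2 0 (2 * τ) ^ 2) with hm
  have hev : (fun η => Gam η τ ^ 2) =ᶠ[𝓝 eta0] fun η => 1 - m * zeta η τ + zeta η τ ^ 2 := by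
    filter_upwards [eventually_theta4_ne_zero hτ] with η hη using Gam_sq hτ hη
  have h1 := ((hG.pow 2).congr_of_eventuallyEq hev.symm).unique
    (((hz.const_mul m).const_sub 1).add (hz.pow 2))
  clear_value m
  rw [hz.deriv]
  generalize deriv (fun η => Gam η τ) eta0 = G1 at *
  generalize thetaQuot (2 * eta0) τ = S at *
  generalize thetaQuotSlope τ = k at *
  generalize Gam eta0 τ = G at *
  generalize zeta eta0 τ = z at *
  generalize chi τ = X at *
  have h2 : G1 = 2 * k * S * (2 * z - m) := by
    apply mul_left_cancel₀ hGne
    simp only [Nat.cast_ofNat] at h1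
    linear_combination h1 / 2
  rw [h2]
  -- The extra factor `z` brings in `χ ζ = k² Γ²`. The unknown modulus `m` is then eliminated by `Γ²
  -- = 1 - mζ + ζ²`, and `Γ` by its supersymmetric value.
  have h3 : z * (k / S * (z * (4 * S * (k * G)) - 2 * k * S * (2 * z - m))) = z * (6 * X) := by
    have : k / S * (z * (4 * S * (k * G)) - 2 * k * S * (2 * z - m)) =
        k ^ 2 * (4 * z * G - 4 * z + 2 * m) := by field_simp; ring
    rw [this]
    linear_combination -6 * hchi + 2 * k ^ 2 * hsq + k ^ 2 * (4 - 8 * G) * hGv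
  exact mul_left_cancel₀ hzne h3

/-! ### The weights at the shift point `u = η` -/

section
variable {E : Type*} [NormedAddCommGroup E] [NormedSpace ℂ E] {τ : ℂ} {f g : E → ℂ} {x : E}

lemma analyticAt_weightA (hτ : 0 < τ.im) (hf : AnalyticAt ℂ f x) (hg : AnalyticAt ℂ g x) :
    AnalyticAt ℂ (fun y => weightA (f y) (g y) τ) x :=
  ((analyticAt_const.mul (analyticAt_theta4_comp (im_two_mul_pos hτ)
    (analyticAt_const.mul hg))).mul (analyticAt_theta4_comp (im_two_mul_pos hτ) (hf.sub hg))).mul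
    (analyticAt_theta1_comp (im_two_mul_pos hτ) (hf.add hg))

lemma analyticAt_weightB (hτ : 0 < τ.im) (hf : AnalyticAt ℂ f x) (hg : AnalyticAt ℂ g x) :
    AnalyticAt ℂ (fun y => weightB (f y) (g y) τ) x :=
  ((analyticAt_const.mul (analyticAt_theta4_comp (im_two_mul_pos hτ)
    (analyticAt_const.mul hg))).mul (analyticAt_theta1_comp (im_two_mul_pos hτ) (hf.sub hg))).mul
    (analyticAt_theta4_comp (im_two_mul_pos hτ) (hf.add hg))

lemma analyticAt_weightC (hτ : 0 < τ.im) (hf : AnalyticAt ℂ f x) (hg : AnalyticAt ℂ g x) :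
    AnalyticAt ℂ (fun y => weightC (f y) (g y) τ) x :=
  ((analyticAt_const.mul (analyticAt_theta1_comp (im_two_mul_pos hτ)
    (analyticAt_const.mul hg))).mul (analyticAt_theta4_comp (im_two_mul_pos hτ) (hf.sub hg))).mul
    (analyticAt_theta4_comp (im_two_mul_pos hτ) (hf.add hg))

lemma analyticAt_weightD (hτ : 0 < τ.im) (hf : AnalyticAt ℂ f x) (hg : AnalyticAt ℂ g x) :
    AnalyticAt ℂ (fun y => weightD (f y) (g y) τ) x :=
  ((analyticAt_const.mul (analyticAt_theta1_comp (im_two_mul_pos hτ)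
    (analyticAt_const.mul hg))).mul (analyticAt_theta1_comp (im_two_mul_pos hτ) (hf.sub hg))).mul
    (analyticAt_theta1_comp (im_two_mul_pos hτ) (hf.add hg))

end

lemma weightB_self (η τ : ℂ) : weightB η η τ = 0 := by simp [weightB, theta1_zero]

lemma weightD_self (η τ : ℂ) : weightD η η τ = 0 := by simp [weightD, theta1_zero]

/-- Together with `b = d = 0` this makes the R-matrix at `u = η` equal to `a` times the permutation,
so the transfer matrix there is `a^L` times a cyclic shift. -/
lemma weightC_self (η τ : ℂ) : weightC η η τ = weightA η η τ := by
  simp only [weightC, weightA, ← two_mul]; ring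

lemma weightA_self_ne_zero {η τ : ℂ} (hτ : 0 < τ.im) (h4 : theta4 (2 * η) (2 * τ) ≠ 0)
    (h1 : theta1 (2 * η) (2 * τ) ≠ 0) : weightA η η τ ≠ 0 := by
  have := rho_ne_zero hτ
  have := theta4_zero_ne_zero (im_two_mul_pos hτ)
  simp only [weightA, ← two_mul, sub_self]
  positivity

lemma deriv_theta4_zero {τ : ℂ} (hτ : 0 < τ.im) : deriv (fun u => theta4 u τ) 0 = 0 := by
  have h := hasDerivAt_theta4 0 hτ
  have h2 : HasDerivAt (fun u => theta4 u τ) (-deriv (fun u => theta4 u τ) 0) 0 := by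
    have h' := hasDerivAt_theta4 (-0) hτ
    have := HasDerivAt.comp (h₂ := fun u => theta4 u τ) (0 : ℂ) h' (hasDerivAt_neg 0)
    simpa [Function.comp_def, theta4_neg] using this
  linear_combination (h.unique h2) / 2

lemma deriv_weightB_self (η : ℂ) {τ : ℂ} (hτ : 0 < τ.im) :
    deriv (fun u => weightB u η τ) η =
      rho τ * theta4 (2 * η) (2 * τ) ^ 2 * deriv (fun u => theta1 u (2 * τ)) 0 := by
  have h2 := im_two_mul_pos hτ
  have h1 : HasDerivAt (fun u => theta1 (u - η) (2 * τ)) (deriv (fun u => theta1 u (2 * τ)) 0) η :=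
    HasDerivAt.comp_sub_const η η (f := fun u => theta1 u (2 * τ))
      (by rw [sub_self]; exact hasDerivAt_theta1 0 h2)
  have h4 : HasDerivAt (fun u => theta4 (u + η) (2 * τ))
      (deriv (fun u => theta4 u (2 * τ)) (η + η)) η :=
    HasDerivAt.comp_add_const η η (hasDerivAt_theta4 (η + η) h2)
  have h := ((h1.const_mul (rho τ * theta4 (2 * η) (2 * τ))).mul h4).deriv
  rw [show (fun u => weightB u η τ) = ((fun u => rho τ * theta4 (2 * η) (2 * τ) *
    theta1 (u - η) (2 * τ)) * fun u => theta4 (u + η) (2 * τ)) from rfl, h, sub_self, theta1_zero,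
    ← two_mul]
  ring

lemma deriv_weightB_div_weightA {η τ : ℂ} (hτ : 0 < τ.im) (h4 : theta4 (2 * η) (2 * τ) ≠ 0)
    (h1 : theta1 (2 * η) (2 * τ) ≠ 0) :
    deriv (fun u => weightB u η τ) η / weightA η η τ =
      thetaQuotSlope τ / thetaQuot (2 * η) τ := by
  have := rho_ne_zero hτ
  have := theta4_zero_ne_zero (im_two_mul_pos hτ)
  rw [deriv_weightB_self η hτ, thetaQuotSlope, thetaQuot]
  simp only [weightA, ← two_mul, sub_self]
  field_simp

/-- Second-order information on the weights at `u = η`. -/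
lemma weightA_mul_deriv_deriv_weightB (η : ℂ) {τ : ℂ} (hτ : 0 < τ.im) :
    weightA η η τ * deriv (deriv fun u => weightB u η τ) η =
      2 * deriv (fun u => weightB u η τ) η * deriv (fun u => weightC u η τ) η := by
  have h2 := im_two_mul_pos hτ
  set t1 : ℂ → ℂ := fun u => theta1 u (2 * τ) with ht1
  set t4 : ℂ → ℂ := fun u => theta4 u (2 * τ) with ht4
  have d1 : Differentiable ℂ t1 := differentiable_theta1 h2
  have d4 : Differentiable ℂ t4 := differentiable_theta4 h2
  have d1' : Differentiable ℂ (deriv t1) := d1.deriv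
  have d4' : Differentiable ℂ (deriv t4) := d4.deriv
  have s1 : ∀ {f : ℂ → ℂ}, Differentiable ℂ f → ∀ u, HasDerivAt (fun u => f (u - η))
      (deriv f (u - η)) u := fun hf u => HasDerivAt.comp_sub_const u η (hf (u - η)).hasDerivAt
  have s2 : ∀ {f : ℂ → ℂ}, Differentiable ℂ f → ∀ u, HasDerivAt (fun u => f (u + η))
      (deriv f (u + η)) u := fun hf u => HasDerivAt.comp_add_const u η (hf (u + η)).hasDerivAt
  have hB : (deriv fun u => weightB u η τ) = fun u => rho τ * t4 (2 * η) *
      (deriv t1 (u - η) * t4 (u + η) + t1 (u - η) * deriv t4 (u + η)) := by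
    funext u
    have h := (((s1 d1 u).mul (s2 d4 u)).const_mul (rho τ * t4 (2 * η))).deriv
    rw [← h]
    congr 1
    funext v
    simp only [weightB, ht1, ht4, Pi.mul_apply]; ring
  have hBB : deriv (deriv fun u => weightB u η τ) η = rho τ * t4 (2 * η) *
      (deriv (deriv t1) 0 * t4 (2 * η) + 2 * deriv t1 0 * deriv t4 (2 * η)) := by
    rw [hB]
    have h := ((((s1 d1' η).mul (s2 d4 η)).add ((s1 d1 η).mul (s2 d4' η))).const_mul
      (rho τ * t4 (2 * η))).deriv
    simp only [sub_self, ← two_mul] at h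
    refine h.trans ?_
    have : t1 0 = 0 := theta1_zero _
    rw [this]; ring
  have hC : deriv (fun u => weightC u η τ) η = rho τ * t1 (2 * η) * (t4 0 * deriv t4 (2 * η)) := by
    have h := (((s1 d4 η).mul (s2 d4 η)).const_mul (rho τ * t1 (2 * η))).deriv
    simp only [sub_self, ← two_mul] at h
    have h0 : deriv t4 0 = 0 := deriv_theta4_zero h2
    rw [h0, zero_mul, zero_add] at h
    rw [← h]
    congr 1
    funext v
    simp only [weightC, ht1, ht4, Pi.mul_apply]; ring
  -- `θ₁` is odd, so its derivative is even and the second derivative vanishes at the origin.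
  have h10 : deriv (deriv t1) 0 = 0 := by
    have hodd : ∀ u, deriv t1 (-u) = deriv t1 u := by
      intro u
      have h := (HasDerivAt.comp (h₂ := t1) u ((d1 (-u)).hasDerivAt) (hasDerivAt_neg u)).deriv
      have e : t1 ∘ (fun u => -u) = fun u => -t1 u := by
        funext v; simp [ht1, theta1_neg]
      have e2 : deriv (t1 ∘ (fun u => -u)) u = -deriv t1 u := by
        rw [e]; exact ((d1 u).hasDerivAt.neg).deriv
      have h' : deriv (t1 ∘ (fun u => -u)) u = deriv t1 (-u) * -1 := h
      rw [e2] at h'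
      linear_combination h'
    have h0 : HasDerivAt (deriv t1) (deriv (deriv t1) 0) (-0) := by
      rw [neg_zero]; exact (d1' 0).hasDerivAt
    have h1 := (HasDerivAt.comp (0 : ℂ) h0 (hasDerivAt_neg (0 : ℂ))).deriv
    have e : deriv t1 ∘ (fun u => -u) = deriv t1 := funext hodd
    have h' : deriv (deriv t1 ∘ (fun u => -u)) 0 = deriv (deriv t1) 0 * -1 := h1
    rw [e] at h'
    linear_combination h' / 2
  rw [hBB, hC, h10, deriv_weightB_self η hτ]
  simp only [weightA, ht1, ht4, sub_self, ← two_mul]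
  ring

end Theta

section Words

/-! ### Functions on binary words -/

/-- The sum of a function over all binary words of length `m`. -/
def wsum : ℕ → (List (Fin 2) → ℝ) → ℝ
  | 0, F => F []
  | m + 1, F => ∑ a, wsum m fun w => F (a :: w)

lemma wsum_congr {m : ℕ} {F G : List (Fin 2) → ℝ} (h : ∀ w, w.length = m → F w = G w) :
    wsum m F = wsum m G := by
  induction m generalizing F G with
  | zero => exact h [] rfl
  | succ m ih => exact Finset.sum_congr rfl fun a _ => ih fun w hw => h _ (by simp [hw])

lemma wsum_add (m : ℕ) (F G : List (Fin 2) → ℝ) :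
    wsum m (fun w => F w + G w) = wsum m F + wsum m G := by
  induction m generalizing F G with
  | zero => rfl
  | succ m ih => simp only [wsum, ih, Finset.sum_add_distrib]

lemma wsum_mul_left (m : ℕ) (r : ℝ) (F : List (Fin 2) → ℝ) :
    wsum m (fun w => r * F w) = r * wsum m F := by
  induction m generalizing F with
  | zero => rfl
  | succ m ih => simp only [wsum, ih, Finset.mul_sum]

lemma wsum_zero (m : ℕ) : wsum m (fun _ => 0) = 0 := by
  simpa using wsum_mul_left m 0 fun _ => 0

lemma wsum_finset_sum {ι : Type*} (m : ℕ) (s : Finset ι) (F : ι → List (Fin 2) → ℝ) :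
    wsum m (fun w => ∑ i ∈ s, F i w) = ∑ i ∈ s, wsum m (F i) := by
  classical
  induction s using Finset.induction_on with
  | empty => simp [wsum_zero]
  | insert a s ha ih => simp only [Finset.sum_insert ha, wsum_add, ih]

lemma wsum_snoc (m : ℕ) (F : List (Fin 2) → ℝ) :
    wsum (m + 1) F = ∑ a, wsum m fun w => F (w ++ [a]) := by
  induction m generalizing F with
  | zero => rfl
  | succ m ih =>
    change ∑ a, wsum (m + 1) (fun w => F (a :: w)) =
      ∑ a, ∑ b, wsum m fun w => F ((b :: w) ++ [a])
    rw [Finset.sum_congr rfl fun a _ => ih fun w => F (a :: w), Finset.sum_comm]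
    rfl

lemma wsum_rotate_one (m : ℕ) (F : List (Fin 2) → ℝ) :
    wsum m (fun w => F (w.rotate 1)) = wsum m F := by
  cases m with
  | zero => rfl
  | succ m => rw [wsum_snoc m F, wsum]; simp

lemma wsum_rotate (m k : ℕ) (F : List (Fin 2) → ℝ) :
    wsum m (fun w => F (w.rotate k)) = wsum m F := by
  induction k with
  | zero => simp
  | succ k ih =>
    rw [← ih, ← wsum_rotate_one m fun w => F (w.rotate k)]
    simp only [List.rotate_rotate, add_comm]

lemma wsum_nonneg {m : ℕ} {F : List (Fin 2) → ℝ} (h : ∀ w, 0 ≤ F w) : 0 ≤ wsum m F := by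
  induction m generalizing F with
  | zero => exact h _
  | succ m ih => exact Finset.sum_nonneg fun a _ => ih fun w => h _

lemma eq_zero_of_wsum_sq {m : ℕ} {F : List (Fin 2) → ℝ} (h : wsum m (fun w => F w * F w) = 0)
    {w : List (Fin 2)} (hw : w.length = m) : F w = 0 := by
  induction m generalizing F w with
  | zero =>
    rw [List.length_eq_zero_iff] at hw
    subst hw
    exact mul_self_eq_zero.mp h
  | succ m ih =>
    obtain ⟨a, w, rfl⟩ := List.exists_cons_of_length_eq_add_one hw
    rw [wsum, Finset.sum_eq_zero_iff_of_nonneg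
      fun a _ => wsum_nonneg fun w => mul_self_nonneg _] at h
    exact ih (F := fun w => F (a :: w)) (h a (Finset.mem_univ a)) (by simpa using hw)

lemma wsum_eq_sum_ofFn (m : ℕ) (F : List (Fin 2) → ℝ) :
    wsum m F = ∑ s : Fin m → Fin 2, F (List.ofFn s) := by
  induction m generalizing F with
  | zero => simp [wsum]
  | succ m ih =>
    rw [wsum, ← (Fin.consEquiv fun _ => Fin 2).sum_comp, Fintype.sum_prod_type]
    refine Finset.sum_congr rfl fun a _ => ?_
    rw [ih]
    exact Finset.sum_congr rfl fun s _ => by simp [Fin.consEquiv]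

/-! ### Splitting and merging letters, and sums over rotations -/

/-- Invariance under rotations of words of length `m`. -/
def CycInv (m : ℕ) (f : List (Fin 2) → ℝ) : Prop := ∀ w, w.length = m → f (w.rotate 1) = f w

/-- Sign change under rotations of words of length `m`. -/
def CycAnti (m : ℕ) (f : List (Fin 2) → ℝ) : Prop := ∀ w, w.length = m → f (w.rotate 1) = -f w

/-- The comultiplication with structure constants `κ`, applied to the first letter. -/
def split (κ : Fin 2 → Fin 2 → Fin 2 → ℝ) (f : List (Fin 2) → ℝ) : List (Fin 2) → ℝ
  | a :: b :: w => ∑ c, κ c a b * f (c :: w)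
  | _ => 0

/-- The transpose of `split`. -/
def merge (κ : Fin 2 → Fin 2 → Fin 2 → ℝ) (g : List (Fin 2) → ℝ) : List (Fin 2) → ℝ
  | c :: w => ∑ a, ∑ b, κ c a b * g (a :: b :: w)
  | _ => 0

/-- The sum over the rotations of a word of length `m`. -/
def avg (m : ℕ) (f : List (Fin 2) → ℝ) (w : List (Fin 2)) : ℝ :=
  ∑ k ∈ Finset.range m, f (w.rotate k)

/-- The alternating sum over the rotations of a word of length `m`. -/
def alt (m : ℕ) (f : List (Fin 2) → ℝ) (w : List (Fin 2)) : ℝ :=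
  ∑ k ∈ Finset.range m, (-1) ^ k * f (w.rotate k)

variable {m : ℕ} {f g : List (Fin 2) → ℝ} {κ : Fin 2 → Fin 2 → Fin 2 → ℝ}

lemma CycInv.rotate (hf : CycInv m f) (k : ℕ) {w : List (Fin 2)} (hw : w.length = m) :
    f (w.rotate k) = f w := by
  induction k with
  | zero => simp
  | succ k ih => rw [← List.rotate_rotate, hf _ (by simpa using hw), ih]

lemma CycAnti.rotate (hf : CycAnti m f) (k : ℕ) {w : List (Fin 2)} (hw : w.length = m) :
    f (w.rotate k) = (-1) ^ k * f w := by
  induction k with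
  | zero => simp
  | succ k ih => rw [← List.rotate_rotate, hf _ (by simpa using hw), ih]; ring

lemma CycInv.append_comm (hf : CycInv m f) {u v : List (Fin 2)} (h : (u ++ v).length = m) :
    f (v ++ u) = f (u ++ v) := by
  rw [← List.rotate_append_length_eq u v, hf.rotate _ h]

lemma CycAnti.append_comm (hf : CycAnti m f) {u v : List (Fin 2)} (h : (u ++ v).length = m) :
    f (v ++ u) = (-1) ^ u.length * f (u ++ v) := by
  rw [← List.rotate_append_length_eq u v, hf.rotate _ h]

lemma sum_range_shift {G : ℕ → ℝ} (h : G m = G 0) :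
    ∑ k ∈ Finset.range m, G (k + 1) = ∑ k ∈ Finset.range m, G k := by
  have h1 := Finset.sum_range_succ G m
  rw [Finset.sum_range_succ'] at h1
  linarith

lemma rotate_self {w : List (Fin 2)} (hw : w.length = m) : w.rotate m = w := by
  rw [← hw, List.rotate_length]

/-- Rotation shifts the summation index, and the term that wraps around returns with the sign
`(-1)^m`. Even length is what makes this consistent. -/
lemma cycAnti_alt (hm : Even m) (f : List (Fin 2) → ℝ) : CycAnti m (alt m f) := by
  intro w hw
  have h := sum_range_shift (m := m) (G := fun k => (-1) ^ k * f (w.rotate k))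
    (by simp [hm.neg_one_pow, rotate_self hw])
  rw [alt, alt, ← h, ← Finset.sum_neg_distrib]
  refine Finset.sum_congr rfl fun k _ => ?_
  rw [List.rotate_rotate, add_comm 1 k]; ring

lemma cycInv_avg (f : List (Fin 2) → ℝ) : CycInv m (avg m f) := by
  intro w hw
  have h := sum_range_shift (m := m) (G := fun k => f (w.rotate k)) (by simp [rotate_self hw])
  rw [avg, avg, ← h]
  refine Finset.sum_congr rfl fun k _ => ?_
  rw [List.rotate_rotate, add_comm 1 k]

/-- The signs cancel in pairs in even length. This is why product vectors are annihilated by the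
supercharge or its adjoint. -/
lemma alt_eq_zero (hm : Even m) (hf : CycInv m f) {w : List (Fin 2)} (hw : w.length = m) :
    alt m f w = 0 := by
  have : alt m f w = ∑ k ∈ Finset.range m, (-1) ^ k * f w :=
    Finset.sum_congr rfl fun k _ => by rw [hf.rotate k hw]
  rw [this, ← Finset.sum_mul, neg_one_geom_sum, if_pos hm, zero_mul]

lemma alt_congr (h : ∀ w, w.length = m → f w = g w) {w : List (Fin 2)} (hw : w.length = m) :
    alt m f w = alt m g w :=
  Finset.sum_congr rfl fun k _ => by rw [h _ (by simpa using hw)]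

lemma avg_congr (h : ∀ w, w.length = m → f w = g w) {w : List (Fin 2)} (hw : w.length = m) :
    avg m f w = avg m g w :=
  Finset.sum_congr rfl fun k _ => by rw [h _ (by simpa using hw)]

/-- Adding `h + h ∘ rotate` does not change the alternating sum. -/
lemma alt_add_rotate (hm : Even m) (f h : List (Fin 2) → ℝ) (r : ℝ) {w : List (Fin 2)}
    (hw : w.length = m) :
    alt m (fun w => f w + r * (h w + h (w.rotate 1))) w = alt m f w := by
  have h1 := cycAnti_alt hm h w hw
  have h2 : alt m (fun w => f w + r * (h w + h (w.rotate 1))) w =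
      alt m f w + r * (alt m h w + alt m h (w.rotate 1)) := by
    simp only [alt, mul_add, Finset.mul_sum, ← Finset.sum_add_distrib, List.rotate_rotate]
    refine Finset.sum_congr rfl fun k _ => ?_
    rw [add_comm k 1]; ring
  rw [h2, h1]; ring

/-- Adding `h - h ∘ rotate` does not change the sum over rotations. -/
lemma avg_sub_rotate (f h : List (Fin 2) → ℝ) (r : ℝ) {w : List (Fin 2)} (hw : w.length = m) :
    avg m (fun w => f w + r * (h w - h (w.rotate 1))) w = avg m f w := by
  have h1 := cycInv_avg h w hw
  have h2 : avg m (fun w => f w + r * (h w - h (w.rotate 1))) w =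
      avg m f w + r * (avg m h w - avg m h (w.rotate 1)) := by
    simp only [avg, mul_sub, Finset.mul_sum, ← Finset.sum_add_distrib, List.rotate_rotate,
      ← Finset.sum_sub_distrib]
    refine Finset.sum_congr rfl fun k _ => ?_
    rw [add_comm k 1]
  rw [h2, h1]; ring

/-- The alternating sum is `m` times the orthogonal projection onto sign-changing functions, so
against such a function it reduces to the factor `m`. -/
lemma wsum_alt_mul (hg : CycAnti m g) (f : List (Fin 2) → ℝ) :
    wsum m (fun w => alt m f w * g w) = m * wsum m (fun w => f w * g w) := by
  simp only [alt, Finset.sum_mul]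
  rw [wsum_finset_sum, Finset.sum_congr rfl (g := fun _ => wsum m fun w => f w * g w)]
  · simp
  · intro k _
    rw [← wsum_rotate m k fun w => f w * g w]
    refine wsum_congr fun w hw => ?_
    rw [hg.rotate k hw]; ring

lemma wsum_avg_mul (hg : CycInv m g) (f : List (Fin 2) → ℝ) :
    wsum m (fun w => avg m f w * g w) = m * wsum m (fun w => f w * g w) := by
  simp only [avg, Finset.sum_mul]
  rw [wsum_finset_sum, Finset.sum_congr rfl (g := fun _ => wsum m fun w => f w * g w)]
  · simp
  · intro k _
    rw [← wsum_rotate m k fun w => f w * g w]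
    exact wsum_congr fun w hw => by rw [hg.rotate k hw]

lemma wsum_split_mul (κ : Fin 2 → Fin 2 → Fin 2 → ℝ) (f g : List (Fin 2) → ℝ) (m : ℕ) :
    wsum (m + 2) (fun w => split κ f w * g w) = wsum (m + 1) (fun w => f w * merge κ g w) := by
  simp only [wsum, split, merge, Fin.sum_univ_two, ← wsum_add]
  refine wsum_congr fun w _ => ?_
  ring

lemma wsum_mul_comm (m : ℕ) (f g : List (Fin 2) → ℝ) :
    wsum m (fun w => f w * g w) = wsum m (fun w => g w * f w) := by
  simp only [mul_comm]

end Words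

section Supercharge

/-! ### The supercharge -/

/-- Structure constants of the local supercharge `|1⟩ ↦ |00⟩ - z |11⟩`. -/
def kap (z : ℝ) (c a b : Fin 2) : ℝ :=
  if c = 0 then 0 else if a = b then (if a = 0 then 1 else -z) else 0

/-- The gauge-equivalent coassociative structure constants. -/
def kap' (z : ℝ) (c a b : Fin 2) : ℝ :=
  kap z c a b + z * ((if a = 1 ∧ b = c then 1 else 0) + if a = c ∧ b = 1 then 1 else 0)

/-- The original constants are not coassociative for `z ≠ 0`. The added terms insert a letter `1`
before or after the given one; they repair coassociativity and disappear in the sums over rotations.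
-/
lemma kap'_coassoc (z : ℝ) (c x y b : Fin 2) :
    ∑ a, kap' z c a b * kap' z a x y = ∑ a, kap' z c x a * kap' z a y b := by
  fin_cases c <;> fin_cases x <;> fin_cases y <;> fin_cases b <;>
    simp [kap', kap, -mul_eq_mul_left_iff, -mul_eq_mul_right_iff] <;> ring

/-- Insertion of the letter `1` at the front. -/
def ins (f : List (Fin 2) → ℝ) : List (Fin 2) → ℝ
  | a :: w => if a = 1 then f w else 0
  | _ => 0

variable {M : ℕ} {f g χ : List (Fin 2) → ℝ} {z : ℝ}

lemma exists_cons_cons {w : List (Fin 2)} (hw : w.length = M + 2) :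
    ∃ a b v, w = a :: b :: v ∧ v.length = M := by
  obtain ⟨a, w, rfl⟩ := List.exists_cons_of_length_eq_add_one hw
  obtain ⟨b, w, rfl⟩ := List.exists_cons_of_length_eq_add_one (n := M) (by simpa using hw)
  exact ⟨a, b, w, rfl, by simpa using hw⟩

/-- On a rotation-invariant function the two inserted-letter terms are rotations of each other,
hence cancel in an alternating sum over rotations. -/
lemma split_kap' (hf : CycInv (M + 1) f) {w : List (Fin 2)} (hw : w.length = M + 2) :
    split (kap' z) f w = split (kap z) f w + z * (ins f w + ins f (w.rotate 1)) := by
  obtain ⟨a, b, v, rfl, hv⟩ := exists_cons_cons hw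
  have h1 : f (v ++ [a]) = f (a :: v) := by
    simpa using hf (a :: v) (by simp [hv])
  have : (a :: b :: v).rotate 1 = b :: (v ++ [a]) := by simp
  rw [this]
  simp only [split, ins, kap', add_mul, mul_add, Finset.sum_add_distrib, h1, Fin.sum_univ_two]
  fin_cases a <;> fin_cases b <;> simp

lemma alt_split_kap' (hM : Even M) (hf : CycInv (M + 1) f) {w : List (Fin 2)}
    (hw : w.length = M + 2) : alt (M + 2) (split (kap' z) f) w = alt (M + 2) (split (kap z) f) w := by
  rw [← alt_add_rotate (by simpa [parity_simps] using hM) (split (kap z) f) (ins f) z hw]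
  exact alt_congr (fun w hw => split_kap' hf hw) hw

lemma merge_kap' (f : List (Fin 2) → ℝ) (c : Fin 2) (v : List (Fin 2)) :
    merge (kap' z) f (c :: v) = merge (kap z) f (c :: v) + z * (f (1 :: c :: v) + f (c :: 1 :: v)) := by
  simp only [merge, kap', Fin.sum_univ_two]
  fin_cases c <;> simp <;> ring

lemma alt_merge_kap' (hM : Even M) (hM0 : M ≠ 0) (hf : CycInv (M + 1) f) {w : List (Fin 2)}
    (hw : w.length = M) : alt M (merge (kap' z) f) w = alt M (merge (kap z) f) w := by
  rw [← alt_add_rotate hM (merge (kap z) f) (fun w => f (1 :: w)) z hw]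
  refine alt_congr (fun w hw => ?_) hw
  obtain ⟨k, rfl⟩ := Nat.exists_eq_succ_of_ne_zero hM0
  obtain ⟨c, v, rfl⟩ := List.exists_cons_of_length_eq_add_one hw
  have h1 : f ((c :: 1 :: v).rotate 1) = f (c :: 1 :: v) := hf _ (by simpa using hw)
  rw [merge_kap']
  simp only [List.rotate_cons_succ, List.rotate_zero, List.cons_append] at h1 ⊢
  rw [h1]

lemma avg_merge_kap' (hχ : CycAnti (M + 2) χ) {w : List (Fin 2)}
    (hw : w.length = M + 1) :
    avg (M + 1) (merge (kap' z) χ) w = avg (M + 1) (merge (kap z) χ) w := by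
  rw [← avg_sub_rotate (merge (kap z) χ) (fun w => χ (1 :: w)) z hw]
  refine avg_congr (fun w hw => ?_) hw
  obtain ⟨c, v, rfl⟩ := List.exists_cons_of_length_eq_add_one hw
  have h1 : χ ((c :: 1 :: v).rotate 1) = -χ (c :: 1 :: v) := hχ _ (by simpa using hw)
  rw [merge_kap']
  simp only [List.rotate_cons_succ, List.rotate_zero, List.cons_append] at h1 ⊢
  rw [h1]; ring

/-! ### Nilpotency -/

/-- Two successive mergings at positions differing by the rotation `k`. -/
def mergeTwice (κ : Fin 2 → Fin 2 → Fin 2 → ℝ) (χ : List (Fin 2) → ℝ) (k : ℕ)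
    (w : List (Fin 2)) : ℝ :=
  merge κ (fun v => merge κ χ (v.rotate k)) w

lemma rotate_cons_cons (a b : Fin 2) (u v : List (Fin 2)) :
    (a :: b :: (u ++ v)).rotate (u.length + 2) = v ++ a :: b :: u := by
  exact List.rotate_append_length_eq (a :: b :: u) v

lemma rotate_cons_append (a : Fin 2) (u v : List (Fin 2)) :
    (a :: (u ++ v)).rotate (u.length + 1) = v ++ a :: u := by
  exact List.rotate_append_length_eq (a :: u) v

/-- The two mergings overlap in one letter: three consecutive letters are merged in either order.
Coassociativity identifies the results, and one rotation of `χ` supplies the relative sign. -/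
lemma mergeTwice_zero_add_one (hM : Even M) (hM0 : M ≠ 0) (hχ : CycAnti (M + 2) χ)
    {w : List (Fin 2)} (hw : w.length = M) :
    mergeTwice (kap' z) χ 0 w + mergeTwice (kap' z) χ 1 w = 0 := by
  obtain ⟨k, rfl⟩ := Nat.exists_eq_succ_of_ne_zero hM0
  obtain ⟨c, v, rfl⟩ := List.exists_cons_of_length_eq_add_one hw
  have hv : v.length = k := by simpa using hw
  have h1 : ∀ a x y, χ (x :: y :: (v ++ [a])) = -χ (a :: x :: y :: v) := by
    intro a x y
    simpa using hχ (a :: x :: y :: v) (by simp [hv])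
  have key : ∀ x y b, ∑ a, kap' z c a b * (kap' z a x y * χ (x :: y :: b :: v)) =
      ∑ a, kap' z c x a * (kap' z a y b * χ (x :: y :: b :: v)) := by
    intro x y b
    simp_rw [← mul_assoc]
    rw [← Finset.sum_mul, ← Finset.sum_mul, kap'_coassoc]
  have e0 : mergeTwice (kap' z) χ 0 (c :: v) =
      ∑ x, ∑ y, ∑ b, ∑ a, kap' z c a b * (kap' z a x y * χ (x :: y :: b :: v)) := by
    simp only [mergeTwice, merge, List.rotate_zero, Fin.sum_univ_two]
    ring
  have e1 : mergeTwice (kap' z) χ 1 (c :: v) =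
      -∑ x, ∑ y, ∑ b, ∑ a, kap' z c x a * (kap' z a y b * χ (x :: y :: b :: v)) := by
    simp only [mergeTwice, merge, List.rotate_cons_succ, List.rotate_zero, List.cons_append, h1,
      Fin.sum_univ_two]
    ring
  rw [e0, e1]
  simp only [key]
  ring

/-- Mergings at disjoint places commute. Starting from the other marked letter is a rotation of the
word, and the sign comes from rotating `χ` by a whole block. -/
lemma mergeTwice_rotate (hχ : CycAnti (M + 2) χ) {κ : Fin 2 → Fin 2 → Fin 2 → ℝ}
    {w : List (Fin 2)} (hw : w.length = M) {j l : ℕ} (hjl : j + l + 2 = M) :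
    mergeTwice κ χ (l + 2) (w.rotate (j + 1)) = (-1) ^ l * mergeTwice κ χ (j + 2) w := by
  obtain ⟨c, w', rfl⟩ := List.exists_cons_of_length_eq_add_one (l := w) (n := j + l + 1)
    (by omega)
  have hw' : w'.length = j + l + 1 := by simp at hw; omega
  obtain ⟨u, w'', rfl, hu⟩ : ∃ u w'', w' = u ++ w'' ∧ u.length = j :=
    ⟨w'.take j, w'.drop j, by simp, by simp; omega⟩
  obtain ⟨x, v, rfl⟩ := List.exists_cons_of_length_eq_add_one (l := w'') (n := l) (by
    simp at hw'; omega)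
  have hv : v.length = l := by simp at hw'; omega
  subst hu hv
  rw [rotate_cons_append]
  have hr : ∀ a b : Fin 2, (a :: b :: (v ++ c :: u)).rotate (v.length + 2) =
    c :: (u ++ a :: b :: v) := fun a b => by rw [rotate_cons_cons]; rfl
  have hl : ∀ a b : Fin 2, (a :: b :: (u ++ x :: v)).rotate (u.length + 2) =
    x :: (v ++ a :: b :: u) := fun a b => by rw [rotate_cons_cons]; rfl
  have hc : ∀ a b a' b' : Fin 2, χ (a :: b :: (u ++ a' :: b' :: v)) =
      (-1) ^ v.length * χ (a' :: b' :: (v ++ a :: b :: u)) := by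
    intro a b a' b'
    have := hχ.append_comm (u := a' :: b' :: v) (v := a :: b :: u) (by simp; omega)
    simpa [pow_add] using this
  simp only [mergeTwice, List.cons_append]
  simp only [merge, hr, hl, hc, Fin.sum_univ_two]
  ring

lemma alt_mergeTwice_add (hM : Even M) (hχ : CycAnti (M + 2) χ) {κ : Fin 2 → Fin 2 → Fin 2 → ℝ}
    {w : List (Fin 2)} (hw : w.length = M) {j l : ℕ} (hjl : j + l + 2 = M) :
    alt M (mergeTwice κ χ (l + 2)) w = -alt M (mergeTwice κ χ (j + 2)) w := by
  have h1 : ∀ r, alt M (mergeTwice κ χ (l + 2)) (w.rotate r) =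
      (-1) ^ r * alt M (mergeTwice κ χ (l + 2)) w := fun r => (cycAnti_alt hM _).rotate r hw
  have h2 : alt M (mergeTwice κ χ (l + 2)) (w.rotate (j + 1)) =
      (-1) ^ l * alt M (mergeTwice κ χ (j + 2)) w := by
    simp only [alt, Finset.mul_sum]
    refine Finset.sum_congr rfl fun k _ => ?_
    rw [List.rotate_rotate, add_comm (j + 1) k, ← List.rotate_rotate,
      mergeTwice_rotate hχ (by simpa using hw) hjl]
    ring
  rw [h1] at h2
  have h3 : (-1 : ℝ) ^ l = (-1) ^ j := by
    rcases Nat.even_or_odd j with hj | hj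
    · have : Even l := by rw [← hjl] at hM; simpa [parity_simps, hj] using hM
      rw [hj.neg_one_pow, this.neg_one_pow]
    · have : Odd l := by
        rw [← hjl] at hM
        have := Nat.not_even_iff_odd.mpr hj
        rw [← Nat.not_even_iff_odd]
        simpa [parity_simps, this] using hM
      rw [hj.neg_one_pow, this.neg_one_pow]
  rw [h3, pow_succ] at h2
  have h4 : (-1 : ℝ) ^ j ≠ 0 := by positivity
  apply mul_left_cancel₀ h4
  linarith

/-- The square of the supercharge vanishes. -/
lemma alt_merge_avg_merge (hM : Even M) (hM0 : M ≠ 0) (hχ : CycAnti (M + 2) χ)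
    {w : List (Fin 2)} (hw : w.length = M) :
    alt M (merge (kap' z) (avg (M + 1) (merge (kap' z) χ))) w = 0 := by
  have e : ∀ v, merge (kap' z) (avg (M + 1) (merge (kap' z) χ)) v =
      ∑ k ∈ Finset.range (M + 1), mergeTwice (kap' z) χ k v := by
    intro v
    cases v with
    | nil => simp [mergeTwice, merge]
    | cons c v =>
      simp only [mergeTwice, merge, avg, Finset.mul_sum, Fin.sum_univ_two,
        ← Finset.sum_add_distrib]
  have e2 : alt M (merge (kap' z) (avg (M + 1) (merge (kap' z) χ))) w =
      ∑ k ∈ Finset.range (M + 1), alt M (mergeTwice (kap' z) χ k) w := by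
    simp only [alt, e, Finset.mul_sum]
    rw [Finset.sum_comm]
  obtain ⟨N, rfl⟩ : ∃ N, M = N + 1 := Nat.exists_eq_succ_of_ne_zero hM0
  rw [e2, Finset.sum_range_succ', Finset.sum_range_succ', add_assoc, zero_add]
  have h01 : alt (N + 1) (mergeTwice (kap' z) χ 1) w + alt (N + 1) (mergeTwice (kap' z) χ 0) w = 0 := by
    simp only [alt, ← Finset.sum_add_distrib, ← mul_add]
    refine Finset.sum_eq_zero fun k _ => ?_
    rw [add_comm, mergeTwice_zero_add_one hM hM0 hχ (by simpa using hw), mul_zero]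
  rw [h01, add_zero]
  -- Offsets 0 and 1 have cancelled. For the remaining `N` offsets, exchanging the order of two
  -- disjoint mergings is the reflection `k ↦ N - 1 - k` and changes the sign, so the sum equals its
  -- negative.
  set G : ℕ → ℝ := fun k => alt (N + 1) (mergeTwice (kap' z) χ (k + 1 + 1)) w with hG
  have hflip := Finset.sum_range_reflect G N
  have : ∀ k ∈ Finset.range N, G (N - 1 - k) = -G k := by
    intro k hk
    rw [Finset.mem_range] at hk
    exact alt_mergeTwice_add hM hχ hw (by omega)
  rw [Finset.sum_congr rfl this, Finset.sum_neg_distrib] at hflip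
  linarith

end Supercharge

/-! ### The shifted Hamiltonian as an anticommutator of supercharges. -/

section EnergyDensity

variable {M : ℕ} {f g : List (Fin 2) → ℝ} {z : ℝ}

lemma wsum_sub (m : ℕ) (F G : List (Fin 2) → ℝ) :
    wsum m (fun w => F w - G w) = wsum m F - wsum m G := by
  have h := wsum_add m F fun w => -1 * G w
  rw [wsum_mul_left] at h
  simpa [sub_eq_add_neg] using h

/-- The local energy density of the supersymmetric chain, shifted by the ground-state energy,
acting on the first two letters. -/
def hloc (z : ℝ) (f : List (Fin 2) → ℝ) : List (Fin 2) → ℝ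
  | a :: b :: w => if a = b then f (a :: b :: w) - z * f ((a + 1) :: (b + 1) :: w)
      else (1 + z ^ 2) / 2 * f (a :: b :: w) - f (b :: a :: w)
  | _ => 0

/-- Matrix element of a splitting, a rotation and a merging. -/
def splitMerge (M : ℕ) (κ : Fin 2 → Fin 2 → Fin 2 → ℝ) (g f : List (Fin 2) → ℝ) (k : ℕ) : ℝ :=
  wsum (M + 1) fun w => g w * merge κ (fun v => split κ f (v.rotate k)) w

/-- Matrix element of a merging, a rotation and a splitting. -/
def mergeSplit (M : ℕ) (κ : Fin 2 → Fin 2 → Fin 2 → ℝ) (g f : List (Fin 2) → ℝ) (k : ℕ) : ℝ :=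
  wsum (M + 1) fun w => g w * split κ (fun v => merge κ f (v.rotate k)) w

/-- A splitting and a merging at disjoint places commute. The rotation offsets are measured between
different marked letters, whence the relation `i + l + 2 = M`. -/
lemma splitMerge_eq_mergeSplit (hg : CycInv (M + 1) g) (hf : CycInv (M + 1) f)
    {κ : Fin 2 → Fin 2 → Fin 2 → ℝ} {i l : ℕ} (hil : i + l + 2 = M) :
    splitMerge M κ g f (i + 2) = mergeSplit M κ g f (l + 1) := by
  rw [splitMerge, mergeSplit,
    ← wsum_rotate _ (i + 1) fun w => g w * split κ (fun v => merge κ f (v.rotate (l + 1))) w]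
  refine wsum_congr fun w hw => ?_
  rw [hg.rotate _ hw]
  congr 1
  obtain ⟨c, w', rfl⟩ := List.exists_cons_of_length_eq_add_one (l := w) (n := M) hw
  have hw' : w'.length = i + (l + 2) := by simp at hw; omega
  obtain ⟨u, w'', rfl, hu⟩ : ∃ u w'', w' = u ++ w'' ∧ u.length = i :=
    ⟨w'.take i, w'.drop i, by simp, by simp; omega⟩
  obtain ⟨x, y, v, rfl, hv⟩ := exists_cons_cons (w := w'') (M := l) (by simp at hw'; omega)
  subst hu hv
  rw [rotate_cons_append]
  have hl : ∀ a b : Fin 2, (a :: b :: (u ++ x :: y :: v)).rotate (u.length + 2) =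
    x :: y :: (v ++ a :: b :: u) := fun a b => by rw [rotate_cons_cons]; rfl
  have hr : ∀ a : Fin 2, (a :: (v ++ c :: u)).rotate (v.length + 1) = c :: (u ++ a :: v) :=
    fun a => by rw [rotate_cons_append]; rfl
  have hc : ∀ a b a' : Fin 2, f (a' :: (v ++ a :: b :: u)) = f (a :: b :: (u ++ a' :: v)) := by
    intro a b a'
    exact hf.append_comm (u := a :: b :: u) (v := a' :: v) (by simp; omega)
  simp only [List.cons_append, merge, hl, split, hr, hc, Fin.sum_univ_two]
  ring

/-- Both terms are expanded in the rotation offset. Offsets `2, …, M` of split-then-merge cancel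
against offsets `M - 1, …, 1` of merge-then-split, since `M` is even; only the overlapping, hence
local, offsets survive. -/
lemma sum_splitMerge (hM : Even M) (hM0 : M ≠ 0) (hg : CycInv (M + 1) g) (hf : CycInv (M + 1) f)
    (κ : Fin 2 → Fin 2 → Fin 2 → ℝ) :
    wsum (M + 1) (fun w => g w * merge κ (alt (M + 2) (split κ f)) w) +
      wsum (M + 1) (fun w => g w * split κ (alt M (merge κ f)) w) =
      splitMerge M κ g f 0 - splitMerge M κ g f 1 - splitMerge M κ g f (M + 1) +
        mergeSplit M κ g f 0 := by
  have e1 : wsum (M + 1) (fun w => g w * merge κ (alt (M + 2) (split κ f)) w) =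
      ∑ k ∈ Finset.range (M + 2), (-1) ^ k * splitMerge M κ g f k := by
    simp only [splitMerge, ← wsum_mul_left, ← wsum_finset_sum]
    refine wsum_congr fun w _ => ?_
    cases w with
    | nil => simp [merge]
    | cons c w =>
      simp only [merge, alt, Fin.sum_univ_two, Finset.mul_sum, ← Finset.sum_add_distrib]
      exact Finset.sum_congr rfl fun k _ => by ring
  have e2 : wsum (M + 1) (fun w => g w * split κ (alt M (merge κ f)) w) =
      ∑ k ∈ Finset.range M, (-1) ^ k * mergeSplit M κ g f k := by
    simp only [mergeSplit, ← wsum_mul_left, ← wsum_finset_sum]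
    refine wsum_congr fun w _ => ?_
    match w with
    | [] => simp [split]
    | [_] => simp [split]
    | a :: b :: w =>
      simp only [split, alt, Fin.sum_univ_two, Finset.mul_sum, ← Finset.sum_add_distrib]
      exact Finset.sum_congr rfl fun k _ => by ring
  obtain ⟨N, rfl⟩ : ∃ N, M = N + 1 := Nat.exists_eq_succ_of_ne_zero hM0
  have hN : Odd N := by
    rw [← Nat.not_even_iff_odd]
    simpa [parity_simps] using hM
  rw [e1, e2, Finset.sum_range_succ, Finset.sum_range_succ', Finset.sum_range_succ',
    Finset.sum_range_succ' _ N, ← Finset.sum_range_reflect _ N]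
  have : ∀ k ∈ Finset.range N, (-1 : ℝ) ^ (N - 1 - k + 1 + 1) *
      splitMerge (N + 1) κ g f (N - 1 - k + 1 + 1) =
      -((-1) ^ (k + 1) * mergeSplit (N + 1) κ g f (k + 1)) := by
    intro k hk
    rw [Finset.mem_range] at hk
    rw [splitMerge_eq_mergeSplit hg hf (l := k) (by omega)]
    have : (-1 : ℝ) ^ (N - 1 - k + 1 + 1) * (-1) ^ (k + 1) = -1 := by
      rw [← pow_add, show N - 1 - k + 1 + 1 + (k + 1) = N + 2 by omega]
      exact Odd.neg_one_pow (by simpa [parity_simps] using hN)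
    have h2 : (-1 : ℝ) ^ (k + 1) * (-1) ^ (k + 1) = 1 := by
      rw [← mul_pow]; norm_num
    have h3 : (-1 : ℝ) ^ (N - 1 - k + 1 + 1) = -(-1) ^ (k + 1) := by
      linear_combination (-1) ^ (k + 1) * this - (-1) ^ (N - 1 - k + 1 + 1) * h2
    rw [h3]; ring
  rw [Finset.sum_congr rfl this, Finset.sum_neg_distrib,
    show N + 1 + 1 = N + 2 from rfl, (show Odd (N + 2) by simpa [parity_simps] using hN).neg_one_pow]
  ring

/-- On words of length `M + 2`, offset `M + 1` is offset `-1`, which is offset 1 with the two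
vectors exchanged. -/
lemma splitMerge_last (κ : Fin 2 → Fin 2 → Fin 2 → ℝ) :
    splitMerge M κ g f (M + 1) = splitMerge M κ f g 1 := by
  rw [splitMerge, splitMerge, ← wsum_split_mul, wsum_mul_comm (M + 1) f,
    wsum_mul_comm (M + 1) _ f, ← wsum_split_mul,
    ← wsum_rotate (M + 2) 1 fun w => split κ g w * split κ f (w.rotate (M + 1)),
    wsum_mul_comm]
  refine wsum_congr fun w hw => ?_
  rw [List.rotate_rotate, add_comm 1, rotate_self hw]

lemma wsum_hloc {N : ℕ} (hg : CycInv (N + 2) g) (hf : CycInv (N + 2) f) :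
    wsum (N + 2) (fun w => g w * hloc z f w) =
      splitMerge (N + 1) (kap z) g f 0 - splitMerge (N + 1) (kap z) g f 1 -
        splitMerge (N + 1) (kap z) f g 1 + mergeSplit (N + 1) (kap z) g f 0 := by
  have hf1 : ∀ (a b : Fin 2) (w : List (Fin 2)), w.length = N →
      f (b :: (w ++ [a])) = f (a :: b :: w) := fun a b w hw => by
    simpa using hf (a :: b :: w) (by simp [hw])
  have hg1 : ∀ (a b : Fin 2) (w : List (Fin 2)), w.length = N →
      g (b :: (w ++ [a])) = g (a :: b :: w) := fun a b w hw => by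
    simpa using hg (a :: b :: w) (by simp [hw])
  -- By rotation invariance, words whose first letter is `1` carry the same weight as words whose
  -- second letter is `1`. Removing the common part `11` equates `10` with `01`, which symmetrizes
  -- the diagonal energy into `(1 + z²)/2`.
  have hhalf : wsum N (fun w => g (1 :: 0 :: w) * f (1 :: 0 :: w)) =
      wsum N (fun w => g (0 :: 1 :: w) * f (0 :: 1 :: w)) := by
    have h := wsum_rotate_one (N + 2) fun w => ins (fun _ => 1) w * (g w * f w)
    have h' : wsum (N + 2) (fun w => ins (fun _ => 1) (w.rotate 1) *
        (g (w.rotate 1) * f (w.rotate 1))) =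
        wsum (N + 2) (fun w => ins (fun _ => 1) (w.rotate 1) * (g w * f w)) :=
      wsum_congr fun w hw => by rw [hf w hw, hg w hw]
    rw [h'] at h
    simp only [wsum, Fin.sum_univ_two, ins, List.rotate_cons_succ, List.rotate_zero,
      List.cons_append] at h
    simp [wsum_zero] at h
    linarith
  have s0 : splitMerge (N + 1) (kap z) g f 0 = wsum N fun w =>
      (1 + z ^ 2) * (g (1 :: 0 :: w) * f (1 :: 0 :: w) + g (1 :: 1 :: w) * f (1 :: 1 :: w)) := by
    simp only [splitMerge, wsum, Fin.sum_univ_two, ← wsum_add, merge, split, kap, List.rotate_zero]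
    exact wsum_congr fun w hw => by simp; ring
  have s1 : ∀ {g f : List (Fin 2) → ℝ}, (∀ (a b : Fin 2) (w : List (Fin 2)), w.length = N →
      f (b :: (w ++ [a])) = f (a :: b :: w)) →
      splitMerge (N + 1) (kap z) g f 1 = wsum N fun w =>
      g (1 :: 0 :: w) * f (0 :: 1 :: w) + z ^ 2 * (g (1 :: 1 :: w) * f (1 :: 1 :: w)) := by
    intro g f hf1
    simp only [splitMerge, wsum, Fin.sum_univ_two, ← wsum_add, merge, split, kap,
      List.rotate_cons_succ, List.rotate_zero, List.cons_append]
    exact wsum_congr fun w hw => by simp [hf1 _ _ _ hw]; ring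
  have t0 : mergeSplit (N + 1) (kap z) g f 0 = wsum N fun w =>
      (g (0 :: 0 :: w) - z * g (1 :: 1 :: w)) * (f (0 :: 0 :: w) - z * f (1 :: 1 :: w)) := by
    simp only [mergeSplit, wsum, Fin.sum_univ_two, ← wsum_add, merge, split, kap, List.rotate_zero]
    exact wsum_congr fun w hw => by simp; ring
  have l0 : wsum (N + 2) (fun w => g w * hloc z f w) = wsum N (fun w =>
      g (0 :: 0 :: w) * f (0 :: 0 :: w) + g (1 :: 1 :: w) * f (1 :: 1 :: w) +
      -z * (g (0 :: 0 :: w) * f (1 :: 1 :: w) + g (1 :: 1 :: w) * f (0 :: 0 :: w)) +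
      -1 * (g (1 :: 0 :: w) * f (0 :: 1 :: w) + g (0 :: 1 :: w) * f (1 :: 0 :: w))) +
      (1 + z ^ 2) / 2 * (wsum N (fun w => g (1 :: 0 :: w) * f (1 :: 0 :: w)) +
        wsum N (fun w => g (0 :: 1 :: w) * f (0 :: 1 :: w))) := by
    simp only [wsum, Fin.sum_univ_two, ← wsum_add, ← wsum_mul_left, hloc]
    exact wsum_congr fun w hw => by simp; ring
  rw [l0, s0, s1 hf1, s1 hg1, t0, ← hhalf]
  simp only [← wsum_mul_left, ← wsum_add, ← wsum_sub]
  exact wsum_congr fun w hw => by ring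

/-- The supersymmetry relation, as an identity of quadratic forms. -/
lemma wsum_hloc_eq (hM : Even M) (hM0 : M ≠ 0) (hg : CycInv (M + 1) g) (hf : CycInv (M + 1) f) :
    wsum (M + 1) (fun w => g w * hloc z f w) =
      ((M : ℝ) + 2)⁻¹ * wsum (M + 2) (fun w => alt (M + 2) (split (kap z) g) w *
        alt (M + 2) (split (kap z) f) w) +
      (M : ℝ)⁻¹ * wsum M (fun w => alt M (merge (kap z) g) w * alt M (merge (kap z) f) w) := by
  have hM2 : Even (M + 2) := by simpa [parity_simps] using hM
  rw [wsum_alt_mul (cycAnti_alt hM2 _), wsum_alt_mul (cycAnti_alt hM _), wsum_split_mul]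
  obtain ⟨N, rfl⟩ : ∃ N, M = N + 1 := Nat.exists_eq_succ_of_ne_zero hM0
  have h1 : wsum (N + 1) (fun w => merge (kap z) g w * alt (N + 1) (merge (kap z) f) w) =
      wsum (N + 2) (fun w => g w * split (kap z) (alt (N + 1) (merge (kap z) f)) w) := by
    rw [wsum_mul_comm, ← wsum_split_mul, wsum_mul_comm]
  rw [h1, wsum_hloc hg hf, ← splitMerge_last (g := g) (f := f),
    ← sum_splitMerge hM hM0 hg hf]
  have a1 : (((N + 1 : ℕ) : ℝ) + 2) ≠ 0 := by positivity
  have a2 : ((N + 1 : ℕ) : ℝ) ≠ 0 := by positivity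
  push_cast at a1 a2 ⊢
  field_simp

lemma wsum_hloc_nonneg (hM : Even M) (hM0 : M ≠ 0) (hf : CycInv (M + 1) f) :
    0 ≤ wsum (M + 1) (fun w => f w * hloc z f w) := by
  rw [wsum_hloc_eq hM hM0 hf hf]
  have h1 := wsum_nonneg (m := M + 2) fun w => mul_self_nonneg (alt (M + 2) (split (kap z) f) w)
  have h2 := wsum_nonneg (m := M) fun w => mul_self_nonneg (alt M (merge (kap z) f) w)
  positivity

/-- The word function of a product state. -/
def prodw (v : Fin 2 → ℝ) (w : List (Fin 2)) : ℝ := (w.map v).prod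

lemma cycInv_prodw (m : ℕ) (v : Fin 2 → ℝ) : CycInv m (prodw v) := by
  intro w _
  simp only [prodw, List.map_rotate]
  exact ((w.map v).rotate_perm 1).prod_eq

lemma wsum_prodw_mul (m : ℕ) (v v' : Fin 2 → ℝ) :
    wsum m (fun w => prodw v w * prodw v' w) = (v 0 * v' 0 + v 1 * v' 1) ^ m := by
  induction m with
  | zero => simp [wsum, prodw]
  | succ m ih =>
    have : ∀ a w, prodw v (a :: w) * prodw v' (a :: w) = v a * v' a * (prodw v w * prodw v' w) := by
      intro a w; simp only [prodw, List.map_cons, List.prod_cons]; ring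
    simp only [wsum, this, wsum_mul_left, ih, Fin.sum_univ_two]
    ring

/-- The letter vector `(s, z)` is group-like for the coassociative constants: splitting a letter
yields the product vector again, which is rotation-invariant, so its alternating sum vanishes. -/
lemma alt_split_prodw (hM : Even M) {s : ℝ} (hs : s ^ 2 = z) {w : List (Fin 2)}
    (hw : w.length = M + 2) : alt (M + 2) (split (kap z) (prodw ![s, z])) w = 0 := by
  rw [← alt_split_kap' hM (cycInv_prodw _ _) hw,
    ← alt_eq_zero (by simpa [parity_simps] using hM) (cycInv_prodw _ ![s, z]) hw]
  refine alt_congr (fun w hw => ?_) hw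
  obtain ⟨a, b, v, rfl, -⟩ := exists_cons_cons hw
  simp only [split, prodw, List.map_cons, List.prod_cons, Fin.sum_univ_two, ← hs]
  fin_cases a <;> fin_cases b <;>
    simp [kap', kap, -mul_eq_mul_left_iff, -mul_eq_mul_right_iff] <;> ring

/-- Dually, merging two letters of the product of `(1/(2s), 1/(2z))` gives back the same letter
vector. This vector is normalized by its pairing 1 with `(s, z)`. -/
lemma alt_merge_prodw (hM : Even M) (hM0 : M ≠ 0) {s : ℝ} (hs : s ^ 2 = z) (hz : z ≠ 0)
    {w : List (Fin 2)} (hw : w.length = M) :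
    alt M (merge (kap z) (prodw ![(2 * s)⁻¹, (2 * z)⁻¹])) w = 0 := by
  have hs0 : s ≠ 0 := by rintro rfl; apply hz; rw [← hs]; ring
  rw [← alt_merge_kap' hM hM0 (cycInv_prodw _ _) hw,
    ← alt_eq_zero hM (cycInv_prodw _ ![(2 * s)⁻¹, (2 * z)⁻¹]) hw]
  refine alt_congr (fun w hw => ?_) hw
  obtain ⟨N, rfl⟩ : ∃ N, M = N + 1 := Nat.exists_eq_succ_of_ne_zero hM0
  obtain ⟨a, v, rfl⟩ := List.exists_cons_of_length_eq_add_one hw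
  simp only [merge, prodw, List.map_cons, List.prod_cons, Fin.sum_univ_two, ← hs]
  fin_cases a <;> simp [kap', kap] <;> field_simp <;> ring

/-- The product state is not in the range of the shifted Hamiltonian on the cyclic sector. -/
lemma not_exists_preimage (hM : Even M) (hM0 : M ≠ 0) {s : ℝ} (hs : s ^ 2 = z) (hz : z ≠ 0) :
    ¬ ∃ f, CycInv (M + 1) f ∧ ∀ g, CycInv (M + 1) g →
      wsum (M + 1) (fun w => g w * hloc z f w) =
        wsum (M + 1) (fun w => g w * prodw ![s, z] w) := by
  rintro ⟨f, hf, h⟩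
  have hs0 : s ≠ 0 := by rintro rfl; apply hz; rw [← hs]; ring
  have hM2 : Even (M + 2) := by simpa [parity_simps] using hM
  set χ := alt (M + 2) (split (kap z) f) with hχdef
  have hχ : CycAnti (M + 2) χ := cycAnti_alt hM2 _
  set φ := avg (M + 1) (merge (kap z) χ) with hφdef
  have hφ : CycInv (M + 1) φ := cycInv_avg _
  have a1 : ((M : ℝ) + 2) ≠ 0 := by positivity
  have a2 : ((M : ℝ) + 1) ≠ 0 := by positivity
  have pair : ∀ g, CycInv (M + 1) g → wsum (M + 2) (fun w => alt (M + 2) (split (kap z) g) w * χ w) =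
      (M + 2) / (M + 1) * wsum (M + 1) (fun w => φ w * g w) := by
    intro g hg
    rw [wsum_alt_mul hχ, wsum_split_mul, wsum_avg_mul hg, wsum_mul_comm]
    push_cast
    field_simp
  -- Up to a factor `φ` is `Q†Q f`, so this is `(Q†)² = 0`. The change to the coassociative
  -- constants is allowed at both stages.
  have hDφ : ∀ w, w.length = M → alt M (merge (kap z) φ) w = 0 := by
    intro w hw
    rw [← alt_merge_kap' hM hM0 hφ hw, ← alt_merge_avg_merge (z := z) hM hM0 hχ hw]
    refine alt_congr (fun w hw => ?_) hw
    obtain ⟨N, rfl⟩ : ∃ N, M = N + 1 := Nat.exists_eq_succ_of_ne_zero hM0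
    obtain ⟨c, v, rfl⟩ := List.exists_cons_of_length_eq_add_one hw
    have hv : v.length = N := by simpa using hw
    simp only [merge]
    refine Finset.sum_congr rfl fun a _ => Finset.sum_congr rfl fun b _ => ?_
    rw [hφdef, avg_merge_kap' hχ (by simp [hv])]
  have hc : wsum (M + 1) (fun w => φ w * prodw ![s, z] w) = 0 := by
    have := pair _ (cycInv_prodw _ ![s, z])
    rw [wsum_congr (G := fun _ => 0) fun w hw => by rw [alt_split_prodw hM hs hw, zero_mul],
      wsum_zero] at this
    have h3 : ((M : ℝ) + 2) / (M + 1) ≠ 0 := by positivity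
    exact (mul_eq_zero.mp this.symm).resolve_left h3
  -- Test the equation for `f` with `φ`: the right side vanishes because the product vector is
  -- `Q`-closed, the `Q†` part of the energy vanishes by nilpotency, and the rest is a positive
  -- multiple of `⟨φ, φ⟩`.
  have hφ0 : wsum (M + 1) (fun w => φ w * φ w) = 0 := by
    have h1 := h φ hφ
    rw [hc, wsum_hloc_eq hM hM0 hφ hf, ← hχdef, pair φ hφ,
      wsum_congr (m := M) (G := fun _ => 0) fun w hw => by rw [hDφ w hw, zero_mul], wsum_zero] at h1
    rw [mul_zero, add_zero, ← mul_assoc] at h1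
    exact (mul_eq_zero.mp h1).resolve_left (by positivity)
  have hχ0 : wsum (M + 2) (fun w => χ w * χ w) = 0 := by
    have := pair f hf
    rw [← hχdef] at this
    rw [this, wsum_congr (G := fun _ => 0) fun w hw => by
      rw [eq_zero_of_wsum_sq hφ0 hw, zero_mul], wsum_zero, mul_zero]
  -- Now `Q f = 0`, so testing with the dual product vector, which is annihilated by `Q†`, gives
  -- energy 0, while its pairing with the product vector is `1^(M+1)`.
  have hp := cycInv_prodw (M + 1) ![(2 * s)⁻¹, (2 * z)⁻¹]
  have h1 := h _ hp
  rw [wsum_hloc_eq hM hM0 hp hf, ← hχdef,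
    wsum_congr (m := M + 2) (G := fun _ => 0) fun w hw => by
      rw [eq_zero_of_wsum_sq hχ0 hw, mul_zero],
    wsum_congr (m := M) (G := fun _ => 0) fun w hw => by
      rw [alt_merge_prodw hM hM0 hs hz hw, zero_mul], wsum_zero, wsum_zero, wsum_prodw_mul] at h1
  have : (2 * s)⁻¹ * s + (2 * z)⁻¹ * z = 1 := by field_simp; norm_num
  have this' : ![(2 * s)⁻¹, (2 * z)⁻¹] 0 * ![s, z] 0 + ![(2 * s)⁻¹, (2 * z)⁻¹] 1 * ![s, z] 1 = 1 :=
    this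
  rw [this', one_pow, mul_zero, mul_zero, add_zero] at h1
  exact zero_ne_one h1

end EnergyDensity

section Product

/-! ### Product operators on the spin chain -/

variable {n : ℕ}

/-- The operator `⊗_j A_j`. -/
def tens (A : Fin (2 * n + 1) → Matrix (Fin 2) (Fin 2) ℂ) : Op n :=
  Matrix.of fun s t => ∏ j, A j (s j) (t j)

lemma tens_apply (A : Fin (2 * n + 1) → Matrix (Fin 2) (Fin 2) ℂ) (s t : Conf n) :
    tens A s t = ∏ j, A j (s j) (t j) := rfl

lemma tens_mul (A B : Fin (2 * n + 1) → Matrix (Fin 2) (Fin 2) ℂ) :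
    tens (A * B) = tens A * tens B := by
  ext s t
  simp only [tens_apply, Matrix.mul_apply, Pi.mul_apply]
  rw [Finset.prod_univ_sum]
  simp only [Fintype.piFinset_univ, Finset.prod_mul_distrib]

lemma tens_one : tens (1 : Fin (2 * n + 1) → Matrix (Fin 2) (Fin 2) ℂ) = 1 := by
  ext s t
  simp only [tens_apply, Matrix.one_apply, Pi.one_apply]
  rw [Finset.prod_ite_zero]
  simp [funext_iff]

lemma site_eq_tens (A : Matrix (Fin 2) (Fin 2) ℂ) (j : Fin (2 * n + 1)) :
    site A j = tens (Pi.mulSingle j A) := by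
  ext s t
  simp only [site, Matrix.of_apply, tens_apply]
  rw [← Finset.mul_prod_erase _ _ (Finset.mem_univ j), Pi.mulSingle_eq_same]
  have : ∏ k ∈ Finset.univ.erase j, (Pi.mulSingle j A : Fin (2 * n + 1) → _) k (s k) (t k) =
      ∏ k ∈ Finset.univ.erase j, if s k = t k then (1 : ℂ) else 0 := by
    refine Finset.prod_congr rfl fun k hk => ?_
    rw [Pi.mulSingle_eq_of_ne (Finset.ne_of_mem_erase hk), Matrix.one_apply]
  rw [this, Finset.prod_ite_zero]
  simp

lemma bond_eq_tens (A : Matrix (Fin 2) (Fin 2) ℂ) (j : Fin (2 * n + 1)) :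
    bond A j = tens (Pi.mulSingle j A * Pi.mulSingle (j + 1) A) := by
  rw [bond, site_eq_tens, site_eq_tens, tens_mul]

lemma site_mulVec (A : Matrix (Fin 2) (Fin 2) ℂ) (j : Fin (2 * n + 1)) (ψ : Conf n → ℂ)
    (s : Conf n) : (site A j).mulVec ψ s = ∑ x, A (s j) x * ψ (Function.update s j x) := by
  simp only [Matrix.mulVec, dotProduct, site, Matrix.of_apply, ite_mul, zero_mul]
  rw [← Finset.sum_filter]
  symm
  refine Finset.sum_bij (fun x _ => Function.update s j x) ?_ ?_ ?_ ?_
  · intro x _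
    simp only [Finset.mem_filter, Finset.mem_univ, true_and]
    intro k hk
    rw [Function.update_of_ne hk]
  · intro x _ y _ h
    simpa using congrFun h j
  · intro t ht
    simp only [Finset.mem_filter, Finset.mem_univ, true_and] at ht
    refine ⟨t j, Finset.mem_univ _, ?_⟩
    funext k
    by_cases hk : k = j
    · subst hk; simp
    · rw [Function.update_of_ne hk, ht k hk]
  · intro x _; simp

/-- The sign `±1` of a spin. -/
def spinSign (a : Fin 2) : ℝ := if a = 0 then 1 else -1

lemma spinSign_add_one (a : Fin 2) : spinSign (a + 1) = -spinSign a := by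
  fin_cases a <;> simp [spinSign]

/-- Flip the spins at `j` and `j + 1`. -/
def flip (j : Fin (2 * n + 1)) (s : Conf n) : Conf n := s + Pi.single j 1 + Pi.single (j + 1) 1

lemma fin_two_add_self (a : Fin 2) : a + a = 0 := by fin_cases a <;> rfl

lemma conf_add_self (s : Conf n) : s + s = 0 := funext fun _ => fin_two_add_self _

lemma flip_flip (j : Fin (2 * n + 1)) (s : Conf n) : flip j (flip j s) = s := by
  have h1 := conf_add_self (n := n) (Pi.single j 1)
  have h2 := conf_add_self (n := n) (Pi.single (j + 1) 1)
  calc flip j (flip j s) = s + (Pi.single j 1 + Pi.single j 1) +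
        (Pi.single (j + 1) 1 + Pi.single (j + 1) 1) := by simp only [flip]; abel
    _ = s := by rw [h1, h2, add_zero, add_zero]

lemma add_one_ne (hn : n ≠ 0) (j : Fin (2 * n + 1)) : j + 1 ≠ j := by
  intro h
  have h1 : (1 : Fin (2 * n + 1)) = 0 := by simpa using h
  have := congrArg Fin.val h1
  rw [Fin.val_one', Fin.val_zero, Nat.mod_eq_of_lt (by omega)] at this
  omega

lemma flip_apply_left (hn : n ≠ 0) (j : Fin (2 * n + 1)) (s : Conf n) :
    flip j s j = s j + 1 := by
  simp [flip, Pi.single_eq_of_ne (add_one_ne hn j).symm]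

lemma flip_apply_right (hn : n ≠ 0) (j : Fin (2 * n + 1)) (s : Conf n) :
    flip j s (j + 1) = s (j + 1) + 1 := by
  simp [flip, Pi.single_eq_of_ne (add_one_ne hn j)]

lemma flip_apply_of_ne {j k : Fin (2 * n + 1)} (h1 : k ≠ j) (h2 : k ≠ j + 1) (s : Conf n) :
    flip j s k = s k := by
  simp [flip, Pi.single_eq_of_ne h1, Pi.single_eq_of_ne h2]

lemma update_add_one (s : Conf n) (j : Fin (2 * n + 1)) :
    Function.update s j (s j + 1) = s + Pi.single j 1 := by
  funext k
  by_cases hk : k = j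
  · subst hk; simp
  · simp [hk]

lemma site_sigmaX_mulVec (j : Fin (2 * n + 1)) (ψ : Conf n → ℂ) (s : Conf n) :
    (site sigmaX j).mulVec ψ s = ψ (s + Pi.single j 1) := by
  rw [site_mulVec, ← update_add_one]
  generalize s j = a
  fin_cases a <;> simp [sigmaX]

lemma site_sigmaY_mulVec (j : Fin (2 * n + 1)) (ψ : Conf n → ℂ) (s : Conf n) :
    (site sigmaY j).mulVec ψ s = -Complex.I * spinSign (s j) * ψ (s + Pi.single j 1) := by
  rw [site_mulVec, ← update_add_one]
  generalize s j = a
  fin_cases a <;> simp [sigmaY, spinSign]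

lemma site_sigmaZ_mulVec (j : Fin (2 * n + 1)) (ψ : Conf n → ℂ) (s : Conf n) :
    (site sigmaZ j).mulVec ψ s = spinSign (s j) * ψ s := by
  rw [site_mulVec]
  have h : ψ s = ψ (Function.update s j (s j)) := by rw [Function.update_eq_self]
  rw [h]
  generalize s j = a
  fin_cases a <;> simp [sigmaZ, spinSign]

lemma bond_sigmaX_mulVec (j : Fin (2 * n + 1)) (ψ : Conf n → ℂ) (s : Conf n) :
    (bond sigmaX j).mulVec ψ s = ψ (flip j s) := by
  rw [bond, ← Matrix.mulVec_mulVec, site_sigmaX_mulVec, site_sigmaX_mulVec, flip]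

lemma bond_sigmaY_mulVec (hn : n ≠ 0) (j : Fin (2 * n + 1)) (ψ : Conf n → ℂ) (s : Conf n) :
    (bond sigmaY j).mulVec ψ s =
      -(spinSign (s j) * spinSign (s (j + 1)) : ℝ) * ψ (flip j s) := by
  rw [bond, ← Matrix.mulVec_mulVec, site_sigmaY_mulVec, site_sigmaY_mulVec, flip]
  have : (s + Pi.single j 1 : Conf n) (j + 1) = s (j + 1) := by
    simp [Pi.single_eq_of_ne (add_one_ne hn j)]
  rw [this]
  push_cast
  linear_combination (spinSign (s j) * spinSign (s (j + 1)) *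
    ψ (s + Pi.single j 1 + Pi.single (j + 1) 1)) * Complex.I_sq

lemma bond_sigmaZ_mulVec (j : Fin (2 * n + 1)) (ψ : Conf n → ℂ) (s : Conf n) :
    (bond sigmaZ j).mulVec ψ s = (spinSign (s j) * spinSign (s (j + 1)) : ℝ) * ψ s := by
  rw [bond, ← Matrix.mulVec_mulVec, site_sigmaZ_mulVec, site_sigmaZ_mulVec]
  push_cast; ring

lemma hamiltonian_mulVec (hn : n ≠ 0) (Jx Jy Jz : ℂ) (ψ : Conf n → ℂ) (s : Conf n) :
    (hamiltonian n Jx Jy Jz).mulVec ψ s = -(1 / 2) * ∑ j, ((Jx - Jy *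
      (spinSign (s j) * spinSign (s (j + 1)) : ℝ)) * ψ (flip j s) +
      Jz * (spinSign (s j) * spinSign (s (j + 1)) : ℝ) * ψ s) := by
  rw [hamiltonian, Matrix.smul_mulVec, Matrix.sum_mulVec, Pi.smul_apply, smul_eq_mul,
    Finset.sum_apply]
  congr 1
  refine Finset.sum_congr rfl fun j _ => ?_
  rw [Matrix.add_mulVec, Matrix.add_mulVec, Matrix.smul_mulVec, Matrix.smul_mulVec,
    Matrix.smul_mulVec]
  simp only [Pi.add_apply, Pi.smul_apply, smul_eq_mul, bond_sigmaX_mulVec,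
    bond_sigmaY_mulVec hn, bond_sigmaZ_mulVec]
  ring

/-! ### The shifted supersymmetric Hamiltonian as a real matrix -/

/-- The weight of a configuration in the diagonal part of the bond energy. -/
def diagWeight (z : ℝ) (s : Conf n) (j : Fin (2 * n + 1)) : ℝ :=
  if s j = s (j + 1) then 1 else (1 + z ^ 2) / 2

/-- Minus the amplitude for flipping the bond `j`. -/
def flipWeight (z : ℝ) (s : Conf n) (j : Fin (2 * n + 1)) : ℝ :=
  if s j = s (j + 1) then z else 1

/-- The supersymmetric Hamiltonian minus its ground-state energy. -/
def shiftedH (n : ℕ) (z : ℝ) : Matrix (Conf n) (Conf n) ℝ :=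
  Matrix.of fun s t => ∑ j, ((if t = s then diagWeight z s j else 0) -
    if t = flip j s then flipWeight z s j else 0)

lemma shiftedH_mulVec (z : ℝ) (f : Conf n → ℝ) (s : Conf n) :
    (shiftedH n z).mulVec f s = ∑ j, (diagWeight z s j * f s - flipWeight z s j * f (flip j s)) := by
  simp only [Matrix.mulVec, dotProduct, shiftedH, Matrix.of_apply, Finset.sum_mul]
  rw [Finset.sum_comm]
  refine Finset.sum_congr rfl fun j _ => ?_
  simp only [sub_mul, ite_mul, zero_mul, Finset.sum_sub_distrib, Finset.sum_ite_eq',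
    Finset.mem_univ, if_true]

lemma flipWeight_flip (hn : n ≠ 0) (z : ℝ) (s : Conf n) (j : Fin (2 * n + 1)) :
    flipWeight z (flip j s) j = flipWeight z s j := by
  simp only [flipWeight, flip_apply_left hn, flip_apply_right hn, add_left_inj]

lemma shiftedH_isHermitian (hn : n ≠ 0) (z : ℝ) : (shiftedH n z).IsHermitian := by
  ext s t
  simp only [Matrix.conjTranspose_apply, shiftedH, Matrix.of_apply, star_trivial]
  refine Finset.sum_congr rfl fun j _ => ?_
  have h1 : (s = flip j t) ↔ (t = flip j s) :=
    ⟨fun h => by rw [h, flip_flip], fun h => by rw [h, flip_flip]⟩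
  congr 1
  · by_cases h : s = t
    · subst h; rfl
    · rw [if_neg h, if_neg (Ne.symm h)]
  · by_cases h : t = flip j s
    · rw [if_pos h, if_pos (h1.mpr h), h, flipWeight_flip hn]
    · rw [if_neg h, if_neg (fun h' => h (h1.mp h'))]

/-- The ground-state energy of the supersymmetric chain. -/
def groundEnergy (n : ℕ) (z : ℝ) : ℝ := -(2 * n + 1) * (z ^ 2 + 3) / 4

lemma spinSign_mul (a b : Fin 2) : spinSign a * spinSign b = if a = b then 1 else -1 := by
  fin_cases a <;> fin_cases b <;> simp [spinSign]

lemma susyHamiltonian_mulVec (hn : n ≠ 0) (z : ℝ) (ψ : Conf n → ℂ) (s : Conf n) :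
    (susyHamiltonian n z).mulVec ψ s = groundEnergy n z * ψ s +
      ∑ j, (diagWeight z s j * ψ s - flipWeight z s j * ψ (flip j s)) := by
  have hE : (groundEnergy n z : ℂ) * ψ s = ∑ _j : Fin (2 * n + 1), -((z : ℂ) ^ 2 + 3) / 4 * ψ s := by
    rw [Finset.sum_const, Finset.card_univ, Fintype.card_fin, nsmul_eq_mul, groundEnergy]
    push_cast; ring
  rw [susyHamiltonian, hamiltonian_mulVec hn, hE, Finset.mul_sum, ← Finset.sum_add_distrib]
  refine Finset.sum_congr rfl fun j _ => ?_
  rw [spinSign_mul, diagWeight, flipWeight]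
  split_ifs <;> push_cast <;> ring

lemma susyHamiltonian_eq (hn : n ≠ 0) (z : ℝ) :
    susyHamiltonian n z = (groundEnergy n z : ℂ) • 1 + (shiftedH n z).map (fun x => (x : ℂ)) := by
  refine Matrix.ext_of_mulVec_single fun t => ?_
  funext s
  rw [susyHamiltonian_mulVec hn, Matrix.add_mulVec, Matrix.smul_mulVec, Matrix.one_mulVec,
    Pi.add_apply, Pi.smul_apply, smul_eq_mul]
  congr 1
  rw [Matrix.mulVec_single_one]
  simp only [Matrix.col_apply, Matrix.map_apply, shiftedH, Matrix.of_apply, Pi.single_apply]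
  push_cast
  refine Finset.sum_congr rfl fun j _ => ?_
  congr 1
  · by_cases h : t = s
    · simp [h]
    · simp [h, Ne.symm h]
  · by_cases h : t = flip j s
    · simp [h]
    · simp [h, Ne.symm h]

end Product

/-! ### Rotations of configurations and words -/

section Rotation
variable {n : ℕ} {z : ℝ}

/-- Rotation of a configuration by one site. -/
def rot (s : Conf n) : Conf n := fun i => s (i + 1)

/-- Rotation as a permutation of the configurations. -/
def rotEquiv (n : ℕ) : Conf n ≃ Conf n where
  toFun := rot
  invFun s i := s (i - 1)
  left_inv s := funext fun i => by simp [rot]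
  right_inv s := funext fun i => by simp [rot]

lemma sum_rot {R : Type*} [AddCommMonoid R] (F : Conf n → R) : ∑ s, F (rot s) = ∑ s, F s :=
  Equiv.sum_comp (rotEquiv n) F

lemma flip_rot (j : Fin (2 * n + 1)) (s : Conf n) : flip j (rot s) = rot (flip (j + 1) s) := by
  funext k
  simp [flip, rot, Pi.single_apply]

/-- Functions of configurations invariant under rotations. -/
def cycSubmodule (n : ℕ) : Submodule ℝ (Conf n → ℝ) where
  carrier := {f | ∀ s, f (rot s) = f s}
  add_mem' hf hg s := by simp only [Pi.add_apply, hf s, hg s]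
  zero_mem' _ := rfl
  smul_mem' c f hf s := by simp only [Pi.smul_apply, hf s]

lemma eq_of_add_one {α : Type*} {F : Fin (2 * n + 1) → α} (h : ∀ j, F (j + 1) = F j)
    (j : Fin (2 * n + 1)) : F j = F 0 := by
  induction j using Fin.induction with
  | zero => rfl
  | succ i ih => rw [← Fin.coeSucc_eq_succ, h, ih]

lemma sum_rot_index {R : Type*} [AddCommMonoid R] (F : Fin (2 * n + 1) → R) :
    ∑ j, F (j + 1) = ∑ j, F j := Equiv.sum_comp (Equiv.addRight 1) F

lemma shiftedH_mulVec_mem {f : Conf n → ℝ} (hf : f ∈ cycSubmodule n) :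
    (shiftedH n z).mulVec f ∈ cycSubmodule n := by
  intro s
  rw [shiftedH_mulVec, shiftedH_mulVec,
    ← sum_rot_index fun j => diagWeight z s j * f s - flipWeight z s j * f (flip j s)]
  refine Finset.sum_congr rfl fun j _ => ?_
  rw [flip_rot, hf, hf]
  rfl

/-- The configuration spelled by a word. -/
def wordConf (n : ℕ) (w : List (Fin 2)) : Conf n := fun i => w.getD i 0

lemma wordConf_ofFn (s : Conf n) : wordConf n (List.ofFn s) = s := by
  funext i
  simp only [wordConf]
  rw [List.getD_eq_getElem _ _ (by simpa using Nat.lt_succ_iff.mp i.isLt), List.getElem_ofFn]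

lemma ofFn_wordConf {w : List (Fin 2)} (hw : w.length = 2 * n + 1) :
    List.ofFn (wordConf n w) = w := by
  apply List.ext_getElem
  · simp [hw]
  · intro i h1 h2
    rw [List.getElem_ofFn]
    exact List.getD_eq_getElem _ _ h2

lemma wordConf_rotate {w : List (Fin 2)} (hw : w.length = 2 * n + 1) :
    wordConf n (w.rotate 1) = rot (wordConf n w) := by
  funext i
  have hi := i.isLt
  have h1 : (i : ℕ) < (w.rotate 1).length := by simpa [hw] using Nat.lt_succ_iff.mp hi
  have h2 : ((i + 1 : Fin (2 * n + 1)) : ℕ) < w.length := by rw [hw]; exact (i + 1).isLt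
  simp only [wordConf, rot]
  rw [List.getD_eq_getElem _ _ h1, List.getD_eq_getElem _ _ h2, List.getElem_rotate]
  congr 1
  rw [Fin.val_add, Fin.val_one', hw]
  simp

lemma wordConf_flip (hn : n ≠ 0) (a b : Fin 2) (w : List (Fin 2)) :
    wordConf n ((a + 1) :: (b + 1) :: w) = flip 0 (wordConf n (a :: b :: w)) := by
  have h1 : ((0 + 1 : Fin (2 * n + 1)) : ℕ) = 1 := by
    rw [zero_add, Fin.val_one', Nat.mod_eq_of_lt (by omega)]
  funext i
  by_cases h0 : i = 0
  · subst h0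
    rw [flip_apply_left hn]
    simp [wordConf]
  · by_cases hi : i = 0 + 1
    · rw [hi, flip_apply_right hn]
      simp only [wordConf, h1]
      rfl
    · rw [flip_apply_of_ne h0 hi]
      have h0' : (i : ℕ) ≠ 0 := fun h => h0 (Fin.ext h)
      have hi' : (i : ℕ) ≠ 1 := fun h => hi (Fin.ext (by rw [h, h1]))
      obtain ⟨k, hk⟩ : ∃ k, (i : ℕ) = k + 2 := ⟨i - 2, by omega⟩
      simp [wordConf, hk]

lemma hloc_wordConf (hn : n ≠ 0) (f : Conf n → ℝ) {w : List (Fin 2)}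
    (hw : w.length = 2 * n + 1) :
    hloc z (fun w => f (wordConf n w)) w =
      diagWeight z (wordConf n w) 0 * f (wordConf n w) -
        flipWeight z (wordConf n w) 0 * f (flip 0 (wordConf n w)) := by
  have h1 : ((0 + 1 : Fin (2 * n + 1)) : ℕ) = 1 := by
    rw [zero_add, Fin.val_one', Nat.mod_eq_of_lt (by omega)]
  obtain ⟨a, b, v, rfl⟩ : ∃ a b v, w = a :: b :: v := by
    match w, hw with
    | [], hw => simp at hw
    | [_], hw => simp at hw; omega
    | a :: b :: v, _ => exact ⟨a, b, v, rfl⟩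
  have ha : wordConf n (a :: b :: v) 0 = a := by simp [wordConf]
  have hb : wordConf n (a :: b :: v) (0 + 1) = b := by simp only [wordConf, h1]; rfl
  rw [← wordConf_flip hn, diagWeight, flipWeight, ha, hb, hloc]
  split_ifs with h
  · ring
  · have hab : b = a + 1 := by revert h; fin_cases a <;> fin_cases b <;> simp
    have hba : a = b + 1 := by revert h; fin_cases a <;> fin_cases b <;> simp
    rw [← hab, ← hba]; ring

/-- Between rotation-invariant vectors every bond contributes the same amount as bond 0, whence the
factor `L`. -/
lemma dotProduct_shiftedH (hn : n ≠ 0) {f g : Conf n → ℝ} (hf : f ∈ cycSubmodule n)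
    (hg : g ∈ cycSubmodule n) :
    g ⬝ᵥ (shiftedH n z).mulVec f = (2 * n + 1) * wsum (2 * n + 1) (fun w =>
      g (wordConf n w) * hloc z (fun w => f (wordConf n w)) w) := by
  have hF := eq_of_add_one (F := fun j : Fin (2 * n + 1) => ∑ s, g s *
    (diagWeight z s j * f s - flipWeight z s j * f (flip j s))) fun j => by
      rw [← sum_rot fun s => g s * (diagWeight z s j * f s - flipWeight z s j * f (flip j s))]
      refine Finset.sum_congr rfl fun s _ => ?_
      rw [flip_rot, hf, hf, hg]
      rfl
  rw [wsum_congr fun w hw => by rw [hloc_wordConf hn f hw], wsum_eq_sum_ofFn]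
  simp only [wordConf_ofFn, dotProduct, shiftedH_mulVec, Finset.mul_sum]
  rw [Finset.sum_comm, Finset.sum_congr rfl fun j _ => hF j]
  simp [Finset.mul_sum]

lemma cycInv_wordConf {f : Conf n → ℝ} (hf : f ∈ cycSubmodule n) :
    CycInv (2 * n + 1) fun w => f (wordConf n w) := fun w hw => by
  simp only [wordConf_rotate hw, hf (wordConf n w)]

lemma ofFn_rot (s : Conf n) : List.ofFn (rot s) = (List.ofFn s).rotate 1 := by
  rw [← ofFn_wordConf (n := n) (w := (List.ofFn s).rotate 1) (by simp),
    wordConf_rotate (by simp), wordConf_ofFn]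

lemma ofFn_mem {g : List (Fin 2) → ℝ} (hg : CycInv (2 * n + 1) g) :
    (fun s : Conf n => g (List.ofFn s)) ∈ cycSubmodule n := fun s => by
  show g (List.ofFn (rot s)) = g (List.ofFn s)
  rw [ofFn_rot, hg _ (by simp)]

lemma shiftedH_nonneg_of_cyc (hn : n ≠ 0) {f : Conf n → ℝ} (hf : f ∈ cycSubmodule n) :
    0 ≤ f ⬝ᵥ (shiftedH n z).mulVec f := by
  rw [dotProduct_shiftedH hn hf hf]
  have := wsum_hloc_nonneg (z := z) (M := 2 * n) (by simp) (by omega) (cycInv_wordConf hf)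
  positivity

/-- The cyclic sector is finite-dimensional: without a kernel the operator would be surjective, and
the product vector would have the preimage excluded by `not_exists_preimage`. Positivity of `z`
provides the real root `s`. -/
lemma exists_cyc_zero_mode (hn : n ≠ 0) (hz : 0 < z) :
    ∃ f ∈ cycSubmodule n, f ≠ 0 ∧ (shiftedH n z).mulVec f = 0 := by
  let T : cycSubmodule n →ₗ[ℝ] cycSubmodule n :=
    (shiftedH n z).mulVecLin.restrict fun f hf => shiftedH_mulVec_mem hf
  by_contra! hcon
  have hinj : Function.Injective T := by
    rw [← LinearMap.ker_eq_bot, LinearMap.ker_eq_bot']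
    intro f hf
    by_contra hf0
    exact hcon f f.2 (fun h => hf0 (Subtype.ext h)) (congrArg Subtype.val hf)
  have hsurj := LinearMap.injective_iff_surjective.mp hinj
  have hN : (2 * (n : ℝ) + 1) ≠ 0 := by positivity
  obtain ⟨f, hf⟩ := hsurj ((2 * (n : ℝ) + 1) •
    ⟨_, ofFn_mem (cycInv_prodw (2 * n + 1) ![Real.sqrt z, z])⟩)
  have hf' : (shiftedH n z).mulVec f = (2 * (n : ℝ) + 1) •
    fun s : Conf n => prodw ![Real.sqrt z, z] (List.ofFn s) := congrArg Subtype.val hf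
  refine not_exists_preimage (M := 2 * n) (by simp) (by omega) (Real.sq_sqrt hz.le) hz.ne'
    ⟨_, cycInv_wordConf f.2, fun g hg => mul_left_cancel₀ hN ?_⟩
  have h1 := dotProduct_shiftedH (z := z) hn f.2 (ofFn_mem hg)
  rw [wsum_congr (G := fun w => g w * hloc z (fun w => f.1 (wordConf n w)) w)
    fun w hw => by rw [ofFn_wordConf hw]] at h1
  rw [← h1, hf', dotProduct_smul, smul_eq_mul, wsum_eq_sum_ofFn]
  rfl

end Rotation

/-! ### Positive zero mode -/

section PerronFrobenius
variable {n : ℕ} {z : ℝ}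

lemma dotProduct_shiftedH_comm (hn : n ≠ 0) (f g : Conf n → ℝ) :
    f ⬝ᵥ (shiftedH n z).mulVec g = g ⬝ᵥ (shiftedH n z).mulVec f := by
  have h : (shiftedH n z).transpose = shiftedH n z := by
    simpa [Matrix.IsHermitian, Matrix.conjTranspose_eq_transpose_of_trivial] using
      shiftedH_isHermitian hn z
  rw [Matrix.dotProduct_mulVec, ← Matrix.mulVec_transpose, h, dotProduct_comm]

/-- At this stage positivity is known only on the cyclic sector, so `f` is perturbed in the
direction of its own image, which stays in that sector; a nonzero image would lower the energy below
0. -/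
lemma shiftedH_mulVec_eq_zero_of_cyc (hn : n ≠ 0) {f : Conf n → ℝ} (hf : f ∈ cycSubmodule n)
    (h0 : f ⬝ᵥ (shiftedH n z).mulVec f = 0) : (shiftedH n z).mulVec f = 0 := by
  set g := (shiftedH n z).mulVec f with hg
  have hgm : g ∈ cycSubmodule n := shiftedH_mulVec_mem hf
  have key : ∀ t : ℝ, 0 ≤ 2 * t * (g ⬝ᵥ g) + t ^ 2 * (g ⬝ᵥ (shiftedH n z).mulVec g) := by
    intro t
    have h1 := shiftedH_nonneg_of_cyc (z := z) hn
      ((cycSubmodule n).add_mem hf ((cycSubmodule n).smul_mem t hgm))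
    rw [Matrix.mulVec_add, Matrix.mulVec_smul, add_dotProduct, dotProduct_add, dotProduct_add,
      smul_dotProduct, smul_dotProduct, dotProduct_smul, dotProduct_smul,
      dotProduct_shiftedH_comm hn f g, ← hg, h0] at h1
    simp only [smul_eq_mul] at h1
    linarith
  have hgg : g ⬝ᵥ g ≤ 0 := by
    by_contra! hpos
    set c := g ⬝ᵥ (shiftedH n z).mulVec g with hc
    have hc0 : 0 ≤ c := shiftedH_nonneg_of_cyc hn hgm
    -- Almost the minimizer of the quadratic; the `+ 1` covers the case `c = 0`.
    have h2 := key (-(g ⬝ᵥ g) / (c + 1))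
    have h3 : 2 * (-(g ⬝ᵥ g) / (c + 1)) * (g ⬝ᵥ g) + (-(g ⬝ᵥ g) / (c + 1)) ^ 2 * c =
        -((g ⬝ᵥ g) ^ 2 * (c + 2) / (c + 1) ^ 2) := by field_simp; ring
    rw [h3] at h2
    have : 0 < (g ⬝ᵥ g) ^ 2 * (c + 2) / (c + 1) ^ 2 := by positivity
    linarith
  have h4 : g ⬝ᵥ g = 0 := le_antisymm hgg (by
    simp only [dotProduct]; exact Finset.sum_nonneg fun i _ => mul_self_nonneg _)
  exact dotProduct_self_eq_zero.mp h4

lemma flipWeight_nonneg (hz : 0 ≤ z) (s : Conf n) (j : Fin (2 * n + 1)) :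
    0 ≤ flipWeight z s j := by
  rw [flipWeight]; split_ifs <;> linarith

/-- The amplitudes for flipping bonds enter with a minus sign and nonnegative weight, so replacing a
vector by its modulus cannot raise the energy. -/
lemma dotProduct_abs_le (hz : 0 ≤ z) (f : Conf n → ℝ) :
    (fun s => |f s|) ⬝ᵥ (shiftedH n z).mulVec (fun s => |f s|) ≤
      f ⬝ᵥ (shiftedH n z).mulVec f := by
  simp only [dotProduct, shiftedH_mulVec, Finset.mul_sum]
  refine Finset.sum_le_sum fun s _ => Finset.sum_le_sum fun j _ => ?_
  have h1 := mul_le_mul_of_nonneg_left (le_abs_self (f s * f (flip j s)))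
    (flipWeight_nonneg hz s j)
  rw [abs_mul] at h1
  have h2 := abs_mul_abs_self (f s)
  have h3 : |f s| * (diagWeight z s j * |f s|) = diagWeight z s j * (|f s| * |f s|) := by ring
  rw [mul_sub, mul_sub, h3, h2]
  linarith

/-- Parity of the number of down spins. -/
def parity (s : Conf n) : Fin 2 := ∑ k, s k

lemma parity_add (s t : Conf n) : parity (s + t) = parity s + parity t := by
  simp [parity, Finset.sum_add_distrib]

lemma parity_single (k : Fin (2 * n + 1)) (a : Fin 2) : parity (Pi.single k a : Conf n) = a := by
  simp [parity]

lemma parity_flip (j : Fin (2 * n + 1)) (s : Conf n) : parity (flip j s) = parity s := by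
  rw [flip, parity_add, parity_add, parity_single, parity_single, add_assoc, fin_two_add_self,
    add_zero]

/-- Bond flips connect all configurations of a given parity: a reversed spin can be moved from site
to site, and all of them can be collected at site 0. -/
lemma eq_single_of_flip_invariant {α : Type*} {x : Conf n → α}
    (hx : ∀ s j, x (flip j s) = x s) (s : Conf n) : x s = x (Pi.single 0 (parity s)) := by
  have h1 : ∀ (s : Conf n) j, x (s + Pi.single j 1) = x (s + Pi.single 0 1) := fun s j => by
    refine eq_of_add_one (F := fun j => x (s + Pi.single j 1)) (fun j => ?_) j
    have h := hx (s + Pi.single j 1) j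
    rwa [flip, add_assoc s, conf_add_self, add_zero] at h
  have h2 : ∀ (t : Conf n) j (a : Fin 2), x (t + Pi.single j a) = x (t + Pi.single 0 a) := by
    intro t j a
    fin_cases a
    · simp
    · exact h1 t j
  have h3 : ∀ (S : Finset (Fin (2 * n + 1))) (t : Conf n),
      x (t + ∑ k ∈ S, Pi.single k (s k)) = x (t + Pi.single 0 (∑ k ∈ S, s k)) := by
    intro S
    induction S using Finset.induction_on with
    | empty => simp
    | insert k S hk ih =>
      intro t
      rw [Finset.sum_insert hk, Finset.sum_insert hk, ← add_assoc, ih,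
        add_right_comm, h2, Pi.single_add]
      congr 1
      abel
  have h4 := h3 Finset.univ 0
  rwa [Finset.univ_sum_single, zero_add, zero_add] at h4

/-- Reversal of all spins. -/
def reverse (s : Conf n) : Conf n := s + 1

lemma reverse_reverse (s : Conf n) : reverse (reverse s) = s := by
  rw [reverse, reverse, add_assoc, conf_add_self, add_zero]

lemma flip_reverse (j : Fin (2 * n + 1)) (s : Conf n) :
    flip j (reverse s) = reverse (flip j s) := by
  simp only [flip, reverse]; abel

lemma rot_reverse (s : Conf n) : rot (reverse s) = reverse (rot s) := rfl

lemma diagWeight_reverse (s : Conf n) (j : Fin (2 * n + 1)) :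
    diagWeight z (reverse s) j = diagWeight z s j := by
  simp [diagWeight, reverse]

lemma flipWeight_reverse (s : Conf n) (j : Fin (2 * n + 1)) :
    flipWeight z (reverse s) j = flipWeight z s j := by
  simp [flipWeight, reverse]

lemma shiftedH_mulVec_reverse (f : Conf n → ℝ) (s : Conf n) :
    (shiftedH n z).mulVec (fun s => f (reverse s)) s = (shiftedH n z).mulVec f (reverse s) := by
  simp only [shiftedH_mulVec, diagWeight_reverse, flipWeight_reverse, flip_reverse]

lemma parity_reverse (s : Conf n) : parity (reverse s) = parity s + 1 := by
  rw [reverse, parity_add]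
  congr 1
  have : (2 * n + 1) • (1 : Fin 2) = 1 := by
    rw [add_smul, mul_comm, mul_smul, one_smul]
    have : (2 : ℕ) • (1 : Fin 2) = 0 := rfl
    rw [this, smul_zero, zero_add]
  simp [parity] at this ⊢

lemma exists_positive_zero_mode (hn : n ≠ 0) (hz : 0 < z) :
    ∃ p ∈ cycSubmodule n, (∀ s, 0 < p s) ∧ (shiftedH n z).mulVec p = 0 := by
  obtain ⟨f, hf, hf0, hKf⟩ := exists_cyc_zero_mode hn hz
  have habs : (fun s => |f s|) ∈ cycSubmodule n := fun s => congrArg abs (hf s)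
  have h1 : (shiftedH n z).mulVec (fun s => |f s|) = 0 := by
    refine shiftedH_mulVec_eq_zero_of_cyc hn habs (le_antisymm ?_ (shiftedH_nonneg_of_cyc hn habs))
    refine (dotProduct_abs_le hz.le f).trans ?_
    rw [hKf, dotProduct_zero]
  -- Bond flips preserve parity, so `|f|` might vanish on one parity class. Reversal of all spins
  -- exchanges the classes, as the length is odd, and the symmetrized vector must be positive on
  -- both.
  set p : Conf n → ℝ := fun s => |f s| + |f (reverse s)| with hp
  have hp0 : ∀ s, 0 ≤ p s := fun s => by positivity
  have hKp : (shiftedH n z).mulVec p = 0 := by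
    have h2 : p = (fun s => |f s|) + fun s => |f (reverse s)| := rfl
    rw [h2, Matrix.mulVec_add, h1, zero_add]
    funext s
    rw [shiftedH_mulVec_reverse (fun s => |f s|), h1]
    rfl
  have hrev : ∀ s, p (reverse s) = p s := fun s => by
    simp only [hp, reverse_reverse]; ring
  have hflip : ∀ s, p s = 0 → ∀ j, p (flip j s) = 0 := by
    intro s hs j
    have h2 := congrFun hKp s
    simp only [shiftedH_mulVec, hs, mul_zero, zero_sub, Finset.sum_neg_distrib, Pi.zero_apply,
      neg_eq_zero] at h2
    rw [Finset.sum_eq_zero_iff_of_nonneg fun j _ =>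
      mul_nonneg (flipWeight_nonneg hz.le s j) (hp0 _)] at h2
    refine (mul_eq_zero.mp (h2 j (Finset.mem_univ j))).resolve_left ?_
    rw [flipWeight]; split_ifs
    · exact hz.ne'
    · exact one_ne_zero
  have hx : ∀ s j, (p (flip j s) = 0) = (p s = 0) := fun s j =>
    propext ⟨fun h => by simpa [flip_flip] using hflip _ h j, fun h => hflip s h j⟩
  refine ⟨p, fun s => ?_, fun s => (hp0 s).lt_of_ne fun h => hf0 ?_, hKp⟩
  · simp only [hp, ← rot_reverse, hf (reverse s), hf s]
  · funext t
    have key := fun s => eq_single_of_flip_invariant (x := fun s => p s = 0) hx s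
    have h2 : p t = 0 := by
      rw [key t]
      by_cases hpar : parity t = parity s
      · rw [hpar, ← key s]; exact h.symm
      · have h3 : parity t = parity (reverse s) := by
          rw [parity_reverse]
          revert hpar
          generalize parity t = a
          generalize parity s = b
          fin_cases a <;> fin_cases b <;> simp
        rw [h3, ← key, hrev]; exact h.symm
    have h3 : |f t| ≤ 0 := by
      rw [← h2]; simp only [hp]
      linarith [abs_nonneg (f (reverse t))]
    exact abs_nonpos_iff.mp h3

end PerronFrobenius

/-! ### The ground space for either sign of the coupling. -/

section ZeroMode
variable {n : ℕ} {z : ℝ}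

/-- A nowhere vanishing rotation-invariant zero mode of the shifted Hamiltonian with the signs
of the Perron–Frobenius theorem. -/
structure IsZeroMode (n : ℕ) (z : ℝ) (q : Conf n → ℝ) : Prop where
  cyc : ∀ s, q (rot s) = q s
  pos : ∀ s j, 0 < flipWeight z s j * (q s * q (flip j s))
  ker : (shiftedH n z).mulVec q = 0

/-- The number of down spins. -/
def numDown (s : Conf n) : ℕ := ∑ k, (s k : ℕ)

lemma numDown_rot (s : Conf n) : numDown (rot s) = numDown s :=
  sum_rot_index fun k => (s k : ℕ)

lemma numDown_eq (hn : n ≠ 0) (s : Conf n) (j : Fin (2 * n + 1)) :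
    numDown s = s j + (s (j + 1) + ∑ k ∈ (Finset.univ.erase j).erase (j + 1), (s k : ℕ)) := by
  rw [Finset.add_sum_erase (Finset.univ.erase j) (fun k => (s k : ℕ))
      (Finset.mem_erase.mpr ⟨add_one_ne hn j, Finset.mem_univ _⟩),
    Finset.add_sum_erase Finset.univ (fun k => (s k : ℕ)) (Finset.mem_univ _), numDown]

/-- A sign that changes when two equal neighbouring spins are flipped. -/
def pairSign (s : Conf n) : ℝ := (-1) ^ (numDown s / 2)

lemma pairSign_mul_self (s : Conf n) : pairSign s * pairSign s = 1 := by
  rw [pairSign, ← mul_pow]; simp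

lemma pairSign_rot (s : Conf n) : pairSign (rot s) = pairSign s := by
  rw [pairSign, numDown_rot, pairSign]

lemma pairSign_flip (hn : n ≠ 0) (s : Conf n) (j : Fin (2 * n + 1)) :
    pairSign (flip j s) = if s j = s (j + 1) then -pairSign s else pairSign s := by
  have hm : ∑ k ∈ (Finset.univ.erase j).erase (j + 1), (flip j s k : ℕ) =
      ∑ k ∈ (Finset.univ.erase j).erase (j + 1), (s k : ℕ) := by
    refine Finset.sum_congr rfl fun k hk => ?_
    rw [flip_apply_of_ne (by aesop) (by aesop)]
  rw [pairSign, pairSign, numDown_eq hn (flip j s) j, numDown_eq hn s j, hm, flip_apply_left hn,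
    flip_apply_right hn]
  generalize ∑ k ∈ (Finset.univ.erase j).erase (j + 1), (s k : ℕ) = m
  generalize s j = a
  generalize s (j + 1) = b
  have h1 : (1 + (1 + m)) / 2 = m / 2 + 1 := by omega
  fin_cases a <;> fin_cases b <;> simp [h1, pow_succ]

/-- For `z < 0`, conjugation by `pairSign` changes the sign of exactly those amplitudes that flip
equal neighbours, and the diagonal is even in `z`; this turns the problem into the one at `-z`. -/
lemma exists_isZeroMode (hn : n ≠ 0) (hz : z ≠ 0) : ∃ q, IsZeroMode n z q := by
  rcases lt_or_gt_of_ne hz with hz | hz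
  · obtain ⟨p, hp, hpos, hker⟩ := exists_positive_zero_mode hn (neg_pos.mpr hz)
    have hw : ∀ (s : Conf n) j, flipWeight z s j * pairSign (flip j s) =
        pairSign s * flipWeight (-z) s j := fun s j => by
      rw [pairSign_flip hn, flipWeight, flipWeight]
      split_ifs <;> ring
    have hpos' : ∀ (s : Conf n) j, 0 < flipWeight (-z) s j := fun s j => by
      rw [flipWeight]; split_ifs <;> linarith
    refine ⟨fun s => pairSign s * p s, fun s => by rw [pairSign_rot, hp s], fun s j => ?_, ?_⟩
    · have h : flipWeight z s j * (pairSign s * p s * (pairSign (flip j s) * p (flip j s))) =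
          flipWeight (-z) s j * (p s * p (flip j s)) := by
        linear_combination (pairSign s * p s * p (flip j s)) * hw s j +
          flipWeight (-z) s j * p s * p (flip j s) * pairSign_mul_self s
      rw [h]
      exact mul_pos (hpos' s j) (mul_pos (hpos _) (hpos _))
    · funext s
      have h := congrFun hker s
      rw [shiftedH_mulVec] at h ⊢
      rw [Pi.zero_apply] at h ⊢
      rw [← mul_zero (pairSign s), ← h, Finset.mul_sum]
      refine Finset.sum_congr rfl fun j _ => ?_
      have hd : diagWeight (-z) s j = diagWeight z s j := by simp [diagWeight]
      rw [hd]
      linear_combination (-p (flip j s)) * hw s j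
  · obtain ⟨p, hp, hpos, hker⟩ := exists_positive_zero_mode hn hz
    refine ⟨p, hp, fun s j => mul_pos ?_ (mul_pos (hpos _) (hpos _)), hker⟩
    rw [flipWeight]; split_ifs <;> linarith

variable {q : Conf n → ℝ}

lemma IsZeroMode.ne_zero (h : IsZeroMode n z q) (s : Conf n) : q s ≠ 0 := by
  intro h0
  have := h.pos s 0
  rw [h0] at this
  simp at this

/-- The shifted Hamiltonian as a complex matrix. -/
def shiftedC (n : ℕ) (z : ℝ) : Op n := (shiftedH n z).map fun x => (x : ℂ)

lemma susyHamiltonian_eq_shiftedC (hn : n ≠ 0) (z : ℝ) :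
    susyHamiltonian n z = (groundEnergy n z : ℂ) • 1 + shiftedC n z := susyHamiltonian_eq hn z

lemma shiftedC_mulVec (hn : n ≠ 0) (z : ℝ) (ψ : Conf n → ℂ) (s : Conf n) :
    (shiftedC n z).mulVec ψ s =
      ∑ j, (diagWeight z s j * ψ s - flipWeight z s j * ψ (flip j s)) := by
  have h := susyHamiltonian_mulVec hn z ψ s
  rw [susyHamiltonian_eq_shiftedC hn, Matrix.add_mulVec, Matrix.smul_mulVec, Matrix.one_mulVec,
    Pi.add_apply, Pi.smul_apply, smul_eq_mul] at h
  exact add_left_cancel h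

lemma shiftedC_mulVec_ofReal (z : ℝ) (f : Conf n → ℝ) :
    (shiftedC n z).mulVec (fun s => (f s : ℂ)) = fun s => (((shiftedH n z).mulVec f s : ℝ) : ℂ) := by
  funext s
  simp [shiftedC, Matrix.mulVec, dotProduct]

/-- Ground-state representation: relative to a nowhere vanishing zero mode, the diagonal part is
eliminated by the equation for `q`, leaving a Dirichlet form with positive edge weights. It extends
positivity from the cyclic sector to the whole space. -/
lemma IsZeroMode.form (hn : n ≠ 0) (h : IsZeroMode n z q) (x y : Conf n → ℂ) :
    (fun s => q s * y s) ⬝ᵥ (shiftedC n z).mulVec (fun s => q s * x s) =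
      (1 / 2) * ∑ j, ∑ s, ((flipWeight z s j * (q s * q (flip j s)) : ℝ) : ℂ) *
        ((y s - y (flip j s)) * (x s - x (flip j s))) := by
  have h1 : (fun s => q s * y s) ⬝ᵥ (shiftedC n z).mulVec (fun s => q s * x s) =
      ∑ j, ∑ s, ((flipWeight z s j * (q s * q (flip j s)) : ℝ) : ℂ) *
        (y s * (x s - x (flip j s))) := by
    simp only [dotProduct, shiftedC_mulVec hn]
    rw [Finset.sum_comm]
    refine Finset.sum_congr rfl fun s _ => ?_
    have h2 : ((∑ j, (diagWeight z s j * q s - flipWeight z s j * q (flip j s)) : ℝ) : ℂ) = 0 := by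
      rw [← shiftedH_mulVec, h.ker]; simp
    push_cast at h2
    rw [← sub_eq_zero, Finset.mul_sum, ← Finset.sum_sub_distrib,
      ← mul_zero (q s * y s * x s : ℂ), ← h2, Finset.mul_sum]
    refine Finset.sum_congr rfl fun j _ => ?_
    push_cast; ring
  -- The edge weight is symmetric under the involution `flip j`, so averaging both forms of the sum
  -- produces the product of differences.
  have h3 : ∀ j, ∑ s, ((flipWeight z s j * (q s * q (flip j s)) : ℝ) : ℂ) *
      (y s * (x s - x (flip j s))) = ∑ s, ((flipWeight z s j * (q s * q (flip j s)) : ℝ) : ℂ) *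
      (y (flip j s) * (x (flip j s) - x s)) := fun j => by
    rw [← Equiv.sum_comp (Function.Involutive.toPerm (flip j) (flip_flip j)) fun s =>
      ((flipWeight z s j * (q s * q (flip j s)) : ℝ) : ℂ) * (y s * (x s - x (flip j s)))]
    refine Finset.sum_congr rfl fun s _ => ?_
    show ((flipWeight z (flip j s) j * (q (flip j s) * q (flip j (flip j s))) : ℝ) : ℂ) *
      (y (flip j s) * (x (flip j s) - x (flip j (flip j s)))) = _
    rw [flip_flip, flipWeight_flip hn, mul_comm (q (flip j s))]
  have h4 : (1 / 2 : ℂ) * ∑ j, ∑ s, ((flipWeight z s j * (q s * q (flip j s)) : ℝ) : ℂ) *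
        ((y s - y (flip j s)) * (x s - x (flip j s))) =
      (1 / 2) * (∑ j, ∑ s, ((flipWeight z s j * (q s * q (flip j s)) : ℝ) : ℂ) *
        (y s * (x s - x (flip j s))) + ∑ j, ∑ s, ((flipWeight z s j * (q s * q (flip j s)) : ℝ) : ℂ) *
        (y (flip j s) * (x (flip j s) - x s))) := by
    rw [← Finset.sum_add_distrib]
    congr 1
    refine Finset.sum_congr rfl fun j _ => ?_
    rw [← Finset.sum_add_distrib]
    refine Finset.sum_congr rfl fun s _ => ?_
    ring
  rw [h4, ← Finset.sum_congr rfl fun j _ => h3 j, h1]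
  ring

lemma IsZeroMode.star_form (hn : n ≠ 0) (h : IsZeroMode n z q) (x : Conf n → ℂ) :
    star (fun s => q s * x s) ⬝ᵥ (shiftedC n z).mulVec (fun s => q s * x s) =
      ((1 / 2 * ∑ j, ∑ s, flipWeight z s j * (q s * q (flip j s)) *
        Complex.normSq (x s - x (flip j s)) : ℝ) : ℂ) := by
  have h1 : star (fun s => q s * x s) = fun s => (q s : ℂ) * star (x s) := by
    funext s; simp
  rw [h1, h.form hn]
  push_cast
  congr 1
  refine Finset.sum_congr rfl fun j _ => Finset.sum_congr rfl fun s _ => ?_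
  rw [Complex.normSq_eq_conj_mul_self]
  simp

lemma IsZeroMode.eq_mul_div (h : IsZeroMode n z q) (ψ : Conf n → ℂ) :
    ψ = fun s => q s * (ψ s / q s) := by
  funext s
  have : (q s : ℂ) ≠ 0 := by exact_mod_cast h.ne_zero s
  field_simp

lemma star_dotProduct_shiftedC_nonneg (hn : n ≠ 0) (hz : z ≠ 0) (ψ : Conf n → ℂ) :
    ∃ c : ℝ, 0 ≤ c ∧ star ψ ⬝ᵥ (shiftedC n z).mulVec ψ = c := by
  obtain ⟨q, h⟩ := exists_isZeroMode hn hz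
  rw [h.eq_mul_div ψ]
  refine ⟨_, ?_, h.star_form hn _⟩
  have := Finset.sum_nonneg fun j (_ : j ∈ Finset.univ) => Finset.sum_nonneg
    fun s (_ : s ∈ Finset.univ) => mul_nonneg (h.pos s j).le
      (Complex.normSq_nonneg (ψ s / q s - ψ (flip j s) / q (flip j s)))
  positivity

lemma IsZeroMode.div_flip_eq (hn : n ≠ 0) (h : IsZeroMode n z q) {ψ : Conf n → ℂ}
    (hψ : (shiftedC n z).mulVec ψ = 0) (s : Conf n) (j : Fin (2 * n + 1)) :
    ψ (flip j s) / q (flip j s) = ψ s / q s := by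
  have h1 := h.star_form hn fun s => ψ s / q s
  rw [← h.eq_mul_div ψ, hψ, dotProduct_zero] at h1
  have h2 : ∑ j, ∑ s, flipWeight z s j * (q s * q (flip j s)) *
      Complex.normSq (ψ s / q s - ψ (flip j s) / q (flip j s)) = 0 := by
    have := Complex.ofReal_eq_zero.mp h1.symm
    linarith
  rw [Finset.sum_eq_zero_iff_of_nonneg fun j _ => Finset.sum_nonneg fun s _ =>
    mul_nonneg (h.pos s j).le (Complex.normSq_nonneg _)] at h2
  have h3 := h2 j (Finset.mem_univ j)
  rw [Finset.sum_eq_zero_iff_of_nonneg fun s _ =>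
    mul_nonneg (h.pos s j).le (Complex.normSq_nonneg _)] at h3
  have h4 := (mul_eq_zero.mp (h3 s (Finset.mem_univ s))).resolve_left (h.pos s j).ne'
  exact (sub_eq_zero.mp (Complex.normSq_eq_zero.mp h4)).symm

/-- A vanishing Dirichlet form makes `ψ / q` constant along bond flips, that is, constant on each
parity class. -/
lemma IsZeroMode.eq_of_ker (hn : n ≠ 0) (h : IsZeroMode n z q) {ψ : Conf n → ℂ}
    (hψ : (shiftedC n z).mulVec ψ = 0) : ∃ x : Fin 2 → ℂ, ∀ s, ψ s = x (parity s) * q s := by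
  refine ⟨fun a => ψ (Pi.single 0 a) / q (Pi.single 0 a), fun s => ?_⟩
  have h1 := eq_single_of_flip_invariant (x := fun s => ψ s / q s) (h.div_flip_eq hn hψ) s
  have h2 : (q s : ℂ) ≠ 0 := by exact_mod_cast h.ne_zero s
  rw [div_eq_iff h2] at h1
  exact h1

lemma parity_eq_one_iff (s : Conf n) :
    parity s = 1 ↔ Odd (Finset.univ.filter fun k => s k = 1).card := by
  rw [parity]
  induction (Finset.univ : Finset (Fin (2 * n + 1))) using Finset.induction_on with
  | empty => simp
  | insert k S hk ih =>
    rw [Finset.sum_insert hk, Finset.filter_insert]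
    by_cases h : s k = 1
    · rw [if_pos h, Finset.card_insert_of_notMem (by simp [hk]), h, Nat.odd_add_one, ← ih]
      generalize ∑ k ∈ S, s k = a
      fin_cases a <;> simp
    · rw [if_neg h, ← ih]
      have : s k = 0 := by revert h; generalize s k = a; fin_cases a <;> simp
      rw [this, zero_add]

lemma isEven_iff {ψ : Conf n → ℂ} : IsEven ψ ↔ ∀ s, parity s = 1 → ψ s = 0 :=
  forall_congr' fun s => by rw [parity_eq_one_iff]

/-- The part of a function supported on even configurations. -/
def evenPart {R : Type*} [Zero R] (f : Conf n → R) (s : Conf n) : R :=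
  if parity s = 0 then f s else 0

lemma parity_rot (s : Conf n) : parity (rot s) = parity s := sum_rot_index s

/-- A nonzero rotation-invariant even real vector spanning the even kernel. -/
structure IsEvenMode (n : ℕ) (z : ℝ) (r : Conf n → ℝ) : Prop where
  cyc : ∀ s, r (rot s) = r s
  odd : ∀ s, parity s = 1 → r s = 0
  ne_zero : r 0 ≠ 0
  ker : (shiftedH n z).mulVec r = 0
  span : ∀ ψ : Conf n → ℂ, (∀ s, parity s = 1 → ψ s = 0) → (shiftedC n z).mulVec ψ = 0 →
    ∃ c : ℂ, ∀ s, ψ s = c * r s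

lemma shiftedH_mulVec_evenPart (f : Conf n → ℝ) :
    (shiftedH n z).mulVec (evenPart f) = evenPart ((shiftedH n z).mulVec f) := by
  funext s
  simp only [shiftedH_mulVec, evenPart, parity_flip]
  split_ifs <;> simp

lemma parity_zero : parity (0 : Conf n) = 0 := by simp [parity]

lemma fin_two_ne_one {a : Fin 2} (h : a ≠ 1) : a = 0 := by revert h; fin_cases a <;> simp

lemma IsZeroMode.isEvenMode (hn : n ≠ 0) (h : IsZeroMode n z q) :
    IsEvenMode n z (evenPart q) where
  cyc s := by simp only [evenPart, parity_rot, h.cyc]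
  odd s hs := by simp [evenPart, hs]
  ne_zero := by simpa [evenPart, parity_zero] using h.ne_zero 0
  ker := by
    rw [shiftedH_mulVec_evenPart, h.ker]
    funext s
    simp [evenPart]
  span ψ h1 h2 := by
    obtain ⟨x, hx⟩ := h.eq_of_ker hn h2
    refine ⟨x 0, fun s => ?_⟩
    by_cases hs : parity s = 1
    · simp [h1 s hs, evenPart, hs]
    · have h0 := fin_two_ne_one hs
      rw [hx, evenPart, h0]; simp

/-! ### Ground states -/

lemma hasEigenvector_iff (H : Op n) (E : ℂ) (ψ : Conf n → ℂ) :
    Module.End.HasEigenvector (Matrix.toLin' H) E ψ ↔ H.mulVec ψ = E • ψ ∧ ψ ≠ 0 := by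
  rw [Module.End.hasEigenvector_iff, Module.End.mem_eigenspace_iff, Matrix.toLin'_apply]

lemma susyHamiltonian_mulVec_eq_iff (hn : n ≠ 0) (ψ : Conf n → ℂ) :
    (susyHamiltonian n z).mulVec ψ = (groundEnergy n z : ℂ) • ψ ↔
      (shiftedC n z).mulVec ψ = 0 := by
  rw [susyHamiltonian_eq_shiftedC hn, Matrix.add_mulVec, Matrix.smul_mulVec, Matrix.one_mulVec,
    add_eq_left]

lemma star_dotProduct_self_pos {ψ : Conf n → ℂ} (h : ψ ≠ 0) :
    ∃ c : ℝ, 0 < c ∧ star ψ ⬝ᵥ ψ = c := by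
  refine ⟨∑ s, Complex.normSq (ψ s), ?_, ?_⟩
  · obtain ⟨s, hs⟩ := Function.ne_iff.mp h
    exact Finset.sum_pos' (fun _ _ => Complex.normSq_nonneg _)
      ⟨s, Finset.mem_univ _, Complex.normSq_pos.mpr hs⟩
  · simp only [dotProduct, Pi.star_apply]
    push_cast
    refine Finset.sum_congr rfl fun s _ => ?_
    rw [Complex.normSq_eq_conj_mul_self]; rfl

lemma groundEnergy_le (hn : n ≠ 0) (hz : z ≠ 0) {E : ℝ} {ψ : Conf n → ℂ}
    (h : Module.End.HasEigenvector (Matrix.toLin' (susyHamiltonian n z)) (E : ℂ) ψ) :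
    groundEnergy n z ≤ E := by
  rw [hasEigenvector_iff, susyHamiltonian_eq_shiftedC hn, Matrix.add_mulVec, Matrix.smul_mulVec,
    Matrix.one_mulVec] at h
  obtain ⟨c, hc, hc'⟩ := star_dotProduct_shiftedC_nonneg hn hz ψ
  obtain ⟨d, hd, hd'⟩ := star_dotProduct_self_pos h.2
  have h1 := congrArg (fun v => star ψ ⬝ᵥ v) h.1
  simp only [dotProduct_add, dotProduct_smul, hc', hd', smul_eq_mul] at h1
  have h2 : groundEnergy n z * d + c = E * d := by exact_mod_cast h1
  by_contra! h3
  nlinarith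

lemma IsEvenMode.hasEigenvector (hn : n ≠ 0) {r : Conf n → ℝ} (h : IsEvenMode n z r) :
    Module.End.HasEigenvector (Matrix.toLin' (susyHamiltonian n z)) (groundEnergy n z : ℂ)
      fun s => (r s : ℂ) := by
  rw [hasEigenvector_iff, susyHamiltonian_mulVec_eq_iff hn, shiftedC_mulVec_ofReal, h.ker]
  refine ⟨by funext s; simp, fun h0 => h.ne_zero ?_⟩
  exact Complex.ofReal_eq_zero.mp (congrFun h0 0)

lemma isLeast_groundEnergy (hn : n ≠ 0) (hz : z ≠ 0) :
    IsLeast {E : ℝ | Module.End.HasEigenvalue (Matrix.toLin' (susyHamiltonian n z)) (E : ℂ)}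
      (groundEnergy n z) := by
  obtain ⟨q, hq⟩ := exists_isZeroMode hn hz
  refine ⟨Module.End.hasEigenvalue_of_hasEigenvector ((hq.isEvenMode hn).hasEigenvector hn), ?_⟩
  intro E hE
  obtain ⟨ψ, hψ⟩ := hE.exists_hasEigenvector
  exact groundEnergy_le hn hz hψ

lemma isGroundState_iff (hn : n ≠ 0) (hz : z ≠ 0) (ψ : Conf n → ℂ) :
    IsGroundState (susyHamiltonian n z) ψ ↔ (shiftedC n z).mulVec ψ = 0 ∧ ψ ≠ 0 := by
  rw [← susyHamiltonian_mulVec_eq_iff hn, ← hasEigenvector_iff]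
  constructor
  · rintro ⟨E, hE, h⟩
    rwa [hE.unique (isLeast_groundEnergy hn hz)] at h
  · exact fun h => ⟨_, isLeast_groundEnergy hn hz, h⟩

end ZeroMode

/-! ### Correlations in the ground states. -/

section Correlations
variable {n : ℕ} {z : ℝ} {r : Conf n → ℝ}

/-- Real expectation `∑ β(s) r(s) r(g s)` of a weighted permutation of the configurations. -/
def corr (r : Conf n → ℝ) (β : Conf n → ℝ) (g : Conf n → Conf n) : ℝ :=
  ∑ s, β s * (r s * r (g s))

lemma sum_eq_sum_even {R : Type*} [AddCommMonoid R] (F : Conf n → R) :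
    ∑ s, F s = ∑ s, if parity s = 0 then F s + F (reverse s) else 0 := by
  have h1 : ∑ s, (if parity s = 0 then F (reverse s) else 0) =
      ∑ s, if parity s = 0 then 0 else F s := by
    rw [← Equiv.sum_comp (Function.Involutive.toPerm (reverse (n := n)) reverse_reverse)
      fun s => if parity s = 0 then 0 else F s]
    refine Finset.sum_congr rfl fun s _ => ?_
    show _ = if parity (reverse s) = 0 then 0 else F (reverse s)
    rw [parity_reverse]
    generalize parity s = a
    fin_cases a <;> simp
  have h2 : ∀ s, (if parity s = 0 then F s + F (reverse s) else 0) =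
      (if parity s = 0 then F s else 0) + if parity s = 0 then F (reverse s) else 0 := fun s => by
    split_ifs <;> simp
  rw [Finset.sum_congr rfl fun s _ => h2 s, Finset.sum_add_distrib, h1, ← Finset.sum_add_distrib]
  refine Finset.sum_congr rfl fun s _ => ?_
  split_ifs <;> simp

/-- A ground state has one component per parity. An observable that preserves parity and commutes
with spin reversal has no cross terms, and reversal maps one component to a multiple of the other.
Hence its matrix element is that of the even mode times a constant independent of the observable. -/
lemma IsZeroMode.exists_corr (hn : n ≠ 0) {q : Conf n → ℝ} (h : IsZeroMode n z q)
    {ψ : Conf n → ℂ} (hψ : (shiftedC n z).mulVec ψ = 0) :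
    ∃ C : ℂ, ∀ (β : Conf n → ℝ) (g : Conf n → Conf n), (∀ s, β (reverse s) = β s) →
      (∀ s, g (reverse s) = reverse (g s)) → (∀ s, parity (g s) = parity s) →
      ∑ s, star (ψ s) * (β s * ψ (g s)) = C * (corr (evenPart q) β g : ℂ) := by
  obtain ⟨x, hx⟩ := h.eq_of_ker hn hψ
  have hrev : (shiftedC n z).mulVec (fun s => ((q (reverse s) : ℝ) : ℂ)) = 0 := by
    rw [shiftedC_mulVec_ofReal]
    funext s
    rw [shiftedH_mulVec_reverse, h.ker]; simp
  obtain ⟨y, hy⟩ := h.eq_of_ker hn hrev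
  refine ⟨star (x 0) * x 0 + star (x 1) * x 1 * y 0 ^ 2, fun β g hβ hg hp => ?_⟩
  rw [sum_eq_sum_even, corr]
  push_cast
  rw [Finset.mul_sum]
  refine Finset.sum_congr rfl fun s _ => ?_
  by_cases hs : parity s = 0
  · have h1 := hy s
    have h2 := hy (g s)
    rw [hs] at h1
    rw [hp, hs] at h2
    rw [if_pos hs, hg, hβ, hx s, hx (g s), hx (reverse s), hx (reverse (g s)), parity_reverse,
      parity_reverse, hp, hs, zero_add, h1, h2]
    have h3 : star (y 0 * (q s : ℂ)) = y 0 * q s := by rw [← h1]; simp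
    have h4 : star (x 1 * (y 0 * (q s : ℂ))) = star (x 1) * (y 0 * q s) := by
      rw [star_mul, h3, mul_comm]
    have h5 : star (x 0 * (q s : ℂ)) = star (x 0) * q s := by simp
    rw [h4, h5, evenPart, evenPart, hp, hs, if_pos rfl, if_pos rfl]
    ring
  · rw [if_neg hs, evenPart, if_neg hs]
    simp

lemma corr_rot (hr : ∀ s, r (rot s) = r s) (β : Fin (2 * n + 1) → Conf n → ℝ)
    (g : Fin (2 * n + 1) → Conf n → Conf n) (hβ : ∀ j s, β j (rot s) = β (j + 1) s)
    (hg : ∀ j s, g j (rot s) = rot (g (j + 1) s)) (j : Fin (2 * n + 1)) :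
    corr r (β j) (g j) = corr r (β 0) (g 0) := by
  refine eq_of_add_one (F := fun j => corr r (β j) (g j)) (fun j => ?_) j
  simp only [corr]
  rw [← sum_rot fun s => β j s * (r s * r (g j s))]
  simp only [hβ, hg, hr]

/-- The product of the signs of two neighbouring spins. -/
def bondSign (j : Fin (2 * n + 1)) (s : Conf n) : ℝ := spinSign (s j) * spinSign (s (j + 1))

lemma bondSign_reverse (j : Fin (2 * n + 1)) (s : Conf n) :
    bondSign j (reverse s) = bondSign j s := by
  simp [bondSign, reverse, spinSign_add_one]

/-- Unnormalized correlations of a rotation-invariant real vector. -/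
def corrX (r : Conf n → ℝ) : ℝ := corr r 1 (flip 0)
def corrY (r : Conf n → ℝ) : ℝ := corr r (fun s => -bondSign 0 s) (flip 0)
def corrZ (r : Conf n → ℝ) : ℝ := corr r (bondSign 0) id
def sqNorm (r : Conf n → ℝ) : ℝ := corr r 1 id

lemma corrX_eq (hr : ∀ s, r (rot s) = r s) (j : Fin (2 * n + 1)) :
    corr r 1 (flip j) = corrX r :=
  corr_rot hr (fun _ => 1) flip (fun _ _ => rfl) flip_rot j

lemma corrY_eq (hr : ∀ s, r (rot s) = r s) (j : Fin (2 * n + 1)) :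
    corr r (fun s => -bondSign j s) (flip j) = corrY r :=
  corr_rot hr (fun j s => -bondSign j s) flip (fun _ _ => rfl) flip_rot j

lemma corrZ_eq (hr : ∀ s, r (rot s) = r s) (j : Fin (2 * n + 1)) :
    corr r (bondSign j) id = corrZ r :=
  corr_rot hr bondSign (fun _ => id) (fun _ _ => rfl) (fun _ _ => rfl) j

lemma sqNorm_pos (h : r 0 ≠ 0) : 0 < sqNorm r :=
  Finset.sum_pos' (fun s _ => by simpa using mul_self_nonneg (r s))
    ⟨0, Finset.mem_univ _, by simpa using mul_self_pos.mpr h⟩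

/-- The coupling `x` is independent of the vector, so that the energy of a fixed ground state can be
varied in the coupling. -/
lemma shiftedH_form (hr : ∀ s, r (rot s) = r s) (x : ℝ) :
    r ⬝ᵥ (shiftedH n x).mulVec r = (2 * n + 1) * ((x ^ 2 + 3) / 4 * sqNorm r -
      (x ^ 2 - 1) / 4 * corrZ r - (1 + x) / 2 * corrX r - (1 - x) / 2 * corrY r) := by
  have h : ∀ j : Fin (2 * n + 1), (x ^ 2 + 3) / 4 * sqNorm r -
      (x ^ 2 - 1) / 4 * corrZ r - (1 + x) / 2 * corrX r - (1 - x) / 2 * corrY r =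
      ∑ s, r s * (diagWeight x s j * r s - flipWeight x s j * r (flip j s)) := fun j => by
    rw [← corrX_eq hr j, ← corrY_eq hr j, ← corrZ_eq hr j, sqNorm]
    simp only [corr, Finset.mul_sum, ← Finset.sum_sub_distrib]
    refine Finset.sum_congr rfl fun s _ => ?_
    rw [diagWeight, flipWeight, bondSign, spinSign_mul]
    split_ifs <;> simp <;> ring
  simp only [dotProduct, shiftedH_mulVec, Finset.mul_sum]
  rw [Finset.sum_comm, Finset.sum_congr rfl fun j _ => (Finset.sum_congr rfl fun s _ => rfl).trans
    (h j).symm, Finset.sum_const, Finset.card_univ, Fintype.card_fin, nsmul_eq_mul]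
  push_cast; rfl

lemma IsEvenMode.corr_energy (h : IsEvenMode n z r) :
    (1 + z) * corrX r + (1 - z) * corrY r + (z ^ 2 - 1) / 2 * corrZ r =
      (z ^ 2 + 3) / 2 * sqNorm r := by
  have h1 := shiftedH_form h.cyc z
  rw [h.ker, dotProduct_zero, eq_comm, mul_eq_zero] at h1
  have := h1.resolve_left (by positivity)
  linarith

/-- The lowest energy is known exactly at every nonzero coupling. The energy of the fixed vector `r`
at coupling `z + t`, shifted by it, is therefore nonnegative and vanishes at `t = 0`, so its linear
coefficient is 0. -/
lemma IsEvenMode.corr_stationary (hn : n ≠ 0) (hz : z ≠ 0) (h : IsEvenMode n z r) :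
    corrX r - corrY r + z * corrZ r = z * sqNorm r := by
  set A := (z / 2 * sqNorm r - z / 2 * corrZ r - 1 / 2 * corrX r + 1 / 2 * corrY r) with hA
  set B := (sqNorm r - corrZ r) / 4 with hB
  have hN : (0 : ℝ) < 2 * n + 1 := by positivity
  have key : ∀ t : ℝ, z + t ≠ 0 → 0 ≤ t * A + t ^ 2 * B := by
    intro t ht
    obtain ⟨c, hc, hc'⟩ := star_dotProduct_shiftedC_nonneg hn ht fun s => (r s : ℂ)
    have h1 : star (fun s => (r s : ℂ)) ⬝ᵥ (shiftedC n (z + t)).mulVec (fun s => (r s : ℂ)) =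
        ((r ⬝ᵥ (shiftedH n (z + t)).mulVec r : ℝ) : ℂ) := by
      rw [shiftedC_mulVec_ofReal]
      simp [dotProduct]
    rw [h1] at hc'
    have h2 : r ⬝ᵥ (shiftedH n (z + t)).mulVec r = c := by exact_mod_cast hc'
    rw [← h2, shiftedH_form h.cyc] at hc
    have h3 := h.corr_energy
    have h4 := nonneg_of_mul_nonneg_right hc hN
    rw [hA, hB]
    linarith
  have hA0 : A = 0 := by
    by_contra hA0
    -- With `t = -εA`, the bound on `ε|B|` makes `tA + t²B` negative and the bound on `ε|A|` keeps
    -- `z + t` away from 0.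
    obtain ⟨ε, hε, hε1, hε2⟩ : ∃ ε : ℝ, 0 < ε ∧ ε * |B| < 1 ∧ ε * |A| < |z| := by
      refine ⟨min 1 |z| / (2 * (|A| + |B| + 1)), ?_, ?_, ?_⟩
      · have := abs_pos.mpr hz
        have : 0 < min 1 |z| := lt_min one_pos this
        positivity
      · rw [div_mul_eq_mul_div, div_lt_one (by positivity)]
        nlinarith [min_le_left 1 |z|, abs_nonneg A, abs_nonneg B]
      · rw [div_mul_eq_mul_div, div_lt_iff₀ (by positivity)]
        nlinarith [min_le_right 1 |z|, abs_nonneg A, abs_nonneg B, abs_pos.mpr hz]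
    have h1 := key (-(ε * A)) fun h0 => by
      have : |z| = ε * |A| := by
        rw [show z = ε * A by linarith, abs_mul, abs_of_pos hε]
      linarith
    have h2 : -(ε * A) * A + (-(ε * A)) ^ 2 * B = ε * A ^ 2 * (ε * B - 1) := by ring
    rw [h2] at h1
    have h3 : 0 < ε * A ^ 2 := by positivity
    have h4 := nonneg_of_mul_nonneg_right h1 h3
    have h5 := mul_le_mul_of_nonneg_left (le_abs_self B) hε.le
    linarith
  linarith

/-- The correlation quantity of a real vector. -/
def corrQuantity (z : ℝ) (r : Conf n → ℝ) : ℝ := (1 - corrZ r / sqNorm r) * (z ^ 2 + 3) / 4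

lemma star_dotProduct_bondX (ψ : Conf n → ℂ) (j : Fin (2 * n + 1)) :
    star ψ ⬝ᵥ (bond sigmaX j).mulVec ψ =
      ∑ s, star (ψ s) * (((1 : Conf n → ℝ) s : ℝ) * ψ (flip j s)) := by
  simp [dotProduct, bond_sigmaX_mulVec]

lemma star_dotProduct_bondY (hn : n ≠ 0) (ψ : Conf n → ℂ) (j : Fin (2 * n + 1)) :
    star ψ ⬝ᵥ (bond sigmaY j).mulVec ψ =
      ∑ s, star (ψ s) * ((-bondSign j s : ℝ) * ψ (flip j s)) := by
  simp [dotProduct, bond_sigmaY_mulVec hn, bondSign]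

lemma star_dotProduct_bondZ (ψ : Conf n → ℂ) (j : Fin (2 * n + 1)) :
    star ψ ⬝ᵥ (bond sigmaZ j).mulVec ψ = ∑ s, star (ψ s) * ((bondSign j s : ℝ) * ψ (id s)) := by
  simp [dotProduct, bond_sigmaZ_mulVec, bondSign]

lemma star_dotProduct_self (ψ : Conf n → ℂ) :
    star ψ ⬝ᵥ ψ = ∑ s, star (ψ s) * (((1 : Conf n → ℝ) s : ℝ) * ψ (id s)) := by
  simp [dotProduct]

lemma expectation_ground (hn : n ≠ 0) {q : Conf n → ℝ} (h : IsZeroMode n z q)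
    {ψ : Conf n → ℂ} (hψ : (shiftedC n z).mulVec ψ = 0) (h0 : ψ ≠ 0) (j : Fin (2 * n + 1)) :
    expectation ψ (bond sigmaX j) = (corrX (evenPart q) / sqNorm (evenPart q) : ℝ) ∧
    expectation ψ (bond sigmaY j) = (corrY (evenPart q) / sqNorm (evenPart q) : ℝ) ∧
    expectation ψ (bond sigmaZ j) = (corrZ (evenPart q) / sqNorm (evenPart q) : ℝ) := by
  obtain ⟨C, hC⟩ := h.exists_corr hn hψ
  have hr := (h.isEvenMode hn).cyc
  have hN := star_dotProduct_self ψ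
  rw [hC 1 id (fun _ => rfl) (fun _ => rfl) fun _ => rfl] at hN
  have hC0 : C ≠ 0 := by
    rintro rfl
    obtain ⟨c, hc, hc'⟩ := star_dotProduct_self_pos h0
    rw [hN, zero_mul] at hc'
    exact hc.ne (by exact_mod_cast hc')
  have hX := star_dotProduct_bondX ψ j
  rw [hC 1 (flip j) (fun _ => rfl) (fun _ => flip_reverse _ _) fun _ => parity_flip _ _,
    corrX_eq hr] at hX
  have hY := star_dotProduct_bondY hn ψ j
  rw [hC (fun s => -bondSign j s) (flip j) (fun _ => by rw [bondSign_reverse])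
    (fun _ => flip_reverse _ _) fun _ => parity_flip _ _, corrY_eq hr] at hY
  have hZ := star_dotProduct_bondZ ψ j
  rw [hC (bondSign j) id (bondSign_reverse j) (fun _ => rfl) fun _ => rfl, corrZ_eq hr] at hZ
  have hdiv : ∀ a : ℝ, C * a / (C * (corr (evenPart q) 1 id : ℝ)) =
      ((a / sqNorm (evenPart q) : ℝ) : ℂ) := fun a => by
    rw [mul_div_mul_left _ _ hC0, sqNorm]; push_cast; rfl
  refine ⟨?_, ?_, ?_⟩
  · rw [expectation, hX, hN, hdiv]
  · rw [expectation, hY, hN, hdiv]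
  · rw [expectation, hZ, hN, hdiv]

/-- Uniqueness comes from `C^z` alone. For existence, the energy and stationarity relations are
solved for `C^x` and `C^y` in terms of `C^z`. -/
lemma isCorrelationQuantity_iff (hn : n ≠ 0) (hz : z ≠ 0) {q : Conf n → ℝ}
    (h : IsZeroMode n z q) (f : ℂ) :
    IsCorrelationQuantity n z f ↔ f = (corrQuantity z (evenPart q) : ℝ) := by
  have hr := h.isEvenMode hn
  have hN := sqNorm_pos hr.ne_zero
  have h3 : (z ^ 2 + 3) ≠ 0 := by positivity
  have h3c : ((z : ℂ) ^ 2 + 3) ≠ 0 := by exact_mod_cast h3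
  have hE := hr.corr_energy
  have hS := hr.corr_stationary hn hz
  constructor
  · intro hf
    have h1 := (hf _ ⟨_, isLeast_groundEnergy hn hz, hr.hasEigenvector hn⟩ 0).2.2
    have h2 := (isGroundState_iff hn hz _).mp ⟨_, isLeast_groundEnergy hn hz, hr.hasEigenvector hn⟩
    rw [(expectation_ground hn h h2.1 h2.2 0).2.2] at h1
    rw [corrQuantity]
    push_cast at h1 ⊢
    rw [h1]
    field_simp
    ring
  · rintro rfl ψ hψ j
    rw [isGroundState_iff hn hz] at hψ
    obtain ⟨hX, hY, hZ⟩ := expectation_ground hn h hψ.1 hψ.2 j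
    rw [hX, hY, hZ]
    set X := corrX (evenPart q)
    set Y := corrY (evenPart q)
    set Z := corrZ (evenPart q)
    set N := sqNorm (evenPart q)
    have e1 : X / N = 1 - (1 - z) ^ 2 * ((1 - Z / N) * (z ^ 2 + 3) / 4) / (z ^ 2 + 3) := by
      field_simp
      linear_combination 2 * hE + (2 - 2 * z) * hS
    have e2 : Y / N = 1 - (1 + z) ^ 2 * ((1 - Z / N) * (z ^ 2 + 3) / 4) / (z ^ 2 + 3) := by
      field_simp
      linear_combination 2 * hE - (2 + 2 * z) * hS
    have e3 : Z / N = 1 - 4 * ((1 - Z / N) * (z ^ 2 + 3) / 4) / (z ^ 2 + 3) := by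
      field_simp
      ring
    refine ⟨?_, ?_, ?_⟩
    · rw [e1, corrQuantity]; push_cast; rfl
    · rw [e2, corrQuantity]; push_cast; rfl
    · conv_lhs => rw [e3]
      rw [corrQuantity]; push_cast; rfl

end Correlations

/-! ### The local commutation relation of the eight-vertex model -/

lemma rMatrix_apply (a b c d : ℂ) (α s β t : Fin 2) :
    rMatrix a b c d (α, s) (β, t) =
      if α = s then (if β = t then (if α = β then a else d) else 0)
      else (if β = t then 0 else (if α = β then b else c)) := by
  fin_cases α <;> fin_cases s <;> fin_cases β <;> fin_cases t <;> rfl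

/-- The block of an `R`-matrix with given auxiliary indices. -/
def blk (R : Matrix (Fin 2 × Fin 2) (Fin 2 × Fin 2) ℂ) (α β : Fin 2) : Matrix (Fin 2) (Fin 2) ℂ :=
  Matrix.of fun s t => R (α, s) (β, t)

/-- The coupling constants of the Hamiltonian commuting with the transfer matrix. -/
def coupling (a b c d : ℂ) : Fin 3 → ℂ :=
  ![a * b + c * d, a * b - c * d, (a ^ 2 + b ^ 2 - c ^ 2 - d ^ 2) / 2]

/-- The Pauli matrices. -/
def pauli : Fin 3 → Matrix (Fin 2) (Fin 2) ℂ := ![sigmaX, sigmaY, sigmaZ]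

/-- The matrix through which the commutator of two `R`-matrices with a bond Hamiltonian is
expressed as a difference. -/
def sutherland (a b c d : ℂ) : Matrix (Fin 2 × Fin 2) (Fin 2 × Fin 2) ℂ :=
  rMatrix 0 (2 * b * (c ^ 2 - d ^ 2)) (c * (c ^ 2 - d ^ 2 + b ^ 2 - a ^ 2))
    (d * (c ^ 2 - d ^ 2 - b ^ 2 + a ^ 2))

set_option maxHeartbeats 4000000 in
-- Sutherland's condition, a polynomial identity in the four weights checked on all 64 index values.
-- Its right side is a difference of one expression at neighbouring sites, so it telescopes around
-- the ring.
lemma sutherland_relation (a b c d : ℂ) (α γ s₁ t₁ s₂ t₂ : Fin 2) :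
    ∑ β, (∑ i, coupling a b c d i *
        ((pauli i * blk (rMatrix a b c d) α β) s₁ t₁ * (pauli i * blk (rMatrix a b c d) β γ) s₂ t₂ -
          (blk (rMatrix a b c d) α β * pauli i) s₁ t₁ *
            (blk (rMatrix a b c d) β γ * pauli i) s₂ t₂)) =
      ∑ β, (blk (rMatrix a b c d) α β s₁ t₁ * blk (sutherland a b c d) β γ s₂ t₂ -
        blk (sutherland a b c d) α β s₁ t₁ * blk (rMatrix a b c d) β γ s₂ t₂) := by
  have hI := Complex.I_sq
  simp only [Fin.sum_univ_two, Fin.sum_univ_three, Matrix.mul_apply, blk, Matrix.of_apply,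
    sutherland, rMatrix_apply, coupling, pauli, Matrix.cons_val_zero, Matrix.cons_val_one,
    Matrix.cons_val, sigmaX, sigmaY, sigmaZ]
  fin_cases α <;> fin_cases γ <;> fin_cases s₁ <;> fin_cases t₁ <;> fin_cases s₂ <;>
    fin_cases t₂ <;> simp <;> ring_nf <;> (try rw [hI]) <;> ring

section Transfer
variable {n : ℕ}

/-! ### The transfer matrix as a sum over closed auxiliary paths -/

lemma ofFn_prod_apply {I : Type*} [Fintype I] [DecidableEq I] {m : ℕ}
    (M : Fin (m + 1) → Matrix I I ℂ) (x y : I) :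
    (List.ofFn M).prod x y = ∑ p : Fin m → I, ∏ j : Fin (m + 1),
      M j ((Fin.cons x p : Fin (m + 1) → I) j) ((Fin.snoc p y : Fin (m + 1) → I) j) := by
  induction m generalizing x with
  | zero => simp [List.ofFn_succ, Fin.snoc]
  | succ m ih =>
    rw [List.ofFn_succ, List.prod_cons, Matrix.mul_apply,
      ← (Fin.consEquiv fun _ : Fin (m + 1) => I).sum_comp, Fintype.sum_prod_type]
    refine Finset.sum_congr rfl fun z _ => ?_
    rw [ih, Finset.mul_sum]
    refine Finset.sum_congr rfl fun p _ => ?_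
    have e : (Fin.consEquiv fun _ : Fin (m + 1) => I) (z, p) = (Fin.cons z p : Fin (m + 1) → I) :=
      rfl
    rw [e, ← Fin.cons_snoc_eq_snoc_cons, Fin.prod_univ_succ (n := m + 1)]
    simp only [Fin.cons_zero, Fin.cons_succ]

lemma sum_ofFn_prod_apply {I : Type*} [Fintype I] [DecidableEq I] {m : ℕ}
    (M : Fin (m + 1) → Matrix I I ℂ) :
    ∑ x, (List.ofFn M).prod x x = ∑ α : Fin (m + 1) → I, ∏ j, M j (α j) (α (j + 1)) := by
  rw [← (Fin.consEquiv fun _ : Fin (m + 1) => I).sum_comp, Fintype.sum_prod_type]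
  refine Finset.sum_congr rfl fun x _ => ?_
  rw [ofFn_prod_apply]
  refine Finset.sum_congr rfl fun p _ => Finset.prod_congr rfl fun j _ => ?_
  simp only [Fin.consEquiv_apply]
  congr 1
  refine Fin.lastCases ?_ (fun i => ?_) j
  · simp
  · rw [Fin.coeSucc_eq_succ]; simp

lemma prod_rSite_apply (R : Matrix (Fin 2 × Fin 2) (Fin 2 × Fin 2) ℂ)
    (l : List (Fin (2 * n + 1))) (hl : l.Nodup) (α β : Fin 2) (s t : Conf n) :
    (l.map (rSite R)).prod (α, s) (β, t) = if ∀ k, k ∉ l → s k = t k then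
      (l.map fun j => Matrix.of fun x y => R (x, s j) (y, t j)).prod α β else 0 := by
  induction l generalizing α s with
  | nil =>
    by_cases h : s = t
    · simp [h, Matrix.one_apply]
    · have h' : ¬ ∀ k, s k = t k := fun h' => h (funext h')
      simp [h, h']
  | cons j l ih =>
    rw [List.nodup_cons] at hl
    rw [List.map_cons, List.prod_cons, Matrix.mul_apply, Fintype.sum_prod_type, List.map_cons,
      List.prod_cons, Matrix.mul_apply]
    simp only [ih hl.2]
    by_cases h : ∀ k, k ∉ j :: l → s k = t k
    · rw [if_pos h]
      refine Finset.sum_congr rfl fun γ _ => ?_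
      rw [Finset.sum_eq_single (Function.update s j (t j))]
      · have h1 : ∀ k, k ≠ j → s k = Function.update s j (t j) k := fun k hk => by simp [hk]
        have h2 : ∀ k, k ∉ l → Function.update s j (t j) k = t k := fun k hk => by
          by_cases hkj : k = j
          · subst hkj; simp
          · rw [Function.update_of_ne hkj]; exact h k (by simp [hk, hkj])
        rw [if_pos h2]
        simp only [rSite, Matrix.of_apply]
        rw [if_pos h1, Function.update_self]
        rw [List.map_congr_left (g := fun j => Matrix.of fun x y => R (x, s j) (y, t j))
          fun k hk => ?_]
        have : k ≠ j := fun hkj => hl.1 (hkj ▸ hk)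
        rw [Function.update_of_ne this]
      · intro w _ hw
        by_cases h3 : ∀ k, k ∉ l → w k = t k
        · have : ¬ ∀ k, k ≠ j → s k = w k := fun h4 => hw (funext fun k => by
            by_cases hkj : k = j
            · subst hkj; rw [Function.update_self, h3 k hl.1]
            · rw [Function.update_of_ne hkj, h4 k hkj])
          simp only [rSite, Matrix.of_apply]
          rw [if_neg this, zero_mul]
        · rw [if_neg h3, mul_zero]
      · simp
    · rw [if_neg h]
      refine Finset.sum_eq_zero fun γ _ => Finset.sum_eq_zero fun w _ => ?_
      by_cases h3 : ∀ k, k ∉ l → w k = t k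
      · have : ¬ ∀ k, k ≠ j → s k = w k := fun h4 => h fun k hk => by
          rw [List.mem_cons, not_or] at hk
          rw [h4 k hk.1, h3 k hk.2]
        simp only [rSite, Matrix.of_apply]
        rw [if_neg this, zero_mul]
      · rw [if_neg h3, mul_zero]

/-- The sum over closed auxiliary paths of the products of the blocks of `R`. -/
def pathSum (n : ℕ) (R : Matrix (Fin 2 × Fin 2) (Fin 2 × Fin 2) ℂ) : Op n :=
  ∑ α : Conf n, tens fun j => blk R (α j) (α (j + 1))

/-- The `R`-matrix of the eight-vertex model. -/
def thetaR (u η τ : ℂ) : Matrix (Fin 2 × Fin 2) (Fin 2 × Fin 2) ℂ :=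
  rMatrix (weightA u η τ) (weightB u η τ) (weightC u η τ) (weightD u η τ)

lemma transfer_eq_pathSum (u η τ : ℂ) : transfer n u η τ = pathSum n (thetaR u η τ) := by
  ext s t
  simp only [transfer, Matrix.of_apply, pathSum, Matrix.sum_apply, tens_apply]
  refine Eq.trans ?_
    (sum_ofFn_prod_apply fun j => Matrix.of fun x y => thetaR u η τ (x, s j) (y, t j))
  refine Finset.sum_congr rfl fun α _ => ?_
  rw [List.ofFn_eq_map, List.ofFn_eq_map, prod_rSite_apply _ _ (List.nodup_finRange _)]
  simp [thetaR]

/-! ### Commutation with the Hamiltonian -/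

lemma sum_update {R : Type*} [CommRing R] (F : Conf n → R) (i : Fin (2 * n + 1)) :
    ∑ α, ∑ β, F (Function.update α i β) = 2 * ∑ α, F α := by
  have h : ∀ α : Conf n, ∑ β, F (Function.update α i β) =
      F α + F (α + Pi.single i 1) := fun α => by
    have h1 : F α = F (Function.update α i (α i)) := by rw [Function.update_eq_self]
    rw [← update_add_one, h1, Fin.sum_univ_two]
    generalize α i = a
    fin_cases a
    · simp
    · simp [add_comm]
  have h2 : ∑ α, F (α + Pi.single i 1) = ∑ α, F α :=
    Equiv.sum_comp (Function.Involutive.toPerm (fun α : Conf n => α + Pi.single i 1)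
      fun α => by simp only [add_assoc, conf_add_self, add_zero]) F
  rw [Finset.sum_congr rfl fun α _ => h α, Finset.sum_add_distrib, h2]
  ring

/-- Inserts a two-site identity into a path sum: the auxiliary index between the two sites occurs
nowhere else, so it may be summed first. -/
lemma sum_path_congr (hn : n ≠ 0) {C : Conf n → ℂ} {l l' : Fin 2 → Fin 2 → Fin 2 → ℂ}
    (j : Fin (2 * n + 1)) (hC : ∀ α β, C (Function.update α (j + 1) β) = C α)
    (hl : ∀ x y, ∑ β, l x β y = ∑ β, l' x β y) :
    ∑ α : Conf n, C α * l (α j) (α (j + 1)) (α (j + 1 + 1)) =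
      ∑ α : Conf n, C α * l' (α j) (α (j + 1)) (α (j + 1 + 1)) := by
  have h : ∀ l : Fin 2 → Fin 2 → Fin 2 → ℂ,
      2 * ∑ α : Conf n, C α * l (α j) (α (j + 1)) (α (j + 1 + 1)) =
        ∑ α : Conf n, C α * ∑ β, l (α j) β (α (j + 1 + 1)) := fun l => by
    rw [← sum_update _ (j + 1)]
    refine Finset.sum_congr rfl fun α _ => ?_
    rw [Finset.mul_sum]
    refine Finset.sum_congr rfl fun β _ => ?_
    rw [hC, Function.update_self, Function.update_of_ne (add_one_ne hn j).symm,
      Function.update_of_ne (add_one_ne hn (j + 1))]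
  refine mul_left_cancel₀ two_ne_zero ?_
  rw [h, h]
  simp only [hl]

lemma prod_eq_mul_rest (hn : n ≠ 0) (H : Fin (2 * n + 1) → ℂ) (j : Fin (2 * n + 1)) :
    ∏ k, H k = (∏ k ∈ (Finset.univ.erase j).erase (j + 1), H k) * (H j * H (j + 1)) := by
  rw [← Finset.mul_prod_erase Finset.univ H (Finset.mem_univ j),
    ← Finset.mul_prod_erase (Finset.univ.erase j) H
      (Finset.mem_erase.mpr ⟨add_one_ne hn j, Finset.mem_univ _⟩)]
  ring

lemma tens_apply_eq (hn : n ≠ 0) {A B : Fin (2 * n + 1) → Matrix (Fin 2) (Fin 2) ℂ}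
    (j : Fin (2 * n + 1)) (h : ∀ k, k ≠ j → k ≠ j + 1 → A k = B k) (s t : Conf n) :
    tens A s t = (∏ k ∈ (Finset.univ.erase j).erase (j + 1), B k (s k) (t k)) *
      (A j (s j) (t j) * A (j + 1) (s (j + 1)) (t (j + 1))) := by
  rw [tens_apply, prod_eq_mul_rest hn _ j]
  congr 1
  refine Finset.prod_congr rfl fun k hk => ?_
  rw [Finset.mem_erase, Finset.mem_erase] at hk
  rw [h k hk.2.1 hk.1]

/-- The path sum with `R` replaced by `Q` at one site. -/
def pathSumAt (R Q : Matrix (Fin 2 × Fin 2) (Fin 2 × Fin 2) ℂ) (j : Fin (2 * n + 1)) : Op n :=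
  ∑ α : Conf n, tens (Function.update (fun k => blk R (α k) (α (k + 1))) j
    (blk Q (α j) (α (j + 1))))

lemma bond_commutator (hn : n ≠ 0) (a b c d : ℂ) (j : Fin (2 * n + 1)) :
    ∑ i, coupling a b c d i • (bond (pauli i) j * pathSum n (rMatrix a b c d) -
        pathSum n (rMatrix a b c d) * bond (pauli i) j) =
      pathSumAt (rMatrix a b c d) (sutherland a b c d) (j + 1) -
        pathSumAt (rMatrix a b c d) (sutherland a b c d) j := by
  have hj := add_one_ne hn j
  set R := rMatrix a b c d with hR
  ext s t
  have key := sum_path_congr hn j (C := fun α =>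
      ∏ k ∈ (Finset.univ.erase j).erase (j + 1), blk R (α k) (α (k + 1)) (s k) (t k))
    (fun α β => Finset.prod_congr rfl fun k hk => by
      rw [Finset.mem_erase, Finset.mem_erase] at hk
      rw [Function.update_of_ne hk.1, Function.update_of_ne (fun h => hk.2.1 (add_right_cancel h))])
    (fun x y => sutherland_relation a b c d x y (s j) (t j) (s (j + 1)) (t (j + 1)))
  rw [← hR] at key
  simp only [Matrix.sum_apply, Matrix.smul_apply, Matrix.sub_apply, smul_eq_mul, pathSum,
    pathSumAt, Finset.mul_sum, Finset.sum_mul, bond_eq_tens, ← tens_mul]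
  have h1 : ∀ (α : Conf n) (i : Fin 3), tens ((Pi.mulSingle j (pauli i) *
      Pi.mulSingle (j + 1) (pauli i)) * fun k => blk R (α k) (α (k + 1))) s t =
      (∏ k ∈ (Finset.univ.erase j).erase (j + 1), blk R (α k) (α (k + 1)) (s k) (t k)) *
        ((pauli i * blk R (α j) (α (j + 1))) (s j) (t j) *
          (pauli i * blk R (α (j + 1)) (α (j + 1 + 1))) (s (j + 1)) (t (j + 1))) := by
    intro α i
    rw [tens_apply_eq hn (B := fun k => blk R (α k) (α (k + 1))) j fun k h1 h2 => by
      simp [Pi.mulSingle_eq_of_ne h1, Pi.mulSingle_eq_of_ne h2]]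
    simp [Pi.mulSingle_eq_of_ne hj, Pi.mulSingle_eq_of_ne hj.symm]
  have h2 : ∀ (α : Conf n) (i : Fin 3), tens ((fun k => blk R (α k) (α (k + 1))) *
      (Pi.mulSingle j (pauli i) * Pi.mulSingle (j + 1) (pauli i))) s t =
      (∏ k ∈ (Finset.univ.erase j).erase (j + 1), blk R (α k) (α (k + 1)) (s k) (t k)) *
        ((blk R (α j) (α (j + 1)) * pauli i) (s j) (t j) *
          (blk R (α (j + 1)) (α (j + 1 + 1)) * pauli i) (s (j + 1)) (t (j + 1))) := by
    intro α i
    rw [tens_apply_eq hn (B := fun k => blk R (α k) (α (k + 1))) j fun k h1 h2 => by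
      simp [Pi.mulSingle_eq_of_ne h1, Pi.mulSingle_eq_of_ne h2]]
    simp [Pi.mulSingle_eq_of_ne hj, Pi.mulSingle_eq_of_ne hj.symm]
  have h3 : ∀ α : Conf n, tens (Function.update (fun k => blk R (α k) (α (k + 1))) (j + 1)
      (blk (sutherland a b c d) (α (j + 1)) (α (j + 1 + 1)))) s t =
      (∏ k ∈ (Finset.univ.erase j).erase (j + 1), blk R (α k) (α (k + 1)) (s k) (t k)) *
        (blk R (α j) (α (j + 1)) (s j) (t j) *
          blk (sutherland a b c d) (α (j + 1)) (α (j + 1 + 1)) (s (j + 1)) (t (j + 1))) := by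
    intro α
    rw [tens_apply_eq hn (B := fun k => blk R (α k) (α (k + 1))) j fun k h1 h2 => by
      rw [Function.update_of_ne h2]]
    rw [Function.update_self, Function.update_of_ne hj.symm]
  have h4 : ∀ α : Conf n, tens (Function.update (fun k => blk R (α k) (α (k + 1))) j
      (blk (sutherland a b c d) (α j) (α (j + 1)))) s t =
      (∏ k ∈ (Finset.univ.erase j).erase (j + 1), blk R (α k) (α (k + 1)) (s k) (t k)) *
        (blk (sutherland a b c d) (α j) (α (j + 1)) (s j) (t j) *
          blk R (α (j + 1)) (α (j + 1 + 1)) (s (j + 1)) (t (j + 1))) := by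
    intro α
    rw [tens_apply_eq hn (B := fun k => blk R (α k) (α (k + 1))) j fun k h1 h2 => by
      rw [Function.update_of_ne h1]]
    rw [Function.update_self, Function.update_of_ne hj]
  simp only [h1, h2, h3, h4]
  rw [← Finset.sum_sub_distrib]
  simp only [← mul_sub]
  rw [← key]
  simp only [← Finset.sum_sub_distrib, ← mul_sub, Finset.mul_sum]
  rw [Finset.sum_comm]
  refine Finset.sum_congr rfl fun α _ => Finset.sum_congr rfl fun i _ => ?_
  ring

lemma hamiltonian_eq_sum_pauli (J : Fin 3 → ℂ) :
    hamiltonian n (J 0) (J 1) (J 2) = -(1 / 2 : ℂ) • ∑ j, ∑ i, J i • bond (pauli i) j := by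
  rw [hamiltonian]
  simp only [Fin.sum_univ_three]
  rfl

lemma hamiltonian_mul_pathSum (hn : n ≠ 0) (a b c d : ℂ) :
    hamiltonian n (coupling a b c d 0) (coupling a b c d 1) (coupling a b c d 2) *
        pathSum n (rMatrix a b c d) =
      pathSum n (rMatrix a b c d) *
        hamiltonian n (coupling a b c d 0) (coupling a b c d 1) (coupling a b c d 2) := by
  rw [← sub_eq_zero, hamiltonian_eq_sum_pauli, Matrix.smul_mul, Matrix.mul_smul, ← smul_sub,
    Finset.sum_mul, Finset.mul_sum, ← Finset.sum_sub_distrib]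
  have h : ∀ j : Fin (2 * n + 1), (∑ i, coupling a b c d i • bond (pauli i) j) *
      pathSum n (rMatrix a b c d) - pathSum n (rMatrix a b c d) *
      ∑ i, coupling a b c d i • bond (pauli i) j =
      pathSumAt (rMatrix a b c d) (sutherland a b c d) (j + 1) -
        pathSumAt (rMatrix a b c d) (sutherland a b c d) j := fun j => by
    rw [← bond_commutator hn, Finset.sum_mul, Finset.mul_sum, ← Finset.sum_sub_distrib]
    refine Finset.sum_congr rfl fun i _ => ?_
    rw [Matrix.smul_mul, Matrix.mul_smul, smul_sub]
  rw [Finset.sum_congr rfl fun j _ => h j, Finset.sum_sub_distrib, sum_rot_index, sub_self,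
    smul_zero]

end Transfer

section PauliExpansion
variable {n : ℕ}

/-! ### Expansion of the transfer matrix in products of Pauli matrices -/

/-- The identity and the Pauli matrices. -/
def sig : Fin 4 → Matrix (Fin 2) (Fin 2) ℂ := ![1, sigmaX, sigmaY, sigmaZ]

/-- The coefficients of an eight-vertex `R`-matrix in products of Pauli matrices. -/
def pauliWeight (a b c d : ℂ) : Fin 4 → ℂ := ![(a + c) / 2, (b + d) / 2, (b - d) / 2, (a - c) / 2]

/-- The crossed indices split off a permutation. What remains is expanded in `σ ⊗ σ`, so that at `u
= η` only the identity coefficient is nonzero. -/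
lemma blk_rMatrix (a b c d : ℂ) (α β s t : Fin 2) :
    blk (rMatrix a b c d) α β s t = ∑ x, pauliWeight a b c d x * (sig x α t * sig x s β) := by
  rw [blk, Matrix.of_apply, rMatrix_apply]
  have hI := Complex.I_mul_I
  fin_cases α <;> fin_cases β <;> fin_cases s <;> fin_cases t <;>
    simp [Fin.sum_univ_four, pauliWeight, sig, sigmaX, sigmaY, sigmaZ, hI] <;> ring

/-- The product operator attached to an assignment of Pauli matrices to the auxiliary bonds. -/
def pauliString (a : Fin (2 * n + 1) → Fin 4) : Op n :=
  tens fun k => sig (a (k - 1)) * sig (a k)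

/-- The permutations of all sites combine into one cyclic shift, which is absorbed into `rot s`.
Each Pauli label then acts at two neighbouring sites. -/
lemma pathSum_rot_apply (a b c d : ℂ) (s t : Conf n) :
    pathSum n (rMatrix a b c d) (rot s) t = ∑ m : Fin (2 * n + 1) → Fin 4,
      (∏ j, pauliWeight a b c d (m j)) * pauliString m s t := by
  have h1 : ∀ α : Conf n, ∏ j, blk (rMatrix a b c d) (α j) (α (j + 1)) (rot s j) (t j) =
      ∑ m : Fin (2 * n + 1) → Fin 4, (∏ j, pauliWeight a b c d (m j)) *
        ∏ j, (sig (m (j - 1)) (s j) (α j) * sig (m j) (α j) (t j)) := fun α => by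
    simp only [blk_rMatrix]
    rw [Finset.prod_univ_sum, Fintype.piFinset_univ]
    refine Finset.sum_congr rfl fun m _ => ?_
    rw [Finset.prod_mul_distrib, Finset.prod_mul_distrib, Finset.prod_mul_distrib,
      ← Equiv.prod_comp (Equiv.addRight (1 : Fin (2 * n + 1)))
        fun j => sig (m (j - 1)) (s j) (α j)]
    simp only [Equiv.coe_addRight, add_sub_cancel_right, rot]
    ring
  simp only [pathSum, Matrix.sum_apply, tens_apply, h1]
  rw [Finset.sum_comm]
  refine Finset.sum_congr rfl fun m _ => ?_
  rw [← Finset.mul_sum, pauliString, tens_apply]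
  congr 1
  simp only [Matrix.mul_apply]
  rw [Finset.prod_univ_sum, Fintype.piFinset_univ]

lemma pathSum_mulVec_rot (a b c d : ℂ) (ψ : Conf n → ℂ) (s : Conf n) :
    (pathSum n (rMatrix a b c d)).mulVec ψ (rot s) = ∑ m : Fin (2 * n + 1) → Fin 4,
      (pauliString m).mulVec ψ s * ∏ j, pauliWeight a b c d (m j) := by
  simp only [Matrix.mulVec, dotProduct, pathSum_rot_apply, Finset.sum_mul]
  rw [Finset.sum_comm]
  refine Finset.sum_congr rfl fun m _ => Finset.sum_congr rfl fun t _ => ?_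
  ring

/-- The sign of a Pauli matrix under conjugation by `σ^z`. -/
def pauliSign : Fin 4 → ℂ := ![1, -1, -1, 1]

lemma pauliSign_mul_self (x : Fin 4) : pauliSign x * pauliSign x = 1 := by
  fin_cases x <;> simp [pauliSign]

lemma sig_mul_sig_sign (x y : Fin 4) (s t : Fin 2) :
    (sig x * sig y) s t * (spinSign s * spinSign t) =
      (sig x * sig y) s t * (pauliSign x * pauliSign y) := by
  rw [Matrix.mul_apply, Fin.sum_univ_two]
  fin_cases x <;> fin_cases y <;> fin_cases s <;> fin_cases t <;>
    simp [sig, sigmaX, sigmaY, sigmaZ, pauliSign, spinSign]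

lemma prod_spinSign (s : Conf n) : ∏ k, spinSign (s k) = spinSign (parity s) := by
  have h : ∀ a b : Fin 2, spinSign (a + b) = spinSign a * spinSign b := by
    intro a b
    fin_cases a <;> fin_cases b <;> simp [spinSign]
  rw [parity]
  induction (Finset.univ : Finset (Fin (2 * n + 1))) using Finset.induction_on with
  | empty => simp [spinSign]
  | insert k S hk ih => rw [Finset.prod_insert hk, Finset.sum_insert hk, h, ih]

/-- Each label occurs at two sites, so its sign under conjugation by `σ^z` is squared away and the
string commutes with the parity. -/
lemma pauliString_apply_eq_zero (m : Fin (2 * n + 1) → Fin 4) {s t : Conf n}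
    (h : parity s ≠ parity t) : pauliString m s t = 0 := by
  have h1 : pauliString m s t * ((spinSign (parity s) * spinSign (parity t) : ℝ) : ℂ) =
      pauliString m s t := by
    have h2 : ∏ k, (pauliSign (m (k - 1)) * pauliSign (m k)) = 1 := by
      rw [Finset.prod_mul_distrib, ← Equiv.prod_comp (Equiv.addRight (1 : Fin (2 * n + 1)))
        fun k => pauliSign (m (k - 1))]
      simp only [Equiv.coe_addRight, add_sub_cancel_right]
      rw [← Finset.prod_mul_distrib]
      simp only [pauliSign_mul_self, Finset.prod_const_one]
    rw [← prod_spinSign, ← prod_spinSign]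
    push_cast
    rw [pauliString, tens_apply, ← Finset.prod_mul_distrib, ← Finset.prod_mul_distrib,
      Finset.prod_congr rfl fun k _ => sig_mul_sig_sign _ _ _ _, Finset.prod_mul_distrib, h2,
      mul_one]
  rw [spinSign_mul, if_neg h] at h1
  push_cast at h1
  linear_combination (-1 / 2 : ℂ) * h1

lemma transfer_apply_eq_zero (u η τ : ℂ) {s t : Conf n} (h : parity s ≠ parity t) :
    transfer n u η τ s t = 0 := by
  obtain ⟨s, rfl⟩ := (rotEquiv n).surjective s
  rw [transfer_eq_pathSum]
  show pathSum n (thetaR u η τ) (rot s) t = 0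
  rw [thetaR, pathSum_rot_apply]
  refine Finset.sum_eq_zero fun m _ => ?_
  rw [pauliString_apply_eq_zero m (by rw [← parity_rot s]; exact h), mul_zero]

lemma sig_zero : sig 0 = 1 := rfl

lemma sig_single (j : Fin (2 * n + 1)) (x : Fin 4) (k : Fin (2 * n + 1)) :
    sig ((Pi.single j x : Fin (2 * n + 1) → Fin 4) k) =
      (Pi.mulSingle j (sig x) : Fin (2 * n + 1) → Matrix (Fin 2) (Fin 2) ℂ) k := by
  by_cases h : k = j
  · subst h; simp
  · rw [Pi.single_eq_of_ne h, Pi.mulSingle_eq_of_ne h, sig_zero]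

lemma mulSingle_sub_one {M : Type*} [Monoid M] (j : Fin (2 * n + 1)) (A : M)
    (k : Fin (2 * n + 1)) : (Pi.mulSingle j A : Fin (2 * n + 1) → M) (k - 1) =
      (Pi.mulSingle (j + 1) A : Fin (2 * n + 1) → M) k := by
  by_cases h : k = j + 1
  · subst h; simp
  · rw [Pi.mulSingle_eq_of_ne h, Pi.mulSingle_eq_of_ne fun h' => h (by rw [← h']; simp)]

lemma pauliString_zero : pauliString (0 : Fin (2 * n + 1) → Fin 4) = 1 := by
  rw [pauliString, ← tens_one]
  congr 1
  funext k
  simp [sig_zero]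

lemma pauliString_single (hn : n ≠ 0) (j : Fin (2 * n + 1)) (x : Fin 4) :
    pauliString (Pi.single j x) = bond (sig x) j := by
  rw [pauliString, bond_eq_tens, (Pi.mulSingle_commute (add_one_ne hn j).symm _ _).eq]
  congr 1
  funext k
  rw [sig_single, sig_single, mulSingle_sub_one]
  rfl

lemma pauliString_single_add_single {j k : Fin (2 * n + 1)} (hjk : j ≠ k) (x y : Fin 4) :
    pauliString (Pi.single j x + Pi.single k y) =
      tens (Pi.mulSingle (j + 1) (sig x) * Pi.mulSingle (k + 1) (sig y) *
        (Pi.mulSingle j (sig x) * Pi.mulSingle k (sig y))) := by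
  have h : ∀ i, sig ((Pi.single j x + Pi.single k y : Fin (2 * n + 1) → Fin 4) i) =
      (Pi.mulSingle j (sig x) * Pi.mulSingle k (sig y) :
        Fin (2 * n + 1) → Matrix (Fin 2) (Fin 2) ℂ) i := fun i => by
    rw [Pi.add_apply, Pi.mul_apply, ← sig_single, ← sig_single]
    by_cases hi : i = j
    · subst hi
      rw [Pi.single_eq_of_ne (M := fun _ => Fin 4) hjk, sig_zero]; simp
    · rw [Pi.single_eq_of_ne (M := fun _ => Fin 4) hi, sig_zero]; simp
  rw [pauliString]
  congr 1
  funext i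
  rw [h, h]
  simp only [Pi.mul_apply, mulSingle_sub_one]

lemma add_two_ne (hn : n ≠ 0) (j : Fin (2 * n + 1)) : j + 1 + 1 ≠ j := by
  intro h
  have h1 : (1 + 1 : Fin (2 * n + 1)) = 0 := by rwa [add_assoc, add_eq_left] at h
  have := congrArg Fin.val h1
  rw [Fin.val_add, Fin.val_one', Fin.val_zero, Nat.mod_eq_of_lt (show 1 < 2 * n + 1 by omega),
    Nat.mod_eq_of_lt (by omega)] at this
  omega

lemma mul_reorder_right {M : Type*} [Monoid M] {p q u v : M} (h1 : u * v = v * u)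
    (h2 : q * v = v * q) (h3 : p * v = v * p) (h4 : p * q = q * p) (h5 : p * u = u * p) :
    p * q * (u * v) = v * q * (u * p) := by
  calc p * q * (u * v) = p * (q * v) * u := by rw [h1]; simp only [mul_assoc]
    _ = (p * v) * q * u := by rw [h2]; simp only [mul_assoc]
    _ = v * (p * q) * u := by rw [h3]; simp only [mul_assoc]
    _ = v * q * (p * u) := by rw [h4]; simp only [mul_assoc]
    _ = v * q * (u * p) := by rw [h5]

lemma mul_reorder_left {M : Type*} [Monoid M] {p q u v : M} (h1 : q * u = u * q)
    (h2 : p * u = u * p) (h3 : q * v = v * q) : p * q * (u * v) = u * p * (v * q) := by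
  calc p * q * (u * v) = p * (q * u) * v := by simp only [mul_assoc]
    _ = (p * u) * (q * v) := by rw [h1]; simp only [mul_assoc]
    _ = u * p * (v * q) := by rw [h2, h3]

/-- Bond operators on adjacent bonds may fail to commute; the order of the factors at the shared
site decides which product occurs. For the expectations below the order is irrelevant. -/
lemma pauliString_single_add_single_eq_or (hn : n ≠ 0) {j k : Fin (2 * n + 1)} (hjk : j ≠ k)
    (x y : Fin 4) : pauliString (Pi.single j x + Pi.single k y) = bond (sig x) j * bond (sig y) k ∨
      pauliString (Pi.single j x + Pi.single k y) = bond (sig y) k * bond (sig x) j := by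
  rw [pauliString_single_add_single hjk, bond_eq_tens, bond_eq_tens, ← tens_mul, ← tens_mul]
  have comm : ∀ (i l : Fin (2 * n + 1)) (A B : Matrix (Fin 2) (Fin 2) ℂ), i ≠ l →
      (Pi.mulSingle i A * Pi.mulSingle l B : Fin (2 * n + 1) → Matrix (Fin 2) (Fin 2) ℂ) =
        Pi.mulSingle l B * Pi.mulSingle i A := fun i l A B h =>
    (Pi.mulSingle_commute (f := fun _ => Matrix (Fin 2) (Fin 2) ℂ) h A B).eq
  set X := sig x
  set Y := sig y
  have hj := add_one_ne hn j
  have hk := add_one_ne hn k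
  have hjk' : j + 1 ≠ k + 1 := fun h => hjk (add_right_cancel h)
  by_cases h : j = k + 1
  · right
    have h' : k ≠ j + 1 := by
      rintro rfl
      exact add_two_ne hn j h.symm
    congr 1
    exact mul_reorder_right (comm j k X Y hjk) (comm (k + 1) k Y Y hk) (comm (j + 1) k X Y h'.symm)
      (comm (j + 1) (k + 1) X Y hjk') (comm (j + 1) j X X hj)
  · left
    congr 1
    exact mul_reorder_left (comm (k + 1) j Y X (Ne.symm h)) (comm (j + 1) j X X hj)
      (comm (k + 1) k Y Y hk)

end PauliExpansion

/-! ### Derivatives of multilinear expressions in the weights -/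

section Jets
variable {ι : Type*} [Fintype ι] [DecidableEq ι] {c : (ι → Fin 4) → ℂ} {a₀ : ℂ} {w : Fin 4 → ℂ}

lemma sum_mul_prod_eq (hw : w = Pi.single 0 a₀) :
    ∑ m, c m * ∏ j, w (m j) = a₀ ^ Fintype.card ι * c 0 := by
  rw [Finset.sum_eq_single 0]
  · simp [hw, mul_comm]
  · intro m _ hm
    obtain ⟨j, hj⟩ := Function.ne_iff.mp hm
    have hj' : m j ≠ 0 := hj
    rw [Finset.prod_eq_zero (Finset.mem_univ j), mul_zero]
    rw [hw, Pi.single_eq_of_ne hj']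
  · simp

/-- When only the weight of the label 0 survives, the first-order terms select assignments supported
on one bond; at second order they are supported on two. -/
lemma sum_mul_prod_erase (hw : w = Pi.single 0 a₀) (g : Fin 4 → ℂ) (j : ι) :
    ∑ m, c m * ((∏ k ∈ Finset.univ.erase j, w (m k)) * g (m j)) =
      a₀ ^ (Fintype.card ι - 1) * ∑ x, g x * c (Pi.single j x) := by
  rw [Finset.mul_sum]
  symm
  refine Finset.sum_of_injOn (fun x => (Pi.single j x : ι → Fin 4))
    (fun x _ y _ h => Pi.single_injective (M := fun _ => Fin 4) j h)
    (fun _ _ => Finset.mem_coe.mpr (Finset.mem_univ _)) (fun m _ hm => ?_) fun x _ => ?_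
  · have : ∃ k, k ≠ j ∧ m k ≠ 0 := by
      by_contra! h
      refine hm ⟨m j, Finset.mem_coe.mpr (Finset.mem_univ _), ?_⟩
      funext k
      by_cases hk : k = j
      · subst hk; simp
      · simp [hk, h k hk]
    obtain ⟨k, hk, hmk⟩ := this
    rw [Finset.prod_eq_zero (Finset.mem_erase.mpr ⟨hk, Finset.mem_univ k⟩), zero_mul, mul_zero]
    rw [hw, Pi.single_eq_of_ne hmk]
  · rw [Finset.prod_congr rfl (g := fun _ => a₀) fun k hk => by
      rw [Pi.single_eq_of_ne (M := fun _ => Fin 4) (Finset.ne_of_mem_erase hk), hw, Pi.single_eq_same],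
      Finset.prod_const, Finset.card_erase_of_mem (Finset.mem_univ j), Finset.card_univ,
      Pi.single_eq_same]
    ring

lemma sum_mul_prod_erase_erase (hw : w = Pi.single 0 a₀) (g : Fin 4 → ℂ) {j k : ι}
    (hjk : k ≠ j) :
    ∑ m, c m * ((∏ i ∈ (Finset.univ.erase j).erase k, w (m i)) * (g (m k) * g (m j))) =
      a₀ ^ (Fintype.card ι - 2) * ∑ x, ∑ y, g x * g y * c (Pi.single j x + Pi.single k y) := by
  simp only [Finset.mul_sum]
  rw [← Fintype.sum_prod_type' fun x y => a₀ ^ (Fintype.card ι - 2) *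
    (g x * g y * c ((Pi.single j x : ι → Fin 4) + (Pi.single k y : ι → Fin 4)))]
  symm
  have hj : ∀ x y : Fin 4, (Pi.single j x + Pi.single k y : ι → Fin 4) j = x := fun x y => by
    simp [hjk.symm]
  have hk : ∀ x y : Fin 4, (Pi.single j x + Pi.single k y : ι → Fin 4) k = y := fun x y => by
    simp [hjk]
  refine Finset.sum_of_injOn (fun p : Fin 4 × Fin 4 => (Pi.single j p.1 + Pi.single k p.2 : ι → Fin 4))
    (fun p _ q _ h => ?_)
    (fun _ _ => Finset.mem_coe.mpr (Finset.mem_univ _)) (fun m _ hm => ?_) fun p _ => ?_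
  · have h1 := congrFun h j
    have h2 := congrFun h k
    simp only [hj, hk] at h1 h2
    exact Prod.ext h1 h2
  · have : ∃ i, i ≠ j ∧ i ≠ k ∧ m i ≠ 0 := by
      by_contra! h
      refine hm ⟨(m j, m k), Finset.mem_coe.mpr (Finset.mem_univ _), ?_⟩
      funext i
      by_cases hij : i = j
      · subst hij; exact hj _ _
      · by_cases hik : i = k
        · subst hik; exact hk _ _
        · simp [hij, hik, h i hij hik]
    obtain ⟨i, hij, hik, hmi⟩ := this
    rw [Finset.prod_eq_zero (Finset.mem_erase.mpr ⟨hik, Finset.mem_erase.mpr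
      ⟨hij, Finset.mem_univ i⟩⟩), zero_mul, mul_zero]
    rw [hw, Pi.single_eq_of_ne hmi]
  · rw [Finset.prod_congr rfl (g := fun _ => a₀) fun i hi => by
      rw [Finset.mem_erase, Finset.mem_erase] at hi
      rw [Pi.add_apply, Pi.single_eq_of_ne (M := fun _ => Fin 4) hi.1,
        Pi.single_eq_of_ne (M := fun _ => Fin 4) hi.2.1, hw, add_zero, Pi.single_eq_same],
      Finset.prod_const, Finset.card_erase_of_mem (Finset.mem_erase.mpr ⟨hjk, Finset.mem_univ k⟩),
      Finset.card_erase_of_mem (Finset.mem_univ j), Finset.card_univ, hj, hk, Nat.sub_sub]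
    ring

lemma hasDerivAt_sum_mul_prod (c : (ι → Fin 4) → ℂ) {w w' : ℂ → Fin 4 → ℂ} {u : ℂ}
    (h : ∀ x, HasDerivAt (fun u => w u x) (w' u x) u) :
    HasDerivAt (fun u => ∑ m, c m * ∏ j, w u (m j))
      (∑ j, ∑ m, c m * ((∏ k ∈ Finset.univ.erase j, w u (m k)) * w' u (m j))) u := by
  rw [Finset.sum_comm]
  refine HasDerivAt.fun_sum fun m _ => ?_
  rw [← Finset.mul_sum]
  exact (HasDerivAt.fun_finsetProd fun j _ => h (m j)).const_mul (c m)

lemma hasDerivAt_deriv_sum_mul_prod (c : (ι → Fin 4) → ℂ) {w w' w'' : ℂ → Fin 4 → ℂ} {u : ℂ}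
    (h : ∀ x, HasDerivAt (fun u => w u x) (w' u x) u)
    (h' : ∀ x, HasDerivAt (fun u => w' u x) (w'' u x) u) :
    HasDerivAt (fun u => ∑ j, ∑ m, c m * ((∏ k ∈ Finset.univ.erase j, w u (m k)) * w' u (m j)))
      (∑ j, (∑ k ∈ Finset.univ.erase j, (∑ m, c m * ((∏ i ∈ (Finset.univ.erase j).erase k,
        w u (m i)) * (w' u (m k) * w' u (m j)))) +
        ∑ m, c m * ((∏ k ∈ Finset.univ.erase j, w u (m k)) * w'' u (m j)))) u := by
  refine HasDerivAt.fun_sum fun j _ => ?_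
  rw [Finset.sum_comm, ← Finset.sum_add_distrib]
  refine HasDerivAt.fun_sum fun m _ => ?_
  rw [← Finset.mul_sum, ← mul_add]
  have h1 := ((HasDerivAt.fun_finsetProd (u := Finset.univ.erase j)
    fun k _ => h (m k)).mul (h' (m j))).const_mul (c m)
  refine h1.congr_deriv ?_
  rw [Finset.sum_mul]
  congr 2
  refine Finset.sum_congr rfl fun k _ => ?_
  rw [smul_eq_mul, mul_assoc]

end Jets

/-! ### Action of the local operators -/

section LocalOperators
variable {n : ℕ}

lemma bond_one (j : Fin (2 * n + 1)) : bond (1 : Matrix (Fin 2) (Fin 2) ℂ) j = 1 := by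
  rw [bond_eq_tens, ← tens_one]
  simp

lemma sum_pauliWeight_bond (hn : n ≠ 0) (a b c d : ℂ) (j : Fin (2 * n + 1)) (ψ : Conf n → ℂ)
    (s : Conf n) : ∑ x, pauliWeight a b c d x * (bond (sig x) j).mulVec ψ s =
      if s j = s (j + 1) then a * ψ s + d * ψ (flip j s) else c * ψ s + b * ψ (flip j s) := by
  have h0 : (bond (sig 0) j).mulVec ψ s = ψ s := by rw [sig_zero, bond_one, Matrix.one_mulVec]
  have h1 : (bond (sig 1) j).mulVec ψ s = _ := bond_sigmaX_mulVec j ψ s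
  have h2 : (bond (sig 2) j).mulVec ψ s = _ := bond_sigmaY_mulVec hn j ψ s
  have h3 : (bond (sig 3) j).mulVec ψ s = _ := bond_sigmaZ_mulVec j ψ s
  rw [Fin.sum_univ_four, h0, h1, h2, h3, spinSign_mul]
  split_ifs <;> simp [pauliWeight] <;> ring

lemma bond_sig_symm (hn : n ≠ 0) (x : Fin 4) (j : Fin (2 * n + 1)) (φ ψ : Conf n → ℂ) :
    φ ⬝ᵥ (bond (sig x) j).mulVec ψ = (bond (sig x) j).mulVec φ ⬝ᵥ ψ := by
  have hflip : ∀ F : Conf n → ℂ, ∑ s, F (flip j s) = ∑ s, F s := fun F =>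
    Equiv.sum_comp (Function.Involutive.toPerm (flip j) (flip_flip j)) F
  have hsign : ∀ s : Conf n, spinSign (flip j s j) * spinSign (flip j s (j + 1)) =
      spinSign (s j) * spinSign (s (j + 1)) := fun s => by
    rw [flip_apply_left hn, flip_apply_right hn, spinSign_add_one, spinSign_add_one, neg_mul_neg]
  fin_cases x
  · show φ ⬝ᵥ (bond 1 j).mulVec ψ = (bond 1 j).mulVec φ ⬝ᵥ ψ
    rw [bond_one, Matrix.one_mulVec, Matrix.one_mulVec]
  · show φ ⬝ᵥ (bond sigmaX j).mulVec ψ = (bond sigmaX j).mulVec φ ⬝ᵥ ψ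
    simp only [dotProduct, bond_sigmaX_mulVec]
    rw [← hflip]
    simp only [flip_flip]
  · show φ ⬝ᵥ (bond sigmaY j).mulVec ψ = (bond sigmaY j).mulVec φ ⬝ᵥ ψ
    simp only [dotProduct, bond_sigmaY_mulVec hn]
    rw [← hflip]
    simp only [flip_flip, hsign]
    refine Finset.sum_congr rfl fun s _ => ?_
    ring
  · show φ ⬝ᵥ (bond sigmaZ j).mulVec ψ = (bond sigmaZ j).mulVec φ ⬝ᵥ ψ
    simp only [dotProduct, bond_sigmaZ_mulVec]
    refine Finset.sum_congr rfl fun s _ => ?_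
    ring

/-- The local operator with the Pauli coefficients of an eight-vertex `R`-matrix. -/
def locVec (a b c d : ℂ) (j : Fin (2 * n + 1)) (ψ : Conf n → ℂ) (s : Conf n) : ℂ :=
  ∑ x, pauliWeight a b c d x * (bond (sig x) j).mulVec ψ s

lemma locVec_apply (hn : n ≠ 0) (a b c d : ℂ) (j : Fin (2 * n + 1)) (ψ : Conf n → ℂ)
    (s : Conf n) : locVec a b c d j ψ s =
      if s j = s (j + 1) then a * ψ s + d * ψ (flip j s) else c * ψ s + b * ψ (flip j s) :=
  sum_pauliWeight_bond hn a b c d j ψ s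

/-- The hypotheses say that the coefficients of `σ^x`, `σ^y`, `σ^z` are `b/2` times `1 + ζ`, `1 -
ζ`, `Γ`. The derivatives of the weights at `u = η` satisfy them. -/
lemma sum_locVec (hn : n ≠ 0) {a b c d ζ Γ : ℂ} (h1 : d = ζ * b) (h2 : a - c = Γ * b)
    (ψ : Conf n → ℂ) (s : Conf n) : ∑ j, locVec a b c d j ψ s =
      (2 * n + 1) * ((a + c) / 2) * ψ s - b * (hamiltonian n (1 + ζ) (1 - ζ) Γ).mulVec ψ s := by
  have hL : (2 * (n : ℂ) + 1) * ((a + c) / 2) * ψ s =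
      ∑ _j : Fin (2 * n + 1), (a + c) / 2 * ψ s := by
    rw [Finset.sum_const, Finset.card_univ, Fintype.card_fin, nsmul_eq_mul]
    push_cast; ring
  rw [hL, hamiltonian_mulVec hn, Finset.mul_sum, Finset.mul_sum, ← Finset.sum_sub_distrib]
  refine Finset.sum_congr rfl fun j _ => ?_
  rw [locVec_apply hn, spinSign_mul]
  split_ifs
  · push_cast
    linear_combination (1 / 2 * ψ s) * h2 + ψ (flip j s) * h1
  · push_cast
    linear_combination (-1 / 2 * ψ s) * h2

lemma dotProduct_locVec (hn : n ≠ 0) (a b c d : ℂ) (j : Fin (2 * n + 1)) (φ ψ : Conf n → ℂ) :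
    φ ⬝ᵥ locVec a b c d j ψ = locVec a b c d j φ ⬝ᵥ ψ := by
  have h : ∀ φ ψ : Conf n → ℂ, φ ⬝ᵥ locVec a b c d j ψ =
      ∑ x, pauliWeight a b c d x * (φ ⬝ᵥ (bond (sig x) j).mulVec ψ) := fun φ ψ => by
    simp only [dotProduct, locVec, Finset.mul_sum]
    rw [Finset.sum_comm]
    refine Finset.sum_congr rfl fun x _ => Finset.sum_congr rfl fun s _ => ?_
    ring
  rw [dotProduct_comm (locVec a b c d j φ), h, h]
  refine Finset.sum_congr rfl fun x _ => ?_
  rw [bond_sig_symm hn, dotProduct_comm]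

/-- On a configuration and its flip at the bond, the local operator is a symmetric 2×2 block with
entries `a, d` or `c, b`. The hypotheses say that its square is the second-order operator up to one
scalar common to both blocks. -/
lemma locVec_locVec (hn : n ≠ 0) {a₀ a b c d a' b' c' d' ν : ℂ} (ha : a₀ * a' - a ^ 2 - d ^ 2 = ν)
    (hc : a₀ * c' - c ^ 2 - b ^ 2 = ν) (hb : a₀ * b' = 2 * b * c) (hd : a₀ * d' = 2 * a * d)
    (j : Fin (2 * n + 1)) (ψ : Conf n → ℂ) (s : Conf n) :
    locVec a b c d j (locVec a b c d j ψ) s = a₀ * locVec a' b' c' d' j ψ s - ν * ψ s := by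
  rw [locVec_apply hn, locVec_apply hn, locVec_apply hn, locVec_apply hn, flip_flip,
    flip_apply_left hn, flip_apply_right hn]
  simp only [add_left_inj]
  split_ifs
  · linear_combination (-ψ s) * ha - ψ (flip j s) * hd
  · linear_combination (-ψ s) * hc - ψ (flip j s) * hb

/-- The quadratic expression in the Pauli weights given by the first and second derivatives of the
transfer matrix at the shift point. -/
lemma second_derivative_form (hn : n ≠ 0) {a₀ a b c d a' b' c' d' ν κ : ℂ} {ρ : Conf n → ℂ}
    (ha : a₀ * a' - a ^ 2 - d ^ 2 = ν) (hc : a₀ * c' - c ^ 2 - b ^ 2 = ν)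
    (hb : a₀ * b' = 2 * b * c) (hd : a₀ * d' = 2 * a * d)
    (hκ : ∀ s, ∑ j, locVec a b c d j ρ s = κ * ρ s) :
    ∑ j : Fin (2 * n + 1), (∑ k ∈ Finset.univ.erase j, a₀ ^ (2 * n + 1 - 2) *
        (∑ x, ∑ y, pauliWeight a b c d x * pauliWeight a b c d y *
          (ρ ⬝ᵥ (pauliString (Pi.single j x + Pi.single k y)).mulVec ρ)) +
        a₀ ^ (2 * n + 1 - 1) * ∑ x, pauliWeight a' b' c' d' x *
          (ρ ⬝ᵥ (pauliString (Pi.single j x)).mulVec ρ)) =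
      a₀ ^ (2 * n + 1 - 2) * (κ ^ 2 + (2 * n + 1) * ν) * (ρ ⬝ᵥ ρ) := by
  -- Bond operators are symmetric, so both orders of the product give the same value between `ρ` and
  -- `ρ`; no commutator term arises.
  have h1 : ∀ j k : Fin (2 * n + 1), j ≠ k → ∀ x y,
      ρ ⬝ᵥ (pauliString (Pi.single j x + Pi.single k y)).mulVec ρ =
        (bond (sig x) j).mulVec ρ ⬝ᵥ (bond (sig y) k).mulVec ρ := by
    intro j k hjk x y
    rcases pauliString_single_add_single_eq_or hn hjk x y with h | h
    · rw [h, ← Matrix.mulVec_mulVec, bond_sig_symm hn]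
    · rw [h, ← Matrix.mulVec_mulVec, bond_sig_symm hn, dotProduct_comm]
  have h2 : ∀ j k : Fin (2 * n + 1), j ≠ k →
      ∑ x, ∑ y, pauliWeight a b c d x * pauliWeight a b c d y *
        (ρ ⬝ᵥ (pauliString (Pi.single j x + Pi.single k y)).mulVec ρ) =
        locVec a b c d j ρ ⬝ᵥ locVec a b c d k ρ := by
    intro j k hjk
    simp only [h1 j k hjk]
    simp only [dotProduct, locVec, Finset.sum_mul, Finset.mul_sum]
    rw [Finset.sum_congr rfl fun x _ => Finset.sum_comm, Finset.sum_comm]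
    refine Finset.sum_congr rfl fun s _ => ?_
    rw [Finset.sum_comm]
    refine Finset.sum_congr rfl fun y _ => Finset.sum_congr rfl fun x _ => ?_
    ring
  have h3 : ∀ j : Fin (2 * n + 1), a₀ * ∑ x, pauliWeight a' b' c' d' x *
      (ρ ⬝ᵥ (pauliString (Pi.single j x)).mulVec ρ) =
        locVec a b c d j ρ ⬝ᵥ locVec a b c d j ρ + ν * (ρ ⬝ᵥ ρ) := by
    intro j
    rw [← dotProduct_locVec hn]
    simp only [pauliString_single hn, dotProduct, locVec_locVec hn ha hc hb hd, Finset.mul_sum]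
    rw [Finset.sum_comm, ← Finset.sum_add_distrib]
    refine Finset.sum_congr rfl fun s _ => ?_
    have : ∑ x, a₀ * (pauliWeight a' b' c' d' x * (ρ s * (bond (sig x) j).mulVec ρ s)) =
        ρ s * (a₀ * locVec a' b' c' d' j ρ s) := by
      simp only [locVec, Finset.mul_sum]
      refine Finset.sum_congr rfl fun x _ => ?_
      ring
    rw [this]
    ring
  -- With the diagonal terms `j = k` restored, the double sum factorizes and the eigenvalue equation
  -- for the sum of local operators applies on both sides.
  have h4 : ∑ j : Fin (2 * n + 1), ∑ k : Fin (2 * n + 1),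
      locVec a b c d j ρ ⬝ᵥ locVec a b c d k ρ = κ ^ 2 * (ρ ⬝ᵥ ρ) := by
    have h5 : ∑ j, locVec a b c d j ρ = κ • ρ := by
      funext s
      rw [Finset.sum_apply, hκ]; rfl
    simp only [← dotProduct_sum, h5, dotProduct_smul, smul_eq_mul]
    rw [← Finset.mul_sum, ← sum_dotProduct, h5, smul_dotProduct, smul_eq_mul]
    ring
  have hpow : a₀ ^ (2 * n + 1 - 1) = a₀ ^ (2 * n + 1 - 2) * a₀ := by
    rw [← pow_succ]; congr 1; omega
  have h6 : ∀ j : Fin (2 * n + 1), (∑ k ∈ Finset.univ.erase j, a₀ ^ (2 * n + 1 - 2) *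
        (∑ x, ∑ y, pauliWeight a b c d x * pauliWeight a b c d y *
          (ρ ⬝ᵥ (pauliString (Pi.single j x + Pi.single k y)).mulVec ρ)) +
        a₀ ^ (2 * n + 1 - 1) * ∑ x, pauliWeight a' b' c' d' x *
          (ρ ⬝ᵥ (pauliString (Pi.single j x)).mulVec ρ)) =
      a₀ ^ (2 * n + 1 - 2) * (∑ k, locVec a b c d j ρ ⬝ᵥ locVec a b c d k ρ + ν * (ρ ⬝ᵥ ρ)) := by
    intro j
    rw [hpow, mul_assoc, h3 j, ← Finset.add_sum_erase _ _ (Finset.mem_univ j),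
      Finset.sum_congr rfl fun k hk => by rw [h2 j k (Finset.ne_of_mem_erase hk).symm],
      ← Finset.mul_sum]
    ring
  rw [Finset.sum_congr rfl fun j _ => h6 j, ← Finset.mul_sum, Finset.sum_add_distrib, h4]
  simp
  ring

end LocalOperators

/-! ### Derivatives of the weights at the shift point -/

section WeightJets
variable {η τ : ℂ}

lemma differentiable_weightA (hτ : 0 < τ.im) (η : ℂ) : Differentiable ℂ fun u => weightA u η τ :=
  fun _ => (analyticAt_weightA hτ analyticAt_id analyticAt_const).differentiableAt

lemma differentiable_weightB (hτ : 0 < τ.im) (η : ℂ) : Differentiable ℂ fun u => weightB u η τ :=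
  fun _ => (analyticAt_weightB hτ analyticAt_id analyticAt_const).differentiableAt

lemma differentiable_weightC (hτ : 0 < τ.im) (η : ℂ) : Differentiable ℂ fun u => weightC u η τ :=
  fun _ => (analyticAt_weightC hτ analyticAt_id analyticAt_const).differentiableAt

lemma differentiable_weightD (hτ : 0 < τ.im) (η : ℂ) : Differentiable ℂ fun u => weightD u η τ :=
  fun _ => (analyticAt_weightD hτ analyticAt_id analyticAt_const).differentiableAt

/-- First and second derivatives of the weights with respect to `u`, at `u = η`. -/
def dA (η τ : ℂ) : ℂ := deriv (fun u => weightA u η τ) η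
def dB (η τ : ℂ) : ℂ := deriv (fun u => weightB u η τ) η
def dC (η τ : ℂ) : ℂ := deriv (fun u => weightC u η τ) η
def dD (η τ : ℂ) : ℂ := deriv (fun u => weightD u η τ) η
def ddA (η τ : ℂ) : ℂ := deriv (deriv fun u => weightA u η τ) η
def ddB (η τ : ℂ) : ℂ := deriv (deriv fun u => weightB u η τ) η
def ddC (η τ : ℂ) : ℂ := deriv (deriv fun u => weightC u η τ) η
def ddD (η τ : ℂ) : ℂ := deriv (deriv fun u => weightD u η τ) η

lemma deriv_mul_entire {f g : ℂ → ℂ} (hf : Differentiable ℂ f) (hg : Differentiable ℂ g) :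
    deriv (fun u => f u * g u) = fun u => deriv f u * g u + f u * deriv g u :=
  funext fun u => deriv_fun_mul (hf u) (hg u)

lemma deriv_deriv_mul_entire {f g : ℂ → ℂ} (hf : Differentiable ℂ f) (hg : Differentiable ℂ g)
    (u : ℂ) : deriv (deriv fun u => f u * g u) u =
      deriv (deriv f) u * g u + 2 * (deriv f u * deriv g u) + f u * deriv (deriv g) u := by
  rw [deriv_mul_entire hf hg]
  refine ((((hf.deriv u).hasDerivAt.mul (hg u).hasDerivAt)).add
    ((hf u).hasDerivAt.mul (hg.deriv u).hasDerivAt)).deriv.trans ?_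
  ring

/-- First and second `u`-derivatives of `cd = ζ ab` at `u = η`, where `b = d = 0` and `c = a`. -/
lemma weight_prod_jet (hτ : 0 < τ.im) (h4 : theta4 (2 * η) (2 * τ) ≠ 0) :
    weightA η η τ * dD η τ = zeta η τ * (weightA η η τ * dB η τ) ∧
      2 * (dC η τ * dD η τ) + weightA η η τ * ddD η τ =
        zeta η τ * (2 * (dA η τ * dB η τ) + weightA η η τ * ddB η τ) := by
  have hA := differentiable_weightA hτ η
  have hB := differentiable_weightB hτ η
  have hC := differentiable_weightC hτ η
  have hD := differentiable_weightD hτ η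
  have h : (fun u => weightC u η τ * weightD u η τ) =
      fun u => zeta η τ * (weightA u η τ * weightB u η τ) := funext fun u =>
    weightC_mul_weightD h4 u
  have h1 := congrFun (congrArg deriv h) η
  rw [deriv_mul_entire hC hD, deriv_const_mul _ ((hA η).fun_mul (hB η)),
    deriv_mul_entire hA hB] at h1
  simp only [weightB_self, weightD_self, weightC_self] at h1
  have h2 := congrFun (congrArg deriv (congrArg deriv h)) η
  have h3 : (deriv fun u => zeta η τ * (weightA u η τ * weightB u η τ)) =
      fun u => zeta η τ * deriv (fun u => weightA u η τ * weightB u η τ) u :=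
    funext fun u => deriv_const_mul _ ((hA u).fun_mul (hB u))
  rw [deriv_deriv_mul_entire hC hD, h3, deriv_const_mul _ ((hA.fun_mul hB).deriv η),
    deriv_deriv_mul_entire hA hB] at h2
  simp only [weightB_self, weightD_self, weightC_self] at h2
  rw [dA, dB, dC, dD, ddD, ddB]
  constructor
  · linear_combination h1
  · linear_combination h2

lemma weight_quadratic_jet (hτ : 0 < τ.im) (h4 : theta4 (2 * η) (2 * τ) ≠ 0) :
    2 * (weightA η η τ * dA η τ) - 2 * (weightA η η τ * dC η τ) =
        2 * Gam η τ * (weightA η η τ * dB η τ) ∧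
      2 * (dA η τ ^ 2 + weightA η η τ * ddA η τ) + 2 * dB η τ ^ 2 -
          2 * (dC η τ ^ 2 + weightA η η τ * ddC η τ) - 2 * dD η τ ^ 2 =
        2 * Gam η τ * (2 * (dA η τ * dB η τ) + weightA η η τ * ddB η τ) := by
  have hA := differentiable_weightA hτ η
  have hB := differentiable_weightB hτ η
  have hC := differentiable_weightC hτ η
  have hD := differentiable_weightD hτ η
  have h : (fun u => weightA u η τ * weightA u η τ + weightB u η τ * weightB u η τ -
      weightC u η τ * weightC u η τ - weightD u η τ * weightD u η τ) =
      fun u => 2 * Gam η τ * (weightA u η τ * weightB u η τ) := funext fun u => by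
    rw [← weight_quadratic hτ h4 u]; ring
  have e : ∀ u, deriv (fun u => weightA u η τ * weightA u η τ + weightB u η τ * weightB u η τ -
      weightC u η τ * weightC u η τ - weightD u η τ * weightD u η τ) u =
      deriv (fun u => weightA u η τ * weightA u η τ) u +
      deriv (fun u => weightB u η τ * weightB u η τ) u -
      deriv (fun u => weightC u η τ * weightC u η τ) u -
      deriv (fun u => weightD u η τ * weightD u η τ) u := fun u =>
    (((((hA.fun_mul hA u).hasDerivAt.add (hB.fun_mul hB u).hasDerivAt).sub
      (hC.fun_mul hC u).hasDerivAt).sub (hD.fun_mul hD u).hasDerivAt)).deriv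
  have h3 : (deriv fun u => 2 * Gam η τ * (weightA u η τ * weightB u η τ)) =
      fun u => 2 * Gam η τ * deriv (fun u => weightA u η τ * weightB u η τ) u :=
    funext fun u => deriv_const_mul _ ((hA u).fun_mul (hB u))
  have h1 := congrFun (congrArg deriv h) η
  rw [e, h3, deriv_mul_entire hA hA, deriv_mul_entire hB hB, deriv_mul_entire hC hC,
    deriv_mul_entire hD hD, deriv_mul_entire hA hB] at h1
  simp only [weightB_self, weightD_self, weightC_self] at h1
  have h2 := congrFun (congrArg deriv (congrArg deriv h)) η
  have e2 : deriv (deriv fun u => weightA u η τ * weightA u η τ + weightB u η τ * weightB u η τ -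
      weightC u η τ * weightC u η τ - weightD u η τ * weightD u η τ) η =
      deriv (deriv fun u => weightA u η τ * weightA u η τ) η +
      deriv (deriv fun u => weightB u η τ * weightB u η τ) η -
      deriv (deriv fun u => weightC u η τ * weightC u η τ) η -
      deriv (deriv fun u => weightD u η τ * weightD u η τ) η := by
    rw [funext e]
    exact ((((((hA.fun_mul hA).deriv η).hasDerivAt.add ((hB.fun_mul hB).deriv η).hasDerivAt).sub
      ((hC.fun_mul hC).deriv η).hasDerivAt).sub ((hD.fun_mul hD).deriv η).hasDerivAt)).deriv
  rw [e2, h3, deriv_const_mul _ ((hA.fun_mul hB).deriv η), deriv_deriv_mul_entire hA hA,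
    deriv_deriv_mul_entire hB hB, deriv_deriv_mul_entire hC hC, deriv_deriv_mul_entire hD hD,
    deriv_deriv_mul_entire hA hB] at h2
  simp only [weightB_self, weightD_self, weightC_self] at h2
  rw [dA, dB, dC, dD, ddA, ddC, ddB]
  constructor
  · linear_combination h1
  · linear_combination h2

lemma dD_eq (hτ : 0 < τ.im) (h4 : theta4 (2 * η) (2 * τ) ≠ 0) (h1 : theta1 (2 * η) (2 * τ) ≠ 0) :
    dD η τ = zeta η τ * dB η τ := by
  refine mul_left_cancel₀ (weightA_self_ne_zero hτ h4 h1) ?_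
  rw [(weight_prod_jet hτ h4).1]; ring

lemma dA_sub_dC (hτ : 0 < τ.im) (h4 : theta4 (2 * η) (2 * τ) ≠ 0)
    (h1 : theta1 (2 * η) (2 * τ) ≠ 0) : dA η τ - dC η τ = Gam η τ * dB η τ := by
  refine mul_left_cancel₀ (mul_ne_zero two_ne_zero (weightA_self_ne_zero hτ h4 h1)) ?_
  linear_combination (weight_quadratic_jet hτ h4).1

lemma weightA_mul_ddB (hτ : 0 < τ.im) (η : ℂ) :
    weightA η η τ * ddB η τ = 2 * dB η τ * dC η τ := weightA_mul_deriv_deriv_weightB η hτ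

lemma weightA_mul_ddD (hτ : 0 < τ.im) (h4 : theta4 (2 * η) (2 * τ) ≠ 0)
    (h1 : theta1 (2 * η) (2 * τ) ≠ 0) : weightA η η τ * ddD η τ = 2 * dA η τ * dD η τ := by
  linear_combination (weight_prod_jet hτ h4).2 + zeta η τ * weightA_mul_ddB hτ η -
    (2 * dC η τ + 2 * dA η τ) * dD_eq hτ h4 h1

/-- The scalar part of the second-order expansion of the local operators. -/
def jetConst (η τ : ℂ) : ℂ := weightA η η τ * ddA η τ - dA η τ ^ 2 - dD η τ ^ 2

/-- The second-order part of the quadratic relation between the weights. It makes the scalars of the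
two blocks of the local operator agree. -/
lemma jetConst_eq (hτ : 0 < τ.im) (h4 : theta4 (2 * η) (2 * τ) ≠ 0)
    (h1 : theta1 (2 * η) (2 * τ) ≠ 0) :
    weightA η η τ * ddC η τ - dC η τ ^ 2 - dB η τ ^ 2 = jetConst η τ := by
  rw [jetConst]
  linear_combination (-1 / 2) * (weight_quadratic_jet hτ h4).2 -
    Gam η τ * weightA_mul_ddB hτ η + 2 * (dA η τ + dC η τ) * dA_sub_dC hτ h4 h1

/-- The logarithmic derivative of `θ₁`. -/
def logTheta (τ u : ℂ) : ℂ := deriv (fun u => theta1 u τ) u / theta1 u τ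

lemma sum_weight_self (hτ : 0 < τ.im) (η : ℂ) : weightA η η τ =
    rho τ * theta4 (2 * η) (2 * τ) * theta2 η τ * theta1 η τ := by
  have h := weightA_add_weightB η η hτ
  rw [weightB_self] at h
  linear_combination h

lemma sum_weight_fun (hτ : 0 < τ.im) (η : ℂ) : (fun u => weightA u η τ + weightB u η τ) =
    fun u => rho τ * theta4 (2 * η) (2 * τ) * theta2 η τ * theta1 u τ := funext fun u => by
  rw [weightA_add_weightB u η hτ]; ring

lemma dA_add_dB_mul (hτ : 0 < τ.im) (η : ℂ) : dA η τ + dB η τ =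
    rho τ * theta4 (2 * η) (2 * τ) * theta2 η τ * deriv (fun u => theta1 u τ) η := by
  have h := congrFun (congrArg deriv (sum_weight_fun hτ η)) η
  rw [deriv_const_mul _ (differentiable_theta1 hτ η),
    deriv_fun_add (differentiable_weightA hτ η η) (differentiable_weightB hτ η η)] at h
  exact h

lemma ddA_add_ddB_mul (hτ : 0 < τ.im) (η : ℂ) : ddA η τ + ddB η τ =
    rho τ * theta4 (2 * η) (2 * τ) * theta2 η τ * deriv (deriv fun u => theta1 u τ) η := by
  have h := congrFun (congrArg deriv (congrArg deriv (sum_weight_fun hτ η))) η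
  have h1 : (deriv fun u => rho τ * theta4 (2 * η) (2 * τ) * theta2 η τ * theta1 u τ) =
      fun u => rho τ * theta4 (2 * η) (2 * τ) * theta2 η τ * deriv (fun u => theta1 u τ) u :=
    funext fun u => deriv_const_mul _ (differentiable_theta1 hτ u)
  have h2 : (deriv fun u => weightA u η τ + weightB u η τ) = fun u =>
      deriv (fun u => weightA u η τ) u + deriv (fun u => weightB u η τ) u :=
    funext fun u => deriv_fun_add (differentiable_weightA hτ η u) (differentiable_weightB hτ η u)
  rw [h1, h2, deriv_const_mul _ ((differentiable_theta1 hτ).deriv η),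
    deriv_fun_add ((differentiable_weightA hτ η).deriv η)
      ((differentiable_weightB hτ η).deriv η)] at h
  exact h

lemma theta1_ne_zero_of_weightA (hτ : 0 < τ.im) (h : weightA η η τ ≠ 0) : theta1 η τ ≠ 0 := by
  rw [sum_weight_self hτ] at h
  exact right_ne_zero_of_mul h

lemma dA_add_dB (hτ : 0 < τ.im) (h4 : theta4 (2 * η) (2 * τ) ≠ 0)
    (h1 : theta1 (2 * η) (2 * τ) ≠ 0) : dA η τ + dB η τ = logTheta τ η * weightA η η τ := by
  have h := theta1_ne_zero_of_weightA hτ (weightA_self_ne_zero hτ h4 h1)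
  rw [dA_add_dB_mul hτ, sum_weight_self hτ, logTheta]
  field_simp

lemma hasDerivAt_logTheta (hτ : 0 < τ.im) (h : theta1 η τ ≠ 0) :
    HasDerivAt (logTheta τ) ((deriv (deriv fun u => theta1 u τ) η * theta1 η τ -
      deriv (fun u => theta1 u τ) η ^ 2) / theta1 η τ ^ 2) η := by
  have h1 := ((differentiable_theta1 hτ).deriv η).hasDerivAt.div (hasDerivAt_theta1 η hτ) h
  rw [sq (deriv (fun u => theta1 u τ) η)]
  exact h1

/-- At the supersymmetric point the second logarithmic derivative of the transfer matrix
eigenvalue is that of `θ₁`. -/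
lemma jetConst_eta0 (hτ : 0 < τ.im) :
    jetConst eta0 τ = deriv (logTheta τ) eta0 * weightA eta0 eta0 τ ^ 2 := by
  have h4 := theta4_two_eta0_ne_zero hτ
  have h1 := theta1_two_eta0_ne_zero hτ
  have ha := weightA_self_ne_zero hτ h4 h1
  have ht := theta1_ne_zero_of_weightA hτ ha
  rw [(hasDerivAt_logTheta hτ ht).deriv, sum_weight_self hτ]
  have e1 := dA_add_dB_mul hτ eta0
  have e2 := ddA_add_ddB_mul hτ eta0
  have e3 := sum_weight_self hτ eta0
  have e4 := dA_sub_dC hτ h4 h1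
  have e5 := dD_eq hτ h4 h1
  have e6 := Gam_eta0 hτ
  have e7 := weightA_mul_ddB hτ eta0
  set g := rho τ * theta4 (2 * eta0) (2 * τ) * theta2 eta0 τ
  have e8 : (deriv (deriv fun u => theta1 u τ) eta0 * theta1 eta0 τ -
      deriv (fun u => theta1 u τ) eta0 ^ 2) / theta1 eta0 τ ^ 2 * (g * theta1 eta0 τ) ^ 2 =
      (g * deriv (deriv fun u => theta1 u τ) eta0) * (g * theta1 eta0 τ) -
      (g * deriv (fun u => theta1 u τ) eta0) ^ 2 := by
    field_simp
  rw [e8, ← e1, ← e2, ← e3, jetConst, e5]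
  -- This is where the supersymmetric point enters: it cancels the terms in the square of `∂_u b`
  -- against those in `Γ`.
  have e9 : zeta eta0 τ ^ 2 = 2 * Gam eta0 τ + 1 := by rw [e6]; ring
  linear_combination (-dB eta0 τ ^ 2) * e9 - e7 + 2 * dB eta0 τ * e4

end WeightJets

/-! ### Derivatives of the transfer matrix eigenvalue at the shift point. -/

section TransferDerivatives
variable {n : ℕ} {η τ : ℂ}

/-- The Pauli coefficients of the weights and their derivatives. -/
def pw (η τ u : ℂ) : Fin 4 → ℂ :=
  pauliWeight (weightA u η τ) (weightB u η τ) (weightC u η τ) (weightD u η τ)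
def pw' (η τ u : ℂ) : Fin 4 → ℂ :=
  pauliWeight (deriv (fun u => weightA u η τ) u) (deriv (fun u => weightB u η τ) u)
    (deriv (fun u => weightC u η τ) u) (deriv (fun u => weightD u η τ) u)
def pw'' (η τ u : ℂ) : Fin 4 → ℂ :=
  pauliWeight (deriv (deriv fun u => weightA u η τ) u) (deriv (deriv fun u => weightB u η τ) u)
    (deriv (deriv fun u => weightC u η τ) u) (deriv (deriv fun u => weightD u η τ) u)

lemma hasDerivAt_pauliWeight {a b c d : ℂ → ℂ} {a' b' c' d' u : ℂ} (ha : HasDerivAt a a' u)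
    (hb : HasDerivAt b b' u) (hc : HasDerivAt c c' u) (hd : HasDerivAt d d' u) (x : Fin 4) :
    HasDerivAt (fun u => pauliWeight (a u) (b u) (c u) (d u) x) (pauliWeight a' b' c' d' x) u := by
  fin_cases x
  · exact (ha.add hc).div_const 2
  · exact (hb.add hd).div_const 2
  · exact (hb.sub hd).div_const 2
  · exact (ha.sub hc).div_const 2

lemma hasDerivAt_pw (hτ : 0 < τ.im) (η u : ℂ) (x : Fin 4) :
    HasDerivAt (fun u => pw η τ u x) (pw' η τ u x) u :=
  hasDerivAt_pauliWeight (differentiable_weightA hτ η u).hasDerivAt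
    (differentiable_weightB hτ η u).hasDerivAt (differentiable_weightC hτ η u).hasDerivAt
    (differentiable_weightD hτ η u).hasDerivAt x

lemma hasDerivAt_pw' (hτ : 0 < τ.im) (η u : ℂ) (x : Fin 4) :
    HasDerivAt (fun u => pw' η τ u x) (pw'' η τ u x) u :=
  hasDerivAt_pauliWeight ((differentiable_weightA hτ η).deriv u).hasDerivAt
    ((differentiable_weightB hτ η).deriv u).hasDerivAt
    ((differentiable_weightC hτ η).deriv u).hasDerivAt
    ((differentiable_weightD hτ η).deriv u).hasDerivAt x

lemma pw_self (η τ : ℂ) : pw η τ η = Pi.single 0 (weightA η η τ) := by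
  rw [pw, weightB_self, weightC_self, weightD_self]
  funext x
  fin_cases x <;> simp [pauliWeight]

lemma transfer_mulVec_rot (u η τ : ℂ) (ψ : Conf n → ℂ) (s : Conf n) :
    (transfer n u η τ).mulVec ψ (rot s) = ∑ m : Fin (2 * n + 1) → Fin 4,
      (pauliString m).mulVec ψ s * ∏ j, pw η τ u (m j) := by
  rw [transfer_eq_pathSum, thetaR, pathSum_mulVec_rot]
  rfl

/-- The eigenvalue of the logarithmic derivative of the transfer matrix at the shift point, for an
eigenvector of the Hamiltonian. -/
def logSlope (n : ℕ) (η τ E : ℂ) : ℂ :=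
  (2 * n + 1) * ((dA η τ + dC η τ) / 2) - dB η τ * E

/-- The eigenvalue equation is read at one configuration where `ψ` does not vanish. At `u = η` it
gives `Λ ψ(rot s) = a^L ψ(s)`, hence `Λ ≠ 0`; no rotation invariance of `ψ` is needed. -/
lemma transfer_eigenvalue_jet (hn : n ≠ 0) (hτ : 0 < τ.im) (h4 : theta4 (2 * η) (2 * τ) ≠ 0)
    (h1 : theta1 (2 * η) (2 * τ) ≠ 0) {ψ : Conf n → ℂ} (hψ : ψ ≠ 0) {l : ℂ → ℂ}
    (hT : ∀ u, (transfer n u η τ).mulVec ψ = l u • ψ) {E : ℂ}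
    (hE : (hamiltonian n (1 + zeta η τ) (1 - zeta η τ) (Gam η τ)).mulVec ψ = E • ψ) :
    l η ≠ 0 ∧ weightA η η τ * deriv l η = logSlope n η τ E * l η := by
  obtain ⟨s, hs⟩ := Function.ne_iff.mp hψ
  have hs : ψ s ≠ 0 := hs
  have ha := weightA_self_ne_zero hτ h4 h1
  have key : ∀ u, l u * ψ (rot s) = ∑ m : Fin (2 * n + 1) → Fin 4,
      (pauliString m).mulVec ψ s * ∏ j, pw η τ u (m j) := fun u => by
    rw [← transfer_mulVec_rot, hT]; rfl
  have h0 := key η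
  rw [sum_mul_prod_eq (pw_self η τ), Fintype.card_fin, pauliString_zero, Matrix.one_mulVec] at h0
  have hne : l η * ψ (rot s) ≠ 0 := by
    rw [h0]; exact mul_ne_zero (pow_ne_zero _ ha) hs
  have hrs := right_ne_zero_of_mul hne
  refine ⟨left_ne_zero_of_mul hne, ?_⟩
  have hl : l = fun u => (∑ m : Fin (2 * n + 1) → Fin 4,
      (pauliString m).mulVec ψ s * ∏ j, pw η τ u (m j)) / ψ (rot s) := funext fun u => by
    rw [← key u, mul_div_cancel_right₀ _ hrs]
  have hd := (hasDerivAt_sum_mul_prod (fun m : Fin (2 * n + 1) → Fin 4 => (pauliString m).mulVec ψ s)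
    (hasDerivAt_pw hτ η η)).div_const (ψ (rot s))
  rw [← hl] at hd
  rw [hd.deriv, Finset.sum_congr rfl fun j _ => sum_mul_prod_erase (pw_self η τ) (pw' η τ η) j,
    ← Finset.mul_sum, Fintype.card_fin]
  have hloc : ∑ j : Fin (2 * n + 1), ∑ x, pw' η τ η x *
      (pauliString (Pi.single j x)).mulVec ψ s = logSlope n η τ E * ψ s := by
    have h := sum_locVec hn (dD_eq hτ h4 h1) (dA_sub_dC hτ h4 h1) ψ s
    rw [hE, Pi.smul_apply, smul_eq_mul] at h
    rw [logSlope, sub_mul, mul_assoc (dB η τ), ← h]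
    refine Finset.sum_congr rfl fun j _ => Finset.sum_congr rfl fun x _ => ?_
    rw [pauliString_single hn]; rfl
  rw [hloc]
  refine mul_right_cancel₀ hrs ?_
  rw [mul_assoc (logSlope n η τ E), h0, Nat.add_sub_cancel, pow_succ]
  field_simp

/-- Here the equation is paired with a rotation-invariant `ρ`, which removes the shift and leaves
symmetric expectations of Pauli strings. -/
lemma transfer_eigenvalue_second (hn : n ≠ 0) (hτ : 0 < τ.im)
    (h4 : theta4 (2 * η) (2 * τ) ≠ 0) (h1 : theta1 (2 * η) (2 * τ) ≠ 0) {ρ : Conf n → ℂ}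
    (hρ : ∀ s, ρ (rot s) = ρ s) (hN : ρ ⬝ᵥ ρ ≠ 0) {l : ℂ → ℂ}
    (hT : ∀ u, (transfer n u η τ).mulVec ρ = l u • ρ) {E : ℂ}
    (hE : (hamiltonian n (1 + zeta η τ) (1 - zeta η τ) (Gam η τ)).mulVec ρ = E • ρ) :
    weightA η η τ ^ 2 * deriv (deriv l) η =
      (logSlope n η τ E ^ 2 + (2 * n + 1) * jetConst η τ) * l η := by
  have ha := weightA_self_ne_zero hτ h4 h1
  have key : ∀ u, l u * (ρ ⬝ᵥ ρ) = ∑ m : Fin (2 * n + 1) → Fin 4,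
      (ρ ⬝ᵥ (pauliString m).mulVec ρ) * ∏ j, pw η τ u (m j) := fun u => by
    have h : ∀ s, l u * ρ s = ∑ m : Fin (2 * n + 1) → Fin 4,
        (pauliString m).mulVec ρ s * ∏ j, pw η τ u (m j) := fun s => by
      rw [← transfer_mulVec_rot, hT, Pi.smul_apply, hρ, smul_eq_mul]
    have h' : l u * (ρ ⬝ᵥ ρ) = ∑ s, ρ s * (l u * ρ s) := by
      rw [dotProduct, Finset.mul_sum]
      refine Finset.sum_congr rfl fun s _ => by ring
    rw [h']
    simp only [h, dotProduct, Finset.sum_mul, Finset.mul_sum]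
    rw [Finset.sum_comm]
    refine Finset.sum_congr rfl fun m _ => Finset.sum_congr rfl fun s _ => by ring
  have h0 := key η
  rw [sum_mul_prod_eq (pw_self η τ), Fintype.card_fin, pauliString_zero, Matrix.one_mulVec] at h0
  have hl0 := mul_right_cancel₀ hN h0
  have hl : l = fun u => (∑ m : Fin (2 * n + 1) → Fin 4,
      (ρ ⬝ᵥ (pauliString m).mulVec ρ) * ∏ j, pw η τ u (m j)) / (ρ ⬝ᵥ ρ) := funext fun u => by
    rw [← key u, mul_div_cancel_right₀ _ hN]
  have hd : deriv l = fun u => (∑ j, ∑ m : Fin (2 * n + 1) → Fin 4,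
      (ρ ⬝ᵥ (pauliString m).mulVec ρ) * ((∏ k ∈ Finset.univ.erase j, pw η τ u (m k)) *
        pw' η τ u (m j))) / (ρ ⬝ᵥ ρ) := funext fun u => by
    conv_lhs => rw [hl]
    exact ((hasDerivAt_sum_mul_prod _ (hasDerivAt_pw hτ η u)).div_const _).deriv
  have hdd := (hasDerivAt_deriv_sum_mul_prod (fun m : Fin (2 * n + 1) → Fin 4 =>
    ρ ⬝ᵥ (pauliString m).mulVec ρ) (hasDerivAt_pw hτ η η) (hasDerivAt_pw' hτ η η)).div_const (ρ ⬝ᵥ ρ)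
  rw [← hd] at hdd
  have hform := second_derivative_form hn (a₀ := weightA η η τ) (a := dA η τ) (b := dB η τ)
    (c := dC η τ) (d := dD η τ) (a' := ddA η τ) (b' := ddB η τ) (c' := ddC η τ) (d' := ddD η τ)
    (ν := jetConst η τ) (κ := logSlope n η τ E) (ρ := ρ) rfl (jetConst_eq hτ h4 h1)
    (weightA_mul_ddB hτ η) (weightA_mul_ddD hτ h4 h1) fun s => by
      rw [sum_locVec hn (dD_eq hτ h4 h1) (dA_sub_dC hτ h4 h1), hE, Pi.smul_apply, smul_eq_mul,
        logSlope]
      ring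
  have hsum : ∑ j : Fin (2 * n + 1), (∑ k ∈ Finset.univ.erase j,
      (∑ m, (ρ ⬝ᵥ (pauliString m).mulVec ρ) * ((∏ i ∈ (Finset.univ.erase j).erase k,
        pw η τ η (m i)) * (pw' η τ η (m k) * pw' η τ η (m j)))) +
        ∑ m, (ρ ⬝ᵥ (pauliString m).mulVec ρ) * ((∏ k ∈ Finset.univ.erase j, pw η τ η (m k)) *
          pw'' η τ η (m j))) = weightA η η τ ^ (2 * n + 1 - 2) *
            (logSlope n η τ E ^ 2 + (2 * n + 1) * jetConst η τ) * (ρ ⬝ᵥ ρ) := by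
    rw [← hform]
    refine Finset.sum_congr rfl fun j _ => ?_
    rw [sum_mul_prod_erase (pw_self η τ) (pw'' η τ η) j, Fintype.card_fin]
    congr 1
    refine Finset.sum_congr rfl fun k hk => ?_
    rw [sum_mul_prod_erase_erase (c := fun m => ρ ⬝ᵥ (pauliString m).mulVec ρ) (pw_self η τ)
      (pw' η τ η) (Finset.ne_of_mem_erase hk), Fintype.card_fin]
    rfl
  rw [hdd.deriv, hsum, hl0, mul_div_cancel_right₀ _ hN]
  have hpow : weightA η η τ ^ (2 * n + 1) = weightA η η τ ^ 2 * weightA η η τ ^ (2 * n + 1 - 2) := by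
    rw [← pow_add]; congr 1; omega
  rw [hpow]; ring

/-! ### Analyticity of the transfer matrix and commutation with the Hamiltonian -/

lemma analyticAt_transfer {V : Type*} [NormedAddCommGroup V] [NormedSpace ℂ V] {f g : V → ℂ} {x : V}
    (hτ : 0 < τ.im) (hf : AnalyticAt ℂ f x) (hg : AnalyticAt ℂ g x) (s t : Conf n) :
    AnalyticAt ℂ (fun y => transfer n (f y) (g y) τ s t) x := by
  simp only [transfer_eq_pathSum, pathSum, Matrix.sum_apply, tens_apply, blk, Matrix.of_apply,
    thetaR, rMatrix_apply]
  refine Finset.analyticAt_fun_sum _ fun α _ => Finset.analyticAt_fun_prod _ fun j _ => ?_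
  have hA := analyticAt_weightA hτ hf hg
  have hB := analyticAt_weightB hτ hf hg
  have hC := analyticAt_weightC hτ hf hg
  have hD := analyticAt_weightD hτ hf hg
  split_ifs
  · exact hA
  · exact hD
  · exact analyticAt_const
  · exact analyticAt_const
  · exact hB
  · exact hC

lemma hamiltonian_smul (r Jx Jy Jz : ℂ) :
    hamiltonian n (r * Jx) (r * Jy) (r * Jz) = r • hamiltonian n Jx Jy Jz := by
  simp only [hamiltonian, mul_smul]
  rw [smul_comm r, Finset.smul_sum (r := r)]
  simp only [smul_add]

lemma transfer_commute (hn : n ≠ 0) (hτ : 0 < τ.im) (h4 : theta4 (2 * η) (2 * τ) ≠ 0)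
    (h1 : theta1 (2 * η) (2 * τ) ≠ 0) (u : ℂ) :
    hamiltonian n (1 + zeta η τ) (1 - zeta η τ) (Gam η τ) * transfer n u η τ =
      transfer n u η τ * hamiltonian n (1 + zeta η τ) (1 - zeta η τ) (Gam η τ) := by
  set H := hamiltonian n (1 + zeta η τ) (1 - zeta η τ) (Gam η τ) with hH
  have hgen : ∀ u, weightA u η τ * weightB u η τ ≠ 0 → H * transfer n u η τ =
      transfer n u η τ * H := by
    intro u hu
    have h := hamiltonian_mul_pathSum hn (weightA u η τ) (weightB u η τ) (weightC u η τ)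
      (weightD u η τ)
    have e0 : coupling (weightA u η τ) (weightB u η τ) (weightC u η τ) (weightD u η τ) 0 =
        (weightA u η τ * weightB u η τ) * (1 + zeta η τ) := by
      simp only [coupling, Matrix.cons_val_zero]
      rw [weightC_mul_weightD h4]; ring
    have e1 : coupling (weightA u η τ) (weightB u η τ) (weightC u η τ) (weightD u η τ) 1 =
        (weightA u η τ * weightB u η τ) * (1 - zeta η τ) := by
      simp only [coupling, Matrix.cons_val_one, Matrix.cons_val_zero]
      rw [weightC_mul_weightD h4]; ring
    have e2 : coupling (weightA u η τ) (weightB u η τ) (weightC u η τ) (weightD u η τ) 2 =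
        (weightA u η τ * weightB u η τ) * Gam η τ := by
      simp only [coupling, Matrix.cons_val]
      rw [weight_quadratic hτ h4]; ring
    rw [e0, e1, e2, hamiltonian_smul, Matrix.smul_mul, Matrix.mul_smul] at h
    rw [transfer_eq_pathSum]
    exact smul_right_injective _ hu h
  have ha := weightA_self_ne_zero hτ h4 h1
  have hb : dB η τ ≠ 0 := by
    intro h0
    have h := dA_add_dB hτ h4 h1
    have h' := deriv_weightB_self η hτ
    rw [dB] at h0
    rw [h0] at h'
    have h2 := deriv_theta1_ne_zero (im_two_mul_pos hτ)
    have := rho_ne_zero hτ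
    exact (mul_ne_zero (mul_ne_zero this (pow_ne_zero 2 h4)) h2) h'.symm
  -- Sutherland's relation yields the commutation multiplied by `ab`. As `b` has a simple zero at `u
  -- = η` and `a` is nonzero there, one may divide in a punctured neighbourhood; the identity
  -- theorem extends the result to all `u`.
  have hev : ∀ᶠ v in 𝓝[≠] η, weightA v η τ * weightB v η τ ≠ 0 := by
    have hB := ((differentiable_weightB hτ η η).hasDerivAt.eventually_ne (c := 0) hb)
    have hA : ∀ᶠ v in 𝓝[≠] η, weightA v η τ ≠ 0 :=
      ((differentiable_weightA hτ η η).continuousAt.eventually_ne ha).filter_mono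
        nhdsWithin_le_nhds
    filter_upwards [hA, hB] with v h1 h2 using mul_ne_zero h1 h2
  ext s t
  have han : ∀ F : ℂ → Op n, (∀ s t, AnalyticOnNhd ℂ (fun u => F u s t) Set.univ) →
      AnalyticOnNhd ℂ (fun u => (H * F u) s t) Set.univ ∧
        AnalyticOnNhd ℂ (fun u => (F u * H) s t) Set.univ := fun F hF => by
    constructor
    · intro v _
      simp only [Matrix.mul_apply]
      exact Finset.analyticAt_fun_sum _ fun w _ => analyticAt_const.mul (hF w t v trivial)
    · intro v _
      simp only [Matrix.mul_apply]
      exact Finset.analyticAt_fun_sum _ fun w _ => (hF s w v trivial).mul analyticAt_const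
  obtain ⟨hl, hr⟩ := han (fun u => transfer n u η τ) fun s t v _ =>
    analyticAt_transfer hτ analyticAt_id analyticAt_const s t
  have := hl.eq_of_frequently_eq hr (z₀ := η)
    (hev.mono fun v hv => by rw [hgen v hv]).frequently
  exact congrFun this u

end TransferDerivatives

/-! ### The correlations from the eigenvalue of the transfer matrix -/

section Calculus

/-- The second mixed derivative from the first derivative along the diagonal. -/
lemma mixed_derivative {l : ℂ → ℂ → ℂ} {x : ℂ} (hl : AnalyticAt ℂ (fun p : ℂ × ℂ => l p.1 p.2) (x, x))
    {e : ℂ → ℂ} {e' : ℂ} (he : HasDerivAt e e' x)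
    (hdiag : ∀ᶠ η in 𝓝 x, deriv (fun u => l u η) η = e η * l η η) :
    deriv (deriv fun u => l u x) x + deriv (fun η => deriv (fun u => l u η) x) x =
      e' * l x x + e x * (deriv (fun u => l u x) x + deriv (fun η => l x η) x) := by
  set h : ℂ × ℂ → ℂ := fun p => l p.1 p.2 with hh
  set F : ℂ × ℂ → ℂ := fun p => fderiv ℂ h p (1, 0) with hF
  have hFan : AnalyticAt ℂ F (x, x) :=
    (ContinuousLinearMap.analyticAt (ContinuousLinearMap.apply ℂ ℂ ((1 : ℂ), (0 : ℂ))) _).comp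
      hl.fderiv
  have hdh := hl.differentiableAt.hasFDerivAt
  have hdF := hFan.differentiableAt.hasFDerivAt
  have line1 : ∀ u η : ℂ, HasDerivAt (fun u : ℂ => (u, η)) ((1 : ℂ), (0 : ℂ)) u := fun u η =>
    (hasDerivAt_id u).prodMk (hasDerivAt_const u η)
  have line2 : ∀ u η : ℂ, HasDerivAt (fun η : ℂ => (u, η)) ((0 : ℂ), (1 : ℂ)) η := fun u η =>
    (hasDerivAt_const η u).prodMk (hasDerivAt_id η)
  have line3 : HasDerivAt (fun η : ℂ => (η, η)) ((1 : ℂ), (1 : ℂ)) x :=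
    (hasDerivAt_id x).prodMk (hasDerivAt_id x)
  have hev : ∀ᶠ p in 𝓝 (x, x), deriv (fun u => l u p.2) p.1 = F p := by
    filter_upwards [hl.eventually_analyticAt] with p hp
    have : HasDerivAt (fun u => h (u, p.2)) (fderiv ℂ h (p.1, p.2) (1, 0)) p.1 :=
      HasFDerivAt.comp_hasDerivAt (f := fun u : ℂ => (u, p.2)) p.1
        hp.differentiableAt.hasFDerivAt (line1 p.1 p.2)
    exact this.deriv
  have e1 : deriv (deriv fun u => l u x) x = fderiv ℂ F (x, x) (1, 0) := by
    have h1 : (deriv fun u => l u x) =ᶠ[𝓝 x] fun u => F (u, x) :=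
      (line1 x x).continuousAt.eventually hev
    rw [h1.deriv_eq]
    exact (HasFDerivAt.comp_hasDerivAt (f := fun u : ℂ => (u, x)) x hdF (line1 x x)).deriv
  have e2 : deriv (fun η => deriv (fun u => l u η) x) x = fderiv ℂ F (x, x) (0, 1) := by
    have h1 : (fun η => deriv (fun u => l u η) x) =ᶠ[𝓝 x] fun η => F (x, η) :=
      (line2 x x).continuousAt.eventually hev
    rw [h1.deriv_eq]
    exact (HasFDerivAt.comp_hasDerivAt (f := fun η : ℂ => (x, η)) x hdF (line2 x x)).deriv
  have e3 : deriv (fun u => l u x) x = fderiv ℂ h (x, x) (1, 0) :=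
    (HasFDerivAt.comp_hasDerivAt (f := fun u : ℂ => (u, x)) x hdh (line1 x x)).deriv
  have e4 : deriv (fun η => l x η) x = fderiv ℂ h (x, x) (0, 1) :=
    (HasFDerivAt.comp_hasDerivAt (f := fun η : ℂ => (x, η)) x hdh (line2 x x)).deriv
  have hsplit : ((1 : ℂ), (1 : ℂ)) = (1, 0) + (0, 1) := by simp
  have e5 : HasDerivAt (fun η => F (η, η)) (fderiv ℂ F (x, x) (1, 1)) x :=
    HasFDerivAt.comp_hasDerivAt (f := fun η : ℂ => (η, η)) x hdF line3
  have e6 : HasDerivAt (fun η => l η η) (fderiv ℂ h (x, x) (1, 1)) x :=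
    HasFDerivAt.comp_hasDerivAt (f := fun η : ℂ => (η, η)) x hdh line3
  have h1 : (fun η => F (η, η)) =ᶠ[𝓝 x] fun η => e η * l η η := by
    filter_upwards [line3.continuousAt.eventually hev, hdiag] with η h1 h2
    rw [← h1, h2]
  have h2 := e5.unique ((he.mul e6).congr_of_eventuallyEq h1)
  rw [e1, e2, e3, e4, ← map_add, ← map_add, ← hsplit]
  exact h2

lemma hasDerivAt_dotProduct_mulVec {n : ℕ} (A : Op n) (ρ : Conf n → ℂ) {Ψ : ℂ → Conf n → ℂ}
    {Ψ' : Conf n → ℂ} {x : ℂ} (h : HasDerivAt Ψ Ψ' x) :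
    HasDerivAt (fun η => ρ ⬝ᵥ A.mulVec (Ψ η)) (ρ ⬝ᵥ A.mulVec Ψ') x := by
  simp only [dotProduct, Matrix.mulVec]
  exact HasDerivAt.fun_sum fun s _ => (HasDerivAt.fun_sum fun t _ =>
    (hasDerivAt_pi.mp h t).const_mul _).const_mul _

end Calculus

/-! ### Analyticity of the eigenvalue and the derivative of the energy. -/

section Family
variable {n : ℕ} {τ : ℂ} {ζ : ℝ} {Ψ : ℂ → Conf n → ℂ} {Λ : ℂ → ℂ → ℂ}

/-- The sum of the bond operators. -/
def bondSum (n : ℕ) (A : Matrix (Fin 2) (Fin 2) ℂ) : Op n := ∑ j, bond A j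

lemma hamiltonian_eq_bondSum (Jx Jy Jz : ℂ) : hamiltonian n Jx Jy Jz =
    -(1 / 2 : ℂ) • (Jx • bondSum n sigmaX + Jy • bondSum n sigmaY + Jz • bondSum n sigmaZ) := by
  simp only [hamiltonian, bondSum, Finset.sum_add_distrib, Finset.smul_sum]

lemma dotProduct_hamiltonian (Jx Jy Jz : ℂ) (φ ψ : Conf n → ℂ) :
    φ ⬝ᵥ (hamiltonian n Jx Jy Jz).mulVec ψ = -(1 / 2) * (Jx * (φ ⬝ᵥ (bondSum n sigmaX).mulVec ψ) +
      Jy * (φ ⬝ᵥ (bondSum n sigmaY).mulVec ψ) + Jz * (φ ⬝ᵥ (bondSum n sigmaZ).mulVec ψ)) := by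
  rw [hamiltonian_eq_bondSum, Matrix.smul_mulVec, Matrix.add_mulVec, Matrix.add_mulVec,
    Matrix.smul_mulVec, Matrix.smul_mulVec, Matrix.smul_mulVec]
  simp only [dotProduct_smul, dotProduct_add, smul_eq_mul]

lemma bondSum_symm (hn : n ≠ 0) (x : Fin 4) (φ ψ : Conf n → ℂ) :
    φ ⬝ᵥ (bondSum n (sig x)).mulVec ψ = (bondSum n (sig x)).mulVec φ ⬝ᵥ ψ := by
  simp only [bondSum, Matrix.sum_mulVec, dotProduct_sum, sum_dotProduct, bond_sig_symm hn]

/-- The bilinear pairing is used rather than the Hermitian one: for complex couplings the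
Hamiltonian is symmetric but not self-adjoint. -/
lemma hamiltonian_symm (hn : n ≠ 0) (Jx Jy Jz : ℂ) (φ ψ : Conf n → ℂ) :
    φ ⬝ᵥ (hamiltonian n Jx Jy Jz).mulVec ψ = (hamiltonian n Jx Jy Jz).mulVec φ ⬝ᵥ ψ := by
  rw [dotProduct_comm ((hamiltonian n Jx Jy Jz).mulVec φ), dotProduct_hamiltonian,
    dotProduct_hamiltonian]
  have h1 := bondSum_symm hn 1 φ ψ
  have h2 := bondSum_symm hn 2 φ ψ
  have h3 := bondSum_symm hn 3 φ ψ
  rw [dotProduct_comm _ ψ] at h1 h2 h3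
  have e1 : sig 1 = sigmaX := rfl
  have e2 : sig 2 = sigmaY := rfl
  have e3 : sig 3 = sigmaZ := rfl
  rw [e1] at h1
  rw [e2] at h2
  rw [e3] at h3
  rw [h1, h2, h3]

/-- A real vector as a complex one. -/
def toC (r : Conf n → ℝ) : Conf n → ℂ := fun s => (r s : ℂ)

lemma star_toC (r : Conf n → ℝ) : star (toC r) = toC r := by funext s; simp [toC]

lemma toC_dotProduct_self (r : Conf n → ℝ) : toC r ⬝ᵥ toC r = (sqNorm r : ℝ) := by
  have h := star_dotProduct_self (toC r)
  rw [star_toC] at h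
  rw [h, sqNorm, corr]
  simp [toC]

lemma toC_bondSumX {r : Conf n → ℝ} (hr : ∀ s, r (rot s) = r s) :
    toC r ⬝ᵥ (bondSum n sigmaX).mulVec (toC r) = (2 * n + 1) * (corrX r : ℝ) := by
  have h : ∀ j : Fin (2 * n + 1), toC r ⬝ᵥ (bond sigmaX j).mulVec (toC r) = (corrX r : ℝ) := by
    intro j
    have h := star_dotProduct_bondX (toC r) j
    rw [star_toC] at h
    rw [h, ← corrX_eq hr j, corr]
    simp [toC]
  simp [bondSum, Matrix.sum_mulVec, dotProduct_sum, h]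

lemma toC_bondSumY (hn : n ≠ 0) {r : Conf n → ℝ} (hr : ∀ s, r (rot s) = r s) :
    toC r ⬝ᵥ (bondSum n sigmaY).mulVec (toC r) = (2 * n + 1) * (corrY r : ℝ) := by
  have h : ∀ j : Fin (2 * n + 1), toC r ⬝ᵥ (bond sigmaY j).mulVec (toC r) = (corrY r : ℝ) := by
    intro j
    have h := star_dotProduct_bondY hn (toC r) j
    rw [star_toC] at h
    rw [h, ← corrY_eq hr j, corr]
    push_cast
    refine Finset.sum_congr rfl fun s _ => ?_
    simp [toC]
    ring
  simp [bondSum, Matrix.sum_mulVec, dotProduct_sum, h]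

lemma toC_bondSumZ {r : Conf n → ℝ} (hr : ∀ s, r (rot s) = r s) :
    toC r ⬝ᵥ (bondSum n sigmaZ).mulVec (toC r) = (2 * n + 1) * (corrZ r : ℝ) := by
  have h : ∀ j : Fin (2 * n + 1), toC r ⬝ᵥ (bond sigmaZ j).mulVec (toC r) = (corrZ r : ℝ) := by
    intro j
    have h := star_dotProduct_bondZ (toC r) j
    rw [star_toC] at h
    rw [h, ← corrZ_eq hr j, corr]
    push_cast
    refine Finset.sum_congr rfl fun s _ => ?_
    simp [toC]
    ring
  simp [bondSum, Matrix.sum_mulVec, dotProduct_sum, h]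

lemma susyHamiltonian_toC (hn : n ≠ 0) {r : Conf n → ℝ} (h : IsEvenMode n ζ r) :
    (susyHamiltonian n ζ).mulVec (toC r) = (groundEnergy n ζ : ℂ) • toC r :=
  ((hasEigenvector_iff _ _ _).mp (h.hasEigenvector hn)).1

lemma susyHamiltonian_eq_hamiltonian (hτ : 0 < τ.im) (hζ : zeta eta0 τ = (ζ : ℂ)) :
    susyHamiltonian n ζ =
      hamiltonian n (1 + zeta eta0 τ) (1 - zeta eta0 τ) (Gam eta0 τ) := by
  rw [susyHamiltonian, Gam_eta0 hτ, hζ]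

lemma ne_zero_of_zeta (hτ : 0 < τ.im) (hζ : zeta eta0 τ = (ζ : ℂ)) : ζ ≠ 0 := by
  rintro rfl
  exact zeta_eta0_ne_zero hτ (by simpa using hζ)

lemma IsGroundStateFamily.exists_eq_smul (hn : n ≠ 0) (hz : ζ ≠ 0)
    (F : IsGroundStateFamily n τ ζ Ψ Λ) {r : Conf n → ℝ} (hr : IsEvenMode n ζ r) :
    ∃ c : ℂ, c ≠ 0 ∧ Ψ eta0 = c • toC r := by
  have hg := (isGroundState_iff hn hz _).mp F.ground
  obtain ⟨c, hc⟩ := hr.span (Ψ eta0) (isEven_iff.mp F.even.self_of_nhds) hg.1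
  have h : Ψ eta0 = c • toC r := funext hc
  refine ⟨c, ?_, h⟩
  rintro rfl
  exact hg.2 (by rw [h, zero_smul])

lemma analyticAt_dotProduct_transfer {V : Type*} [NormedAddCommGroup V] [NormedSpace ℂ V]
    (hτ : 0 < τ.im) {f g : V → ℂ} {ψ : V → Conf n → ℂ} {x : V}
    (hf : AnalyticAt ℂ f x) (hg : AnalyticAt ℂ g x) (hψ : AnalyticAt ℂ ψ x) (ρ : Conf n → ℂ) :
    AnalyticAt ℂ (fun y => ρ ⬝ᵥ (transfer n (f y) (g y) τ).mulVec (ψ y)) x := by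
  simp only [dotProduct, Matrix.mulVec]
  exact Finset.analyticAt_fun_sum _ fun s _ => analyticAt_const.mul
    (Finset.analyticAt_fun_sum _ fun t _ => (analyticAt_transfer hτ hf hg s t).mul
      (analyticAt_pi_iff.mp hψ t))

lemma analyticAt_dotProduct {V : Type*} [NormedAddCommGroup V] [NormedSpace ℂ V]
    {ψ : V → Conf n → ℂ} {x : V} (hψ : AnalyticAt ℂ ψ x) (ρ : Conf n → ℂ) :
    AnalyticAt ℂ (fun y => ρ ⬝ᵥ ψ y) x := by
  simp only [dotProduct]
  exact Finset.analyticAt_fun_sum _ fun s _ => analyticAt_const.mul (analyticAt_pi_iff.mp hψ s)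

/-- No regularity of `Λ` is part of the definition of a family. Pairing the eigenvalue equation with
a fixed vector exhibits `Λ` as a quotient of analytic functions. -/
lemma IsGroundStateFamily.analyticAt_eigenvalue (hτ : 0 < τ.im)
    (F : IsGroundStateFamily n τ ζ Ψ Λ) {ρ : Conf n → ℂ} (hρ : ρ ⬝ᵥ Ψ eta0 ≠ 0) :
    AnalyticAt ℂ (fun p : ℂ × ℂ => Λ p.1 p.2) (eta0, eta0) := by
  have h1 : AnalyticAt ℂ (fun p : ℂ × ℂ => Ψ p.2) (eta0, eta0) :=
    AnalyticAt.comp (f := fun p : ℂ × ℂ => p.2) (g := Ψ) F.analytic analyticAt_snd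
  have h2 := (analyticAt_dotProduct_transfer hτ analyticAt_fst analyticAt_snd h1 ρ).div
    (analyticAt_dotProduct h1 ρ) hρ
  refine h2.congr ?_
  have h3 : ∀ᶠ η in 𝓝 eta0, ρ ⬝ᵥ Ψ η ≠ 0 :=
    (analyticAt_dotProduct F.analytic ρ).continuousAt.eventually_ne hρ
  have h4 := (continuous_snd.tendsto ((eta0, eta0) : ℂ × ℂ)).eventually
    (h3.and F.transfer_eigen)
  filter_upwards [h4] with p hp
  show (ρ ⬝ᵥ (transfer n p.1 p.2 τ).mulVec (Ψ p.2)) / (ρ ⬝ᵥ Ψ p.2) = Λ p.1 p.2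
  rw [hp.2 p.1, dotProduct_smul, smul_eq_mul, mul_div_cancel_right₀ _ hp.1]

/-- Hellmann–Feynman derivative of the energy along the family. -/
lemma IsGroundStateFamily.hasDerivAt_energy (hn : n ≠ 0) (hτ : 0 < τ.im)
    (hζ : zeta eta0 τ = (ζ : ℂ)) (F : IsGroundStateFamily n τ ζ Ψ Λ) {r : Conf n → ℝ}
    (hr : IsEvenMode n ζ r) :
    HasDerivAt (fun η => (toC r ⬝ᵥ (hamiltonian n (1 + zeta η τ) (1 - zeta η τ)
        (Gam η τ)).mulVec (Ψ η)) / (toC r ⬝ᵥ Ψ η))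
      (-(1 / 2) * (2 * n + 1) * (deriv (fun η => Gam η τ) eta0 +
        4 * (corrQuantity ζ r : ℝ) / ((ζ : ℂ) ^ 2 + 3) * (zeta eta0 τ *
          deriv (fun η => zeta η τ) eta0 - deriv (fun η => Gam η τ) eta0))) eta0 := by
  have hz := ne_zero_of_zeta hτ hζ
  obtain ⟨c, hc, hΨ⟩ := F.exists_eq_smul hn hz hr
  have hN := sqNorm_pos hr.ne_zero
  have hNc : (sqNorm r : ℂ) ≠ 0 := by exact_mod_cast hN.ne'
  have h4 := theta4_two_eta0_ne_zero hτ
  have dΨ := F.analytic.differentiableAt.hasDerivAt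
  have dz := (analyticAt_zeta hτ h4).differentiableAt.hasDerivAt
  have dG := (analyticAt_Gam hτ h4).differentiableAt.hasDerivAt
  set z' := deriv (fun η => zeta η τ) eta0
  set G' := deriv (fun η => Gam η τ) eta0
  have dX := hasDerivAt_dotProduct_mulVec (bondSum n sigmaX) (toC r) dΨ
  have dY := hasDerivAt_dotProduct_mulVec (bondSum n sigmaY) (toC r) dΨ
  have dZ := hasDerivAt_dotProduct_mulVec (bondSum n sigmaZ) (toC r) dΨ
  have dN := hasDerivAt_dotProduct_mulVec 1 (toC r) dΨ
  simp only [Matrix.one_mulVec] at dN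
  have hsymm : ∀ ψ, toC r ⬝ᵥ (hamiltonian n (1 + zeta eta0 τ) (1 - zeta eta0 τ)
      (Gam eta0 τ)).mulVec ψ = groundEnergy n ζ * (toC r ⬝ᵥ ψ) := fun ψ => by
    rw [hamiltonian_symm hn, ← susyHamiltonian_eq_hamiltonian hτ hζ, susyHamiltonian_toC hn hr,
      smul_dotProduct, smul_eq_mul]
  -- By symmetry the derivative of the eigenvector contributes `E₀` times the derivative of the
  -- denominator, and so drops out of the derivative of the quotient.
  have h1 := hsymm (deriv Ψ eta0)
  have h0 := hsymm (Ψ eta0)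
  rw [dotProduct_hamiltonian] at h1 h0
  have hX : toC r ⬝ᵥ (bondSum n sigmaX).mulVec (Ψ eta0) = c * ((2 * n + 1) * (corrX r : ℝ)) := by
    rw [hΨ, Matrix.mulVec_smul, dotProduct_smul, toC_bondSumX hr.cyc, smul_eq_mul]
  have hY : toC r ⬝ᵥ (bondSum n sigmaY).mulVec (Ψ eta0) = c * ((2 * n + 1) * (corrY r : ℝ)) := by
    rw [hΨ, Matrix.mulVec_smul, dotProduct_smul, toC_bondSumY hn hr.cyc, smul_eq_mul]
  have hZ : toC r ⬝ᵥ (bondSum n sigmaZ).mulVec (Ψ eta0) = c * ((2 * n + 1) * (corrZ r : ℝ)) := by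
    rw [hΨ, Matrix.mulVec_smul, dotProduct_smul, toC_bondSumZ hr.cyc, smul_eq_mul]
  have hNN : toC r ⬝ᵥ Ψ eta0 = c * (sqNorm r : ℝ) := by
    rw [hΨ, dotProduct_smul, toC_dotProduct_self, smul_eq_mul]
  have hne : toC r ⬝ᵥ Ψ eta0 ≠ 0 := by rw [hNN]; exact mul_ne_zero hc hNc
  have dH := ((((dz.const_add 1).mul dX).add ((dz.const_sub 1).mul dY)).add (dG.mul dZ)).const_mul
    (-(1 / 2 : ℂ))
  have hquot := dH.div dN hne
  have hfun : (fun η => (toC r ⬝ᵥ (hamiltonian n (1 + zeta η τ) (1 - zeta η τ)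
        (Gam η τ)).mulVec (Ψ η)) / (toC r ⬝ᵥ Ψ η)) = fun η => -(1 / 2) * ((1 + zeta η τ) *
      (toC r ⬝ᵥ (bondSum n sigmaX).mulVec (Ψ η)) + (1 - zeta η τ) *
      (toC r ⬝ᵥ (bondSum n sigmaY).mulVec (Ψ η)) + Gam η τ *
      (toC r ⬝ᵥ (bondSum n sigmaZ).mulVec (Ψ η))) / (toC r ⬝ᵥ Ψ η) := funext fun η => by
    rw [dotProduct_hamiltonian]
  rw [hfun]
  refine hquot.congr_deriv ?_
  have hS := hr.corr_stationary hn hz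
  have hSc : (corrX r : ℂ) - corrY r + ζ * corrZ r = ζ * sqNorm r := by exact_mod_cast hS
  have h3 : ((ζ : ℂ) ^ 2 + 3) ≠ 0 := by exact_mod_cast (by positivity : ζ ^ 2 + 3 ≠ 0)
  simp only [Pi.mul_apply, Pi.add_apply]
  rw [h0, ← mul_div_mul_right _ _ hc]
  rw [div_eq_iff (by simp [hne, hc]), hNN, corrQuantity]
  rw [hX, hY, hZ]
  push_cast
  rw [hζ] at h1 ⊢
  field_simp
  linear_combination 2 * h1 - z' * c * (2 * n + 1) * hSc

end Family

/-! ### The mixed derivative of the eigenvalue. -/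

section Formula
variable {n : ℕ} {τ : ℂ} {ζ : ℝ} {Ψ : ℂ → Conf n → ℂ} {Λ : ℂ → ℂ → ℂ}

/-- The ratio `b'/a` at the shift point. -/
def slopeRatio (τ η : ℂ) : ℂ := thetaQuotSlope τ / thetaQuot (2 * η) τ

lemma dB_eq {η : ℂ} (hτ : 0 < τ.im) (h4 : theta4 (2 * η) (2 * τ) ≠ 0)
    (h1 : theta1 (2 * η) (2 * τ) ≠ 0) : dB η τ = slopeRatio τ η * weightA η η τ := by
  rw [slopeRatio, ← deriv_weightB_div_weightA hτ h4 h1,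
    div_mul_cancel₀ _ (weightA_self_ne_zero hτ h4 h1)]
  rfl

lemma differentiableAt_slopeRatio (hτ : 0 < τ.im) : DifferentiableAt ℂ (slopeRatio τ) eta0 := by
  have h4 := theta4_two_eta0_ne_zero hτ
  have h1 := theta1_two_eta0_ne_zero hτ
  have h := ((hasDerivAt_thetaQuot hτ h4).comp eta0
    ((hasDerivAt_id eta0).const_mul 2)).differentiableAt
  refine DifferentiableAt.div (differentiableAt_const _) h ?_
  exact div_ne_zero h1 h4

/-- Arranged so that the energy enters only through `L(1 + Γ/2) + E`, which vanishes at the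
supersymmetric point; the derivative of `slopeRatio` then does not contribute there. -/
lemma logSlope_eq {η : ℂ} (hτ : 0 < τ.im) (h4 : theta4 (2 * η) (2 * τ) ≠ 0)
    (h1 : theta1 (2 * η) (2 * τ) ≠ 0) (E : ℂ) : logSlope n η τ E =
      ((2 * n + 1) * logTheta τ η -
        slopeRatio τ η * ((2 * n + 1) * (1 + Gam η τ / 2) + E)) * weightA η η τ := by
  rw [logSlope]
  linear_combination (2 * (n : ℂ) + 1) * dA_add_dB hτ h4 h1 -
    (2 * (n : ℂ) + 1) / 2 * dA_sub_dC hτ h4 h1 -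
    ((2 * n + 1) * (1 + Gam η τ / 2) + E) * dB_eq hτ h4 h1

/-- The formula for the correlations in terms of the transfer matrix eigenvalue. -/
theorem IsGroundStateFamily.corrQuantity_eq (hn : n ≠ 0) (hτ : 0 < τ.im)
    (hζ : zeta eta0 τ = (ζ : ℂ)) (F : IsGroundStateFamily n τ ζ Ψ Λ) {r : Conf n → ℝ}
    (hr : IsEvenMode n ζ r) :
    AnalyticAt ℂ (fun p : ℂ × ℂ => Λ p.1 p.2) (eta0, eta0) ∧ Λ eta0 eta0 ≠ 0 ∧
      ((corrQuantity ζ r : ℝ) : ℂ) = ((ζ : ℂ) ^ 2 + 3) / (12 * (2 * (n : ℂ) + 1) * chi τ) *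
        ((deriv (fun η => deriv (fun u => Λ u η) eta0) eta0 * Λ eta0 eta0 -
          deriv (fun u => Λ u eta0) eta0 * deriv (fun η => Λ eta0 η) eta0) /
            Λ eta0 eta0 ^ 2) := by
  have hz := ne_zero_of_zeta hτ hζ
  obtain ⟨c, hc, hΨ⟩ := F.exists_eq_smul hn hz hr
  have hNc : (sqNorm r : ℂ) ≠ 0 := by exact_mod_cast (sqNorm_pos hr.ne_zero).ne'
  have hne : toC r ⬝ᵥ Ψ eta0 ≠ 0 := by
    rw [hΨ, dotProduct_smul, toC_dotProduct_self, smul_eq_mul]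
    exact mul_ne_zero hc hNc
  have han := F.analyticAt_eigenvalue hτ hne
  have h4 := theta4_two_eta0_ne_zero hτ
  have h1 := theta1_two_eta0_ne_zero hτ
  have ha := weightA_self_ne_zero hτ h4 h1
  set L : ℂ := 2 * (n : ℂ) + 1 with hL
  have hL0 : L ≠ 0 := by
    rw [hL]; exact_mod_cast (by positivity : (2 * (n : ℝ) + 1) ≠ 0)
  set E : ℂ → ℂ := fun η => (toC r ⬝ᵥ (hamiltonian n (1 + zeta η τ) (1 - zeta η τ)
    (Gam η τ)).mulVec (Ψ η)) / (toC r ⬝ᵥ Ψ η) with hE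
  have dE := F.hasDerivAt_energy hn hτ hζ hr
  rw [← hE] at dE
  have hEe : ∀ᶠ η in 𝓝 eta0, Ψ η ≠ 0 ∧ (hamiltonian n (1 + zeta η τ) (1 - zeta η τ)
      (Gam η τ)).mulVec (Ψ η) = E η • Ψ η := by
    have h3 : ∀ᶠ η in 𝓝 eta0, toC r ⬝ᵥ Ψ η ≠ 0 :=
      (analyticAt_dotProduct F.analytic _).continuousAt.eventually_ne hne
    filter_upwards [F.eigen, h3] with η hη h3
    obtain ⟨e, he⟩ := hη
    rw [hasEigenvector_iff] at he
    refine ⟨he.2, ?_⟩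
    rw [hE]
    simp only [he.1, dotProduct_smul, smul_eq_mul, mul_div_cancel_right₀ _ h3]
  have hjet : ∀ᶠ η in 𝓝 eta0, Λ η η ≠ 0 ∧ deriv (fun u => Λ u η) η =
      (L * logTheta τ η - slopeRatio τ η * (L * (1 + Gam η τ / 2) + E η)) * Λ η η := by
    filter_upwards [hEe, F.transfer_eigen, eventually_theta4_ne_zero hτ,
      eventually_theta1_ne_zero hτ] with η hη hT h4 h1
    obtain ⟨h2, h3⟩ := transfer_eigenvalue_jet (l := fun u => Λ u η) hn hτ h4 h1 hη.1 hT hη.2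
    refine ⟨h2, mul_left_cancel₀ (weightA_self_ne_zero hτ h4 h1) ?_⟩
    rw [h3, logSlope_eq hτ h4 h1]
    ring
  have hΛ0 := hjet.self_of_nhds.1
  refine ⟨han, hΛ0, ?_⟩
  have dlog := hasDerivAt_logTheta hτ (theta1_ne_zero_of_weightA hτ ha)
  have dlog' := dlog.differentiableAt.hasDerivAt
  have dB' := (differentiableAt_slopeRatio hτ).hasDerivAt
  have dG := (analyticAt_Gam hτ h4).differentiableAt.hasDerivAt
  have dl := (dlog'.const_mul L).sub (dB'.mul ((((dG.div_const 2).const_add 1).const_mul L).add dE))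
  have hmixed := mixed_derivative han dl (hjet.mono fun η h => h.2)
  -- At `η = π/3` the family is a multiple of the rotation-invariant even mode, so the
  -- second-derivative formula is available at this point.
  have hT0 : ∀ u, (transfer n u eta0 τ).mulVec (toC r) = Λ u eta0 • toC r := fun u => by
    have h := F.transfer_eigen.self_of_nhds u
    rw [hΨ, Matrix.mulVec_smul, smul_comm] at h
    exact smul_right_injective _ hc h
  have hE0 : E eta0 = groundEnergy n ζ := by
    rw [hE]
    simp only
    rw [← susyHamiltonian_eq_hamiltonian hτ hζ, hΨ, Matrix.mulVec_smul, susyHamiltonian_toC hn hr,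
      smul_comm, dotProduct_smul, smul_eq_mul, mul_div_cancel_right₀]
    rw [← hΨ]; exact hne
  have hHr : (hamiltonian n (1 + zeta eta0 τ) (1 - zeta eta0 τ) (Gam eta0 τ)).mulVec (toC r) =
      E eta0 • toC r := by
    rw [← susyHamiltonian_eq_hamiltonian hτ hζ, hE0, susyHamiltonian_toC hn hr]
  have hrot : ∀ s, toC r (rot s) = toC r s := fun s => by simp only [toC, hr.cyc]
  have hsecond := transfer_eigenvalue_second (l := fun u => Λ u eta0) hn hτ h4 h1 hrot
    (by rw [toC_dotProduct_self]; exact hNc) hT0 hHr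
  have hfirst := hjet.self_of_nhds.2
  rw [logSlope_eq hτ h4 h1, jetConst_eta0 hτ, ← hL] at hsecond
  have hbal : L * (1 + Gam eta0 τ / 2) + E eta0 = 0 := by
    rw [hE0, Gam_eta0 hτ, hζ, groundEnergy, hL]
    push_cast; ring
  rw [hbal, mul_zero, sub_zero] at hsecond hfirst
  have hsecond' : deriv (deriv fun u => Λ u eta0) eta0 =
      ((L * logTheta τ eta0) ^ 2 + L * deriv (logTheta τ) eta0) * Λ eta0 eta0 := by
    refine mul_left_cancel₀ (pow_ne_zero 2 ha) ?_
    linear_combination hsecond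
  simp only [Pi.add_apply, Pi.sub_apply, Pi.mul_apply] at hmixed
  rw [hbal, mul_zero, zero_add, mul_zero, sub_zero] at hmixed
  rw [hsecond', hfirst] at hmixed
  rw [hfirst]
  have hchi := six_mul_chi hτ
  have hB : thetaQuotSlope τ / thetaQuot (2 * eta0) τ = slopeRatio τ eta0 := rfl
  rw [hB] at hchi
  have h3 : ((ζ : ℂ) ^ 2 + 3) ≠ 0 := by exact_mod_cast (by positivity : ζ ^ 2 + 3 ≠ 0)
  have hχ := chi_ne_zero hτ
  set z' := deriv (fun η => zeta η τ) eta0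
  set G' := deriv (fun η => Gam η τ) eta0
  set f : ℂ := ((corrQuantity ζ r : ℝ) : ℂ)
  set l0 := Λ eta0 eta0
  set m := deriv (fun η => deriv (fun u => Λ u η) eta0) eta0
  set le := deriv (fun η => Λ eta0 η) eta0
  have hm : m * l0 - L * logTheta τ eta0 * l0 * le =
      12 * L * chi τ * f / ((ζ : ℂ) ^ 2 + 3) * l0 ^ 2 := by
    have e1 : slopeRatio τ eta0 * (L * (G' / 2) + (-(1 / 2) * L * (G' +
        4 * f / ((ζ : ℂ) ^ 2 + 3) * (zeta eta0 τ * z' - G')))) =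
        -(12 * L * chi τ * f / ((ζ : ℂ) ^ 2 + 3)) := by
      field_simp
      linear_combination (-4 * f) * hchi
    rw [e1] at hmixed
    linear_combination l0 * hmixed
  rw [hm]
  field_simp

end Formula

/-! ### Analytic continuation of a simple eigenvector. -/

section Perturbation
variable {ι : Type*} [Fintype ι]

/-- An even eigenvector of a symmetric matrix, unique up to scalars. The matrix is only required to
be symmetric against the vector, and to map vectors supported on `P` to such vectors. -/
structure IsSimpleEigen (P : ι → Prop) (A : Matrix ι ι ℂ) (e : ℂ) (ρ : ι → ℂ) : Prop where
  supp : ∀ s, ¬ P s → ρ s = 0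
  block : ∀ s t, ¬ P s → P t → A s t = 0
  eigen : A.mulVec ρ = e • ρ
  symm : ∀ ψ, ρ ⬝ᵥ A.mulVec ψ = A.mulVec ρ ⬝ᵥ ψ
  self_ne : ρ ⬝ᵥ ρ ≠ 0
  span : ∀ ψ, (∀ s, ¬ P s → ψ s = 0) → A.mulVec ψ = e • ψ → ∃ c : ℂ, ψ = c • ρ

variable {P : ι → Prop} [DecidablePred P] {A : Matrix ι ι ℂ} {e : ℂ} {ρ : ι → ℂ}

lemma mulVec_eq_zero_of_block (h : ∀ s t, ¬ P s → P t → A s t = 0) {ψ : ι → ℂ}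
    (hψ : ∀ s, ¬ P s → ψ s = 0) {s : ι} (hs : ¬ P s) : A.mulVec ψ s = 0 := by
  refine Finset.sum_eq_zero fun t _ => ?_
  by_cases ht : P t
  · simp only [h s t hs ht, zero_mul]
  · rw [hψ t ht, mul_zero]

/-- Pairing with `ρ` annihilates `(A - e)ψ` by symmetry, so `b = 0`; simplicity then makes `ψ` a
multiple of `ρ`. This gives both the invertible linearization and the uniqueness of nearby
eigenvectors. -/
lemma IsSimpleEigen.eq_zero (h : IsSimpleEigen P A e ρ) {ψ : ι → ℂ} {b : ℂ}
    (hψ : ∀ s, ¬ P s → ψ s = 0) (h1 : ∀ s, P s → A.mulVec ψ s - e * ψ s = b * ρ s) :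
    b = 0 ∧ (ρ ⬝ᵥ ψ = 0 → ψ = 0) := by
  have h2 : A.mulVec ψ = e • ψ + b • ρ := by
    funext s
    by_cases hs : P s
    · simp only [Pi.add_apply, Pi.smul_apply, smul_eq_mul]
      linear_combination h1 s hs
    · simp [mulVec_eq_zero_of_block h.block hψ hs, hψ s hs, h.supp s hs]
  have h3 := h.symm ψ
  rw [h2, h.eigen, dotProduct_add, dotProduct_smul, dotProduct_smul, smul_dotProduct,
    add_eq_left, smul_eq_mul] at h3
  have hb : b = 0 := (mul_eq_zero.mp h3).resolve_right h.self_ne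
  refine ⟨hb, fun h4 => ?_⟩
  rw [hb, zero_smul, add_zero] at h2
  obtain ⟨c, rfl⟩ := h.span ψ hψ h2
  rw [dotProduct_smul, smul_eq_mul] at h4
  rw [(mul_eq_zero.mp h4).resolve_right h.self_ne, zero_smul]

lemma analyticAt_mulVec {V : Type*} [NormedAddCommGroup V] [NormedSpace ℂ V] {A : V → Matrix ι ι ℂ}
    {ψ : V → ι → ℂ} {x : V} (hA : ∀ s t, AnalyticAt ℂ (fun η => A η s t) x)
    (hψ : AnalyticAt ℂ ψ x) (s : ι) : AnalyticAt ℂ (fun η => (A η).mulVec (ψ η) s) x := by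
  simp only [Matrix.mulVec, dotProduct]
  exact Finset.analyticAt_fun_sum _ fun t _ => (hA s t).mul (analyticAt_pi_iff.mp hψ t)

/-- The equations for a normalized eigenvector supported on `P`, with its eigenvalue. -/
def eigenEquation (P : ι → Prop) [DecidablePred P] (ρ : ι → ℂ) (A : ℂ → Matrix ι ι ℂ)
    (p : ℂ × ℂ × (ι → ℂ)) : ℂ × (ι → ℂ) :=
  (ρ ⬝ᵥ p.2.2, fun s => if P s then (A p.1).mulVec p.2.2 s - p.2.1 * p.2.2 s else p.2.2 s)

lemma analyticAt_eigenEquation {A : ℂ → Matrix ι ι ℂ} {p : ℂ × ℂ × (ι → ℂ)}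
    (hA : ∀ s t, AnalyticAt ℂ (fun η => A η s t) p.1) :
    AnalyticAt ℂ (eigenEquation P ρ A) p := by
  have h1 : AnalyticAt ℂ (fun p : ℂ × ℂ × (ι → ℂ) => p.2.2) p :=
    analyticAt_snd.fun_comp analyticAt_snd
  have h2 : AnalyticAt ℂ (fun p : ℂ × ℂ × (ι → ℂ) => p.2.1) p :=
    analyticAt_fst.fun_comp analyticAt_snd
  refine AnalyticAt.prod ?_ (analyticAt_pi_iff.mpr fun s => ?_)
  · simp only [dotProduct]
    exact Finset.analyticAt_fun_sum _ fun s _ => analyticAt_const.mul (analyticAt_pi_iff.mp h1 s)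
  · by_cases hs : P s
    · simp only [hs, if_true]
      refine AnalyticAt.sub (analyticAt_mulVec (fun s t => ?_) h1 s)
        (h2.mul (analyticAt_pi_iff.mp h1 s))
      exact AnalyticAt.fun_comp (f := fun p : ℂ × ℂ × (ι → ℂ) => p.1) (g := fun η => A η s t)
        (hA s t) analyticAt_fst
    · simp only [hs, if_false]
      exact analyticAt_pi_iff.mp h1 s

/-- The partial derivative in eigenvalue and eigenvector is computed along lines; it is an injective
endomorphism of a finite-dimensional space. -/
lemma IsSimpleEigen.isInvertible {A : ℂ → Matrix ι ι ℂ} {x : ℂ}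
    (hA : ∀ s t, AnalyticAt ℂ (fun η => A η s t) x) (h : IsSimpleEigen P (A x) e ρ) :
    (fderiv ℂ (eigenEquation P ρ A) (x, e, ρ) ∘L .inr ℂ ℂ (ℂ × (ι → ℂ))).IsInvertible := by
  set T := fderiv ℂ (eigenEquation P ρ A) (x, e, ρ) ∘L .inr ℂ ℂ (ℂ × (ι → ℂ)) with hT
  have hval : ∀ (b : ℂ) (ψ : ι → ℂ), T (b, ψ) = (ρ ⬝ᵥ ψ, fun s =>
      if P s then (A x).mulVec ψ s - e * ψ s - b * ρ s else ψ s) := by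
    intro b ψ
    have hd : HasFDerivAt (eigenEquation P ρ A) (fderiv ℂ (eigenEquation P ρ A) (x, e, ρ))
        ((fun t : ℂ => (x, e + t * b, ρ + t • ψ)) 0) := by
      simpa using (analyticAt_eigenEquation (P := P) (ρ := ρ) (p := (x, e, ρ))
        hA).differentiableAt.hasFDerivAt
    have hline : HasDerivAt (fun t : ℂ => (x, e + t * b, ρ + t • ψ)) ((0 : ℂ), b, ψ) 0 := by
      refine (hasDerivAt_const _ _).prodMk (HasDerivAt.prodMk ?_ ?_)
      · simpa using ((hasDerivAt_id (0 : ℂ)).mul_const b).const_add e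
      · simpa using ((hasDerivAt_id (0 : ℂ)).smul_const ψ).const_add ρ
    have h1 := hd.comp_hasDerivAt (0 : ℂ) hline
    have h2 : HasDerivAt (eigenEquation P ρ A ∘ fun t : ℂ => (x, e + t * b, ρ + t • ψ))
        (ρ ⬝ᵥ ψ, fun s => if P s then (A x).mulVec ψ s - e * ψ s - b * ρ s else ψ s) 0 := by
      refine HasDerivAt.prodMk ?_ (hasDerivAt_pi.mpr fun s => ?_)
      · simp only [dotProduct_add, dotProduct_smul, smul_eq_mul]
        simpa using ((hasDerivAt_id (0 : ℂ)).mul_const (ρ ⬝ᵥ ψ)).const_add (ρ ⬝ᵥ ρ)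
      · by_cases hs : P s
        · simp only [hs, if_true, Matrix.mulVec_add, Matrix.mulVec_smul, Pi.add_apply,
            Pi.smul_apply, smul_eq_mul]
          have e1 := ((hasDerivAt_id (0 : ℂ)).mul_const ((A x).mulVec ψ s)).const_add
            ((A x).mulVec ρ s)
          have e2 := ((hasDerivAt_id (0 : ℂ)).mul_const b).const_add e
          have e3 := ((hasDerivAt_id (0 : ℂ)).mul_const (ψ s)).const_add (ρ s)
          convert! e1.sub (e2.mul e3) using 1
          simp
          ring
        · simp only [hs, if_false, Pi.add_apply, Pi.smul_apply, smul_eq_mul]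
          simpa using ((hasDerivAt_id (0 : ℂ)).mul_const (ψ s)).const_add (ρ s)
    have h3 := h1.unique h2
    rw [← h3]
    rfl
  have hinj : Function.Injective T := by
    rw [injective_iff_map_eq_zero]
    rintro ⟨b, ψ⟩ h0
    rw [hval, Prod.mk_eq_zero] at h0
    have hs : ∀ s, ¬ P s → ψ s = 0 := fun s hs => by simpa [hs] using congrFun h0.2 s
    obtain ⟨hb, hψ⟩ := h.eq_zero hs (b := b) fun s hs => by
      simpa [hs, sub_eq_zero] using congrFun h0.2 s
    rw [hb, hψ h0.1]
    rfl
  refine ⟨(LinearEquiv.ofInjectiveEndo (T : (ℂ × (ι → ℂ)) →ₗ[ℂ] _) hinj).toContinuousLinearEquiv,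
    ?_⟩
  ext <;> rfl

/-- Analytic continuation of a simple eigenvector. -/
lemma exists_analytic_eigenvector [DecidableEq ι] {A : ℂ → Matrix ι ι ℂ} {x : ℂ}
    (hA : ∀ s t, AnalyticAt ℂ (fun η => A η s t) x)
    (hb : ∀ η s t, ¬ P s → P t → A η s t = 0) (h : IsSimpleEigen P (A x) e ρ) :
    ∃ (Ψ : ℂ → ι → ℂ) (E : ℂ → ℂ), AnalyticAt ℂ Ψ x ∧ Ψ x = ρ ∧ ∀ᶠ η in 𝓝 x,
      Ψ η ≠ 0 ∧ (∀ s, ¬ P s → Ψ η s = 0) ∧ (A η).mulVec (Ψ η) = E η • Ψ η ∧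
      ∀ φ : ι → ℂ, (∀ s, ¬ P s → φ s = 0) → (A η).mulVec φ = E η • φ →
        φ = ((ρ ⬝ᵥ φ) / (ρ ⬝ᵥ ρ)) • Ψ η := by
  have han : AnalyticAt ℂ (eigenEquation P ρ A) (x, e, ρ) := analyticAt_eigenEquation hA
  have cd : ContDiffAt ℂ ⊤ (eigenEquation P ρ A) (x, e, ρ) := han.contDiffAt
  have hinv := h.isInvertible hA
  set g := cd.implicitFunction (by simp) hinv with hg
  have hgan : AnalyticAt ℂ g x :=
    analyticWithinAt_univ.mp (contDiffWithinAt_omega_iff_analyticWithinAt.mp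
      (cd.contDiffAt_implicitFunction (by simp) hinv).contDiffWithinAt)
  have hgx : g x = (e, ρ) := cd.implicitFunction_apply_self (by simp) hinv
  have hge : ∀ᶠ η in 𝓝 x, eigenEquation P ρ A (η, g η) = eigenEquation P ρ A (x, e, ρ) :=
    cd.eventually_apply_implicitFunction (by simp) hinv
  have hE : AnalyticAt ℂ (fun η => (g η).1) x := analyticAt_fst.fun_comp hgan
  have h0 : eigenEquation P ρ A (x, e, ρ) = (ρ ⬝ᵥ ρ, 0) := by
    refine Prod.ext rfl (funext fun s => ?_)
    by_cases hs : P s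
    · simp [eigenEquation, hs, h.eigen]
    · simp [eigenEquation, hs, h.supp s hs]
  -- On `P` this is `A - E` plus the rank-one matrix `ρ ρᵀ`, which removes the kernel at `x`;
  -- outside `P` it is the identity. It stays invertible nearby.
  set N : ℂ → Matrix ι ι ℂ := fun η => Matrix.of fun s t =>
    if P s then A η s t - (g η).1 * (1 : Matrix ι ι ℂ) s t + ρ s * ρ t
    else (1 : Matrix ι ι ℂ) s t with hN
  have hNv : ∀ η v s, (N η).mulVec v s = if P s then
      (A η).mulVec v s - (g η).1 * v s + ρ s * (ρ ⬝ᵥ v) else v s := by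
    intro η v s
    have h1 : ∑ t, (1 : Matrix ι ι ℂ) s t * v t = v s := by
      simpa [Matrix.mulVec, dotProduct] using congrFun (Matrix.one_mulVec v) s
    by_cases hs : P s
    · simp only [hN, Matrix.mulVec, dotProduct, Matrix.of_apply, hs, if_true, add_mul, sub_mul,
        Finset.sum_add_distrib, Finset.sum_sub_distrib, mul_assoc, ← Finset.mul_sum, h1]
    · simp only [hN, Matrix.mulVec, dotProduct, Matrix.of_apply, hs, if_false, h1]
  have hdet0 : (N x).det ≠ 0 := by
    intro hd
    obtain ⟨v, hv, hv0⟩ := Matrix.exists_mulVec_eq_zero_iff.mpr hd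
    have hs : ∀ s, ¬ P s → v s = 0 := fun s hs => by
      simpa [hNv, hs] using congrFun hv0 s
    obtain ⟨h1, h2⟩ := h.eq_zero hs (b := -(ρ ⬝ᵥ v)) fun s hs => by
      have := congrFun hv0 s
      simp only [hNv, hs, if_true, hgx, Pi.zero_apply] at this
      linear_combination this
    exact hv (h2 (neg_eq_zero.mp h1))
  have hdet : ∀ᶠ η in 𝓝 x, (N η).det ≠ 0 := by
    have hc : ContinuousAt (fun η => (N η).det) x := by
      have hN' : ContinuousAt N x := by
        refine continuousAt_pi.mpr fun s => continuousAt_pi.mpr fun t => ?_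
        by_cases hs : P s
        · simp only [hN, Matrix.of_apply, hs, if_true]
          exact (((hA s t).continuousAt).sub (hE.continuousAt.mul continuousAt_const)).add
            continuousAt_const
        · simp only [hN, Matrix.of_apply, hs, if_false]
          exact continuousAt_const
      exact (Continuous.matrix_det continuous_id).continuousAt.comp hN'
    exact hc.eventually_ne hdet0
  refine ⟨fun η => (g η).2, fun η => (g η).1, analyticAt_snd.fun_comp hgan, by simp only [hgx], ?_⟩
  filter_upwards [hge, hdet] with η h1 h2
  rw [h0, Prod.ext_iff] at h1
  have hn : ρ ⬝ᵥ (g η).2 = ρ ⬝ᵥ ρ := h1.1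
  have hs : ∀ s, ¬ P s → (g η).2 s = 0 := fun s hs => by
    simpa [eigenEquation, hs] using congrFun h1.2 s
  have heig : (A η).mulVec (g η).2 = (g η).1 • (g η).2 := by
    funext s
    by_cases hP : P s
    · simpa [eigenEquation, hP, sub_eq_zero] using congrFun h1.2 s
    · simp [mulVec_eq_zero_of_block (hb η) hs hP, hs s hP]
  refine ⟨fun hz => h.self_ne (by rw [← hn, hz, dotProduct_zero]), hs, heig, fun φ hφ hφe => ?_⟩
  -- This multiple makes the difference orthogonal to `ρ`, so the difference lies in the kernel of
  -- `N η`.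
  set c := (ρ ⬝ᵥ φ) / (ρ ⬝ᵥ ρ) with hc
  by_contra hne
  refine h2 (Matrix.exists_mulVec_eq_zero_iff.mp ⟨φ - c • (g η).2, sub_ne_zero.mpr hne, ?_⟩)
  funext s
  have hd : ρ ⬝ᵥ (φ - c • (g η).2) = 0 := by
    rw [dotProduct_sub, dotProduct_smul, hn, hc, smul_eq_mul, div_mul_cancel₀ _ h.self_ne, sub_self]
  rw [hNv, hd, Matrix.mulVec_sub, Matrix.mulVec_smul, hφe, heig]
  by_cases hP : P s
  · simp [hP]; ring
  · simp [hP, hφ s hP, hs s hP]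

end Perturbation

/-! ### Existence of the family. -/

section Existence
variable {n : ℕ} {τ : ℂ} {ζ : ℝ}

lemma hamiltonian_apply_eq_zero (hn : n ≠ 0) (Jx Jy Jz : ℂ) {s t : Conf n}
    (h : parity s ≠ parity t) : hamiltonian n Jx Jy Jz s t = 0 := by
  have h1 := hamiltonian_mulVec hn Jx Jy Jz (Pi.single t 1) s
  rw [Matrix.mulVec_single_one, Matrix.col_apply] at h1
  rw [h1]
  have e1 : ∀ j, (Pi.single t 1 : Conf n → ℂ) (flip j s) = 0 := fun j =>
    Pi.single_eq_of_ne (fun h2 => h (by rw [← h2, parity_flip])) 1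
  have e2 : (Pi.single t 1 : Conf n → ℂ) s = 0 :=
    Pi.single_eq_of_ne (fun h2 => h (by rw [h2])) 1
  simp [e1, e2]

lemma analyticAt_hamiltonian {f g k : ℂ → ℂ} {x : ℂ} (hf : AnalyticAt ℂ f x)
    (hg : AnalyticAt ℂ g x) (hk : AnalyticAt ℂ k x) (s t : Conf n) :
    AnalyticAt ℂ (fun η => hamiltonian n (f η) (g η) (k η) s t) x := by
  simp only [hamiltonian_eq_bondSum, Matrix.smul_apply, Matrix.add_apply, smul_eq_mul]
  exact analyticAt_const.mul (((hf.mul analyticAt_const).add (hg.mul analyticAt_const)).add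
    (hk.mul analyticAt_const))

lemma IsEvenMode.isSimpleEigen (hn : n ≠ 0) {r : Conf n → ℝ} (hr : IsEvenMode n ζ r) :
    IsSimpleEigen (fun s : Conf n => parity s ≠ 1) (susyHamiltonian n ζ)
      (groundEnergy n ζ : ℂ) (toC r) where
  supp s hs := by simp [toC, hr.odd s (not_not.mp hs)]
  block s t hs ht := hamiltonian_apply_eq_zero hn _ _ _ (by rw [not_not.mp hs]; exact ht.symm)
  eigen := susyHamiltonian_toC hn hr
  symm ψ := hamiltonian_symm hn _ _ _ _ ψ
  self_ne := by
    rw [toC_dotProduct_self]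
    exact_mod_cast (sqNorm_pos hr.ne_zero).ne'
  span ψ hψ h := by
    obtain ⟨c, hc⟩ := hr.span ψ (fun s hs => hψ s (not_not.mpr hs))
      ((susyHamiltonian_mulVec_eq_iff hn ψ).mp h)
    exact ⟨c, funext hc⟩

/-- Existence of the analytic family of eigenvectors. -/
theorem exists_isGroundStateFamily (hn : n ≠ 0) (hτ : 0 < τ.im)
    (hζ : zeta eta0 τ = (ζ : ℂ)) {r : Conf n → ℝ} (hr : IsEvenMode n ζ r) :
    ∃ (Ψ : ℂ → Conf n → ℂ) (Λ : ℂ → ℂ → ℂ), IsGroundStateFamily n τ ζ Ψ Λ := by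
  have h4 := theta4_two_eta0_ne_zero hτ
  set H : ℂ → Op n := fun η => hamiltonian n (1 + zeta η τ) (1 - zeta η τ) (Gam η τ) with hH
  have hs := hr.isSimpleEigen hn
  rw [susyHamiltonian_eq_hamiltonian hτ hζ] at hs
  have hzan := analyticAt_zeta hτ h4
  obtain ⟨Ψ, E, han, hx, hev⟩ := exists_analytic_eigenvector (A := H) (x := eta0)
    (P := fun s : Conf n => parity s ≠ 1) (fun s t => analyticAt_hamiltonian
      (analyticAt_const.add hzan) (analyticAt_const.sub hzan) (analyticAt_Gam hτ h4) s t)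
    (fun η s t hs ht => hamiltonian_apply_eq_zero hn _ _ _ (by
      rw [not_not.mp hs]; exact ht.symm)) hs
  refine ⟨Ψ, fun u η => (toC r ⬝ᵥ (transfer n u η τ).mulVec (Ψ η)) / (toC r ⬝ᵥ toC r), han, ?_,
    ?_, ?_, ?_⟩
  · rw [hx, isGroundState_iff hn (ne_zero_of_zeta hτ hζ), ← susyHamiltonian_mulVec_eq_iff hn]
    refine ⟨susyHamiltonian_toC hn hr, fun h => hs.self_ne (by rw [h, dotProduct_zero])⟩
  · filter_upwards [hev] with η h
    rw [isEven_iff]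
    exact fun s hs => h.2.1 s (not_not.mpr hs)
  · filter_upwards [hev] with η h
    exact ⟨E η, (hasEigenvector_iff _ _ _).mpr ⟨h.2.2.1, h.1⟩⟩
  · filter_upwards [hev, eventually_theta4_ne_zero hτ, eventually_theta1_ne_zero hτ]
      with η h h4 h1 u
    obtain ⟨-, hodd, heig, huniq⟩ := h
    -- The image of `Ψ η` under the transfer matrix is again even and has the same energy, because
    -- the two operators commute. By uniqueness it is a multiple of `Ψ η`, with the factor read off
    -- by pairing with `toC r`.
    refine huniq _ (fun s hs => ?_) ?_
    · exact mulVec_eq_zero_of_block (P := fun s : Conf n => parity s ≠ 1)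
        (fun s t hs ht => transfer_apply_eq_zero u η τ (by rw [not_not.mp hs]; exact ht.symm))
        hodd hs
    · rw [Matrix.mulVec_mulVec, hH, transfer_commute hn hτ h4 h1, ← Matrix.mulVec_mulVec]
      rw [hH] at heig
      simp only at heig
      rw [heig, Matrix.mulVec_smul]

end Existence

/-! ### The chain with a single site -/

section SingleSite
variable {τ : ℂ} {ζ : ℝ} {Ψ : ℂ → Conf 0 → ℂ} {Λ : ℂ → ℂ → ℂ}

/-- With one site, `j + 1 = j` and the bond operator is a square. All correlations are therefore 1
and `f = 0`. -/
lemma bond_single_site {A : Matrix (Fin 2) (Fin 2) ℂ} (hA : A * A = 1)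
    (j : Fin (2 * 0 + 1)) : (bond A j : Op 0) = 1 := by
  have h : Subsingleton (Fin (2 * 0 + 1)) := inferInstanceAs (Subsingleton (Fin 1))
  rw [bond_eq_tens, h.elim (j + 1) j, ← Pi.mulSingle_mul, hA, Pi.mulSingle_one, tens_one]

lemma sigmaX_mul_self : sigmaX * sigmaX = 1 := by
  simp [sigmaX, Matrix.one_fin_two]

lemma sigmaY_mul_self : sigmaY * sigmaY = 1 := by
  simp [sigmaY, Matrix.one_fin_two]

lemma sigmaZ_mul_self : sigmaZ * sigmaZ = 1 := by
  simp [sigmaZ, Matrix.one_fin_two]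

lemma hamiltonian_single_site (Jx Jy Jz : ℂ) :
    hamiltonian 0 Jx Jy Jz = (-(1 / 2) * (Jx + Jy + Jz)) • (1 : Op 0) := by
  simp only [hamiltonian, bond_single_site sigmaX_mul_self, bond_single_site sigmaY_mul_self,
    bond_single_site sigmaZ_mul_self, ← add_smul]
  simp [smul_smul]

lemma isGroundState_single_site {ψ : Conf 0 → ℂ} (hψ : ψ ≠ 0) :
    IsGroundState (susyHamiltonian 0 ζ) ψ := by
  have h : ∀ φ : Conf 0 → ℂ, (susyHamiltonian 0 ζ).mulVec φ =
      ((-(1 / 2) * (2 + (ζ ^ 2 - 1) / 2) : ℝ) : ℂ) • φ := by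
    intro φ
    rw [susyHamiltonian, hamiltonian_single_site, Matrix.smul_mulVec, Matrix.one_mulVec]
    congr 1
    push_cast
    ring
  have hv := (hasEigenvector_iff (susyHamiltonian 0 ζ) _ ψ).mpr ⟨h ψ, hψ⟩
  refine ⟨_, ⟨Module.End.hasEigenvalue_of_hasEigenvector hv, fun E hE => le_of_eq ?_⟩, hv⟩
  obtain ⟨φ, hφ⟩ := hE.exists_hasEigenvector
  rw [hasEigenvector_iff, h] at hφ
  exact_mod_cast smul_left_injective ℂ hφ.2 hφ.1

lemma isCorrelationQuantity_single_site (f : ℂ) : IsCorrelationQuantity 0 ζ f ↔ f = 0 := by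
  have h3 : ((ζ : ℂ) ^ 2 + 3) ≠ 0 := by exact_mod_cast (by positivity : ζ ^ 2 + 3 ≠ 0)
  have he : ∀ {ψ : Conf 0 → ℂ} {A : Matrix (Fin 2) (Fin 2) ℂ} (j : Fin (2 * 0 + 1)), ψ ≠ 0 →
      A * A = 1 → expectation ψ (bond A j) = 1 := by
    intro ψ A j hψ hA
    rw [expectation, bond_single_site hA, Matrix.one_mulVec, div_self]
    obtain ⟨d, hd, hd'⟩ := star_dotProduct_self_pos hψ
    rw [hd']
    exact_mod_cast hd.ne'
  constructor
  · intro h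
    have hne : (1 : Conf 0 → ℂ) ≠ 0 := one_ne_zero
    have h1 := (h 1 (isGroundState_single_site hne) 0).2.2
    rw [he 0 hne sigmaZ_mul_self, eq_comm, sub_eq_self, div_eq_zero_iff] at h1
    simpa [h3] using h1
  · rintro rfl ψ ⟨E, -, hE⟩ j
    have hψ := hE.2
    simp [he j hψ sigmaX_mul_self, he j hψ sigmaY_mul_self, he j hψ sigmaZ_mul_self]

lemma transfer_single_site (u η τ : ℂ) :
    transfer 0 u η τ = (weightA u η τ + weightB u η τ) • (1 : Op 0) := by
  ext s t
  have hsub : Subsingleton (Fin (2 * 0 + 1)) := inferInstanceAs (Subsingleton (Fin 1))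
  have h0 : ∀ k : Fin (2 * 0 + 1), k = 0 := fun k => hsub.elim k 0
  have h : ∀ {s t : Conf 0}, (s = t) ↔ s 0 = t 0 := by
    intro s t
    refine ⟨fun h => by rw [h], fun h => funext fun k => ?_⟩
    rwa [h0 k]
  simp only [transfer, Matrix.of_apply, Matrix.smul_apply, Matrix.one_apply, h, smul_eq_mul]
  have hl : ∀ g : Fin (2 * 0 + 1) → Matrix (Fin 2 × Conf 0) (Fin 2 × Conf 0) ℂ,
      (List.ofFn g).prod = g 0 := fun g => by
    rw [List.ofFn_succ, List.ofFn_zero, List.prod_singleton]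
  simp only [hl, rSite, Matrix.of_apply, h0, ne_eq, not_true_eq_false, false_imp_iff,
    implies_true, if_true, Fin.sum_univ_two, rMatrix_apply]
  generalize s 0 = x
  generalize t 0 = y
  fin_cases x <;> fin_cases y <;> simp [add_comm]

lemma exists_isGroundStateFamily_single_site (τ : ℂ) (ζ : ℝ) :
    ∃ (Ψ : ℂ → Conf 0 → ℂ) (Λ : ℂ → ℂ → ℂ), IsGroundStateFamily 0 τ ζ Ψ Λ := by
  have hne : (Pi.single 0 1 : Conf 0 → ℂ) ≠ 0 := by simp
  refine ⟨fun _ => Pi.single 0 1, fun u η => weightA u η τ + weightB u η τ, analyticAt_const,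
    isGroundState_single_site hne, Eventually.of_forall fun η => ?_,
    Eventually.of_forall fun η => ?_, Eventually.of_forall fun η u => ?_⟩
  · rw [isEven_iff]
    intro s hs
    refine Pi.single_eq_of_ne ?_ 1
    rintro rfl
    rw [parity_zero] at hs
    exact zero_ne_one hs
  · refine ⟨-(1 / 2) * ((1 + zeta η τ) + (1 - zeta η τ) + Gam η τ),
      (hasEigenvector_iff _ _ _).mpr ⟨?_, hne⟩⟩
    rw [hamiltonian_single_site, Matrix.smul_mulVec, Matrix.one_mulVec]
  · rw [transfer_single_site, Matrix.smul_mulVec, Matrix.one_mulVec]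

/-- For a single site the eigenvalue of the transfer matrix factorizes. -/
theorem IsGroundStateFamily.eigenvalue_single_site (hτ : 0 < τ.im)
    (F : IsGroundStateFamily 0 τ ζ Ψ Λ) :
    AnalyticAt ℂ (fun p : ℂ × ℂ => Λ p.1 p.2) (eta0, eta0) ∧ Λ eta0 eta0 ≠ 0 ∧
      deriv (fun η => deriv (fun u => Λ u η) eta0) eta0 * Λ eta0 eta0 -
        deriv (fun u => Λ u eta0) eta0 * deriv (fun η => Λ eta0 η) eta0 = 0 := by
  set g : ℂ → ℂ := fun η => rho τ * theta4 (2 * η) (2 * τ) * theta2 η τ with hg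
  have hev : ∀ᶠ η in 𝓝 eta0, ∀ u, Λ u η = g η * theta1 u τ := by
    filter_upwards [F.eigen, F.transfer_eigen] with η ⟨E, hE⟩ hT u
    have h := hT u
    rw [transfer_single_site, Matrix.smul_mulVec, Matrix.one_mulVec] at h
    rw [← smul_left_injective ℂ hE.2 h, weightA_add_weightB u η hτ, hg]
    ring
  have hgan : AnalyticAt ℂ g eta0 := (analyticAt_const.mul (analyticAt_theta4_comp
    (im_two_mul_pos hτ) (analyticAt_two_mul eta0))).mul (analyticAt_theta2_comp hτ analyticAt_id)
  have h0 := hev.self_of_nhds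
  refine ⟨?_, ?_, ?_⟩
  · have h1 : AnalyticAt ℂ (fun p : ℂ × ℂ => g p.2 * theta1 p.1 τ) (eta0, eta0) :=
      (AnalyticAt.fun_comp (f := fun p : ℂ × ℂ => p.2) (g := g) hgan analyticAt_snd).mul
        (analyticAt_theta1_comp hτ analyticAt_fst)
    refine h1.congr ?_
    have h2 : Tendsto (fun p : ℂ × ℂ => p.2) (𝓝 (eta0, eta0)) (𝓝 eta0) :=
      continuous_snd.continuousAt
    filter_upwards [h2.eventually hev] with p hp
    exact (hp p.1).symm
  · rw [h0]
    exact mul_ne_zero (mul_ne_zero (mul_ne_zero (rho_ne_zero hτ) (theta4_two_eta0_ne_zero hτ))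
      (theta2_eta0_ne_zero hτ)) (theta1_eta0_ne_zero hτ)
  · have h1 : (fun η => deriv (fun u => Λ u η) eta0) =ᶠ[𝓝 eta0]
        fun η => g η * deriv (fun u => theta1 u τ) eta0 := by
      filter_upwards [hev] with η h
      rw [funext h]
      exact deriv_const_mul_field _
    have h2 : (fun η => Λ eta0 η) =ᶠ[𝓝 eta0] fun η => g η * theta1 eta0 τ := by
      filter_upwards [hev] with η h using h eta0
    have h3 : deriv (fun u => Λ u eta0) eta0 = g eta0 * deriv (fun u => theta1 u τ) eta0 :=
      h1.self_of_nhds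
    rw [h1.deriv_eq, h2.deriv_eq, h3, h0, deriv_mul_const_field,
      deriv_mul_const_field]
    ring

end SingleSite

end XYZ

end

theorem proposition3p3 (n : ℕ) (τ : ℂ) (hτ : 0 < τ.im) (ζ : ℝ)
    (hζ : XYZ.zeta XYZ.eta0 τ = (ζ : ℂ)) :
    (∃ (Ψ : ℂ → XYZ.Conf n → ℂ) (Λ : ℂ → ℂ → ℂ), XYZ.IsGroundStateFamily n τ ζ Ψ Λ) ∧
    ∀ (Ψ : ℂ → XYZ.Conf n → ℂ) (Λ : ℂ → ℂ → ℂ), XYZ.IsGroundStateFamily n τ ζ Ψ Λ →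
      AnalyticAt ℂ (fun p : ℂ × ℂ => Λ p.1 p.2) (XYZ.eta0, XYZ.eta0) ∧
      Λ XYZ.eta0 XYZ.eta0 ≠ 0 ∧ XYZ.chi τ ≠ 0 ∧
      ∀ f : ℂ, XYZ.IsCorrelationQuantity n ζ f ↔
        f = ((ζ : ℂ) ^ 2 + 3) / (12 * (2 * (n : ℂ) + 1) * XYZ.chi τ) *
          ((deriv (fun η => deriv (fun u => Λ u η) XYZ.eta0) XYZ.eta0 * Λ XYZ.eta0 XYZ.eta0 -
              deriv (fun u => Λ u XYZ.eta0) XYZ.eta0 * deriv (fun η => Λ XYZ.eta0 η) XYZ.eta0) /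
            Λ XYZ.eta0 XYZ.eta0 ^ 2) := by
  -- For a single site the two ends of a bond coincide and the spin-flip description fails. There
  -- `Λ` is a product of a function of `u` and a function of `η`, so both sides vanish.
  rcases eq_or_ne n 0 with rfl | hn
  · refine ⟨XYZ.exists_isGroundStateFamily_single_site τ ζ, fun Ψ Λ F => ?_⟩
    obtain ⟨h1, h2, h3⟩ := F.eigenvalue_single_site hτ
    refine ⟨h1, h2, XYZ.chi_ne_zero hτ, fun f => ?_⟩
    rw [XYZ.isCorrelationQuantity_single_site, h3, zero_div, mul_zero]
  · have hz := XYZ.ne_zero_of_zeta hτ hζ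
    obtain ⟨q, hq⟩ := XYZ.exists_isZeroMode hn hz
    have hr := hq.isEvenMode hn
    refine ⟨XYZ.exists_isGroundStateFamily hn hτ hζ hr, fun Ψ Λ F => ?_⟩
    obtain ⟨h1, h2, h3⟩ := F.corrQuantity_eq hn hτ hζ hr
    refine ⟨h1, h2, XYZ.chi_ne_zero hτ, fun f => ?_⟩
    rw [XYZ.isCorrelationQuantity_iff hn hz hq, h3]
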